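/- Let $d\ge 1$ and let $\mathbb{H}^d=\mathbb{C}^d\times\mathbb{R}$ be the Heisenberg group with Lebesgue measure $dz\,dt$, Koranyi norm $\rho=|(z,t)|_{\mathbb{H}}=(|z|^4+t^2)^{1/4}$, and, with $z_j=x_j+iy_j$, the fields $X_j=\partial_{x_j}+2y_j\partial_t$, $Y_j=\partial_{y_j}-2x_j\partial_t$, $\nabla_{\mathbb{H}}=(X_1,\dots,X_d,Y_1,\dots,Y_d)$, $\mathcal{L}=-\sum_j(X_j^2+Y_j^2)$. Let $\|\cdot\|$ be the $L^2(\mathbb{H}^d)$-norm and $H^1(\mathbb{H}^d)$ the space of $u\in L^2(\mathbb{H}^d;\mathbb{C})$ with weak horizontal gradient $\nabla_{\mathbb{H}}u\in L^2$. Let $\partial_\rho=\rho^{-1}(z\cdot\nabla_z+2t\,\partial_t)$, so that $\partial_\rho(\rho V)=V+\rho\,\partial_\rho V$. A function is radial if it depends (a.e.) only on $\rho$. Let $V\in L^1_{\mathrm{loc}}(\mathbb{H}^d;\mathbb{R})\cap W^{1,d}_{\mathrm{loc}}(\mathbb{H}^d;\mathbb{R})$ and $0\le b_1,b_2<1$ be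 such that, for all $\psi\in H^1(\mathbb{H}^d)$, $$\int V_-|\psi|^2\le b_1^2\int|\nabla_{\mathbb{H}}\psi|^2,\qquad \int[\partial_\rho(\rho V)]_+|\psi|^2\le b_2^2\int|\nabla_{\mathbb{H}}\psi|^2,$$ where $V_-=\max\{0,-V\}$ and $[\cdot]_+=\max\{0,\cdot\}$. Let $\lambda=\lambda_1+i\lambda_2\in\mathbb{C}$, let $f:\mathbb{H}^d\to\mathbb{C}$ be measurable, and let $u\in H^1(\mathbb{H}^d)$ be a radial weak solution of $-\mathcal{L}u-Vu+\lambda u=f$, that is, $$-\langle\nabla_{\mathbb{H}}v,\nabla_{\mathbb{H}}u\rangle-\langle v,Vu\rangle+\lambda\langle v,u\rangle=\langle v,f\rangle$$ for all $v\in H^1(\mathbb{H}^d)$ for which the integrals $\langle v,Vu\rangle=\int\overline{v}\,Vu$ and $\langle v,f\rangle=\int\overline{v}f$ converge absolutely. Put $\operatorname{sgn}(w)=w/|w|$ for $w\ne0$, $\operatorname{sgn}(0)=1$, and $$u^-=e^{-i\psi}u,\qquad \psi(z,t)=\sqrt{\tfrac d2}\,\frac{\Gamma(d/2)}{\Gamma((d+1)/2)}\,\operatorname{sgn}(\lambda_2)\sqrt{|\lambda_1|}\,|(z,t)|_{\mathbb{H}}.$$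 Then for every $\delta>0$ (the norms of weighted $f$ may be $+\infty$): $$\|\nabla_{\mathbb{H}}u\|\le\frac{1+1/\delta}{d(1-b_1^2)}\Big\|\frac{\rho^2}{|z|}f\Big\|\quad\text{if }|\lambda_2|>\delta\lambda_1,$$ $$u^-\in H^1(\mathbb{H}^d),\quad \|\nabla_{\mathbb{H}}u^-\|\le M_{d,b_2}(\delta)\Big\|\frac{\rho^2}{|z|}f\Big\|\quad\text{if }|\lambda_2|\le\delta\lambda_1,$$ where $M_{d,b_2}(\delta)=\min_{\gamma_1>0,\;0<\gamma_2<1}\big(a+\sqrt{a^2+b}\big)$ with $$a=\frac{4d+1+\frac{\gamma_1\sqrt\delta}{2}+\frac{1}{1-b_2^2}\Big(\frac{\sqrt\delta}{8d\gamma_2}\Big)^2}{2d(1-b_2^2)(1-\gamma_2^2)},\qquad b=\frac{\sqrt\delta}{2\gamma_1(1-b_2^2)(1-\gamma_2^2)}.$$ In particular, $$\Big\|\frac{|z|}{\rho^2}u\Big\|\le\mu_{d,b_1,b_2}\Big\|\frac{\rho^2}{|z|}f\Big\|,\qquad \mu_{d,b_1,b_2}=\min_{\delta>0}\max\Big\{\frac{1+1/\delta}{d^2(1-b_1^2)},\frac{M_{d,b_2}(\delta)}{d}\Big\}.$$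 (Both minima are attained.) -/

import Mathlib

open MeasureTheory
open scoped ENNReal ContDiff

namespace HeisenbergResolvent

noncomputable section

/-- The Heisenberg group `ℍ^d = ℂ^d × ℝ`. Its Haar measure `volume` is Lebesgue measure `dz dt`. The
sup norm that Lean puts on the product is used only through the topology and the (norm independent)
notions of derivative and local integrability. -/
abbrev Heis (d : ℕ) : Type := (Fin d → ℂ) × ℝ

variable {d : ℕ}

/-- `|z|`, the Euclidean norm of the horizontal variable of `(z, t)`. -/
def zNorm (p : Heis d) : ℝ := Real.sqrt (∑ j, ‖p.1 j‖ ^ 2)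

/-- The Koranyi norm `(|z|^4 + t^2)^(1/4)`. -/
def koranyi (p : Heis d) : ℝ := (zNorm p ^ 4 + p.2 ^ 2) ^ (1 / 4 : ℝ)

/-- The left-invariant field `X_j = ∂_{x_j} + 2 y_j ∂_t`. -/
def fieldX (j : Fin d) (p : Heis d) : Heis d := (Pi.single j 1, 2 * (p.1 j).im)

/-- The left-invariant field `Y_j = ∂_{y_j} - 2 x_j ∂_t`. -/
def fieldY (j : Fin d) (p : Heis d) : Heis d := (Pi.single j Complex.I, -2 * (p.1 j).re)

/-- The horizontal frame `(X_1, …, X_d, Y_1, …, Y_d)`. -/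
def horizontalFrame : Fin d ⊕ Fin d → Heis d → Heis d
  | Sum.inl j => fieldX j
  | Sum.inr j => fieldY j

/-- `φ` is a real test function, `φ ∈ C_c^∞(ℍ^d)`. -/
def IsTestFunction (φ : Heis d → ℝ) : Prop := ContDiff ℝ ∞ φ ∧ HasCompactSupport φ

/-- `g` is the derivative of `u` along the vector field `Z` in the weak (distributional) sense.
It is used only for divergence-free `Z` (the fields `X_j`, `Y_j` and the constant fields), for which
the formal adjoint of `Z` is `-Z`. -/
def HasWeakDerivAlong {F : Type*} [NormedAddCommGroup F] [NormedSpace ℝ F]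
    (Z : Heis d → Heis d) (u g : Heis d → F) : Prop :=
  ∀ φ : Heis d → ℝ, IsTestFunction φ →
    ∫ p, fderiv ℝ φ p (Z p) • u p = - ∫ p, φ p • g p

/-- `u ∈ H^1(ℍ^d)`, with weak horizontal gradient `∇_ℍ u = g`: both are square integrable. -/
structure MemH1 (u : Heis d → ℂ) (g : Heis d → EuclideanSpace ℂ (Fin d ⊕ Fin d)) : Prop where
  memLp : MemLp u 2 volume
  memLp_grad : MemLp g 2 volume
  weakDeriv : ∀ i, HasWeakDerivAlong (horizontalFrame i) u (fun p => g p i)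

/-- `h ∈ L^q_loc(ℍ^d)`. -/
def MemLpLoc {F : Type*} [NormedAddCommGroup F] (h : Heis d → F) (q : ℝ≥0∞) : Prop :=
  ∀ K : Set (Heis d), IsCompact K → MemLp h q (volume.restrict K)

/-- `V ∈ W^{1,q}_loc(ℍ^d; ℝ)`, with (full) weak differential `DV`. -/
structure MemW1Loc (q : ℝ≥0∞) (V : Heis d → ℝ) (DV : Heis d → (Heis d →L[ℝ] ℝ)) : Prop where
  memLpLoc : MemLpLoc V q
  memLpLoc_deriv : MemLpLoc DV q
  weakDeriv : ∀ e : Heis d, HasWeakDerivAlong (fun _ => e) V (fun p => DV p e)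

/-- The radial derivative `∂_ρ V = |(z,t)|_ℍ⁻¹ 𝔼 V`, with the Euler field `𝔼 = z·∇_z + 2t ∂_t`,
of a function with weak differential `DV`. -/
def radialDeriv (DV : Heis d → (Heis d →L[ℝ] ℝ)) (p : Heis d) : ℝ :=
  (koranyi p)⁻¹ * DV p (p.1, 2 * p.2)

/-- `∂_ρ (|(z,t)|_ℍ V) = V + |(z,t)|_ℍ ∂_ρ V`, for `V` with weak differential `DV`. -/
def radialDerivMul (V : Heis d → ℝ) (DV : Heis d → (Heis d →L[ℝ] ℝ)) (p : Heis d) : ℝ :=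
  V p + koranyi p * radialDeriv DV p

/-- `∫ W |ψ|^2 ≤ b^2 ∫ |∇_ℍ ψ|^2` for all `ψ ∈ H^1(ℍ^d)`, for a weight `W ≥ 0`. -/
def FormBounded (W : Heis d → ℝ) (b : ℝ) : Prop :=
  ∀ (ψ : Heis d → ℂ) (g : Heis d → EuclideanSpace ℂ (Fin d ⊕ Fin d)), MemH1 ψ g →
    ∫⁻ p, ENNReal.ofReal (W p) * ‖ψ p‖ₑ ^ 2 ≤ ENNReal.ofReal (b ^ 2) * ∫⁻ p, ‖g p‖ₑ ^ 2

/-- `u` is radial: almost everywhere a function of the Koranyi norm. -/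
def IsRadial (u : Heis d → ℂ) : Prop :=
  ∃ u₀ : ℝ → ℂ, ∀ᵐ p : Heis d, u p = u₀ (koranyi p)

/-- `u ∈ H^1`, with `∇_ℍ u = gu`, is a weak solution of `-𝓛u - Vu + l u = f`: for `v ∈ H^1`,
`- ⟨∇_ℍ v, ∇_ℍ u⟩ - ⟨v, Vu⟩ + l ⟨v, u⟩ = ⟨v, f⟩`, the brackets being conjugate-linear in `v`.
The identity is required for those `v` only for which the integrals defining `⟨v, Vu⟩` and
`⟨v, f⟩` converge absolutely. -/
structure IsWeakSolution (V : Heis d → ℝ) (l : ℂ) (f u : Heis d → ℂ)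
    (gu : Heis d → EuclideanSpace ℂ (Fin d ⊕ Fin d)) : Prop where
  memH1 : MemH1 u gu
  equation : ∀ (v : Heis d → ℂ) (gv : Heis d → EuclideanSpace ℂ (Fin d ⊕ Fin d)), MemH1 v gv →
    Integrable (fun p => star (v p) * ((V p : ℂ) * u p)) →
    Integrable (fun p => star (v p) * f p) →
    - (∫ p, inner ℂ (gv p) (gu p)) - (∫ p, star (v p) * ((V p : ℂ) * u p))
      + l * (∫ p, star (v p) * u p) = ∫ p, star (v p) * f p

/-- The sign function with `sgn 0 = 1`. -/
def sgn (w : ℝ) : ℝ := if w = 0 then 1 else w / |w|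

/-- The phase
`√(d/2) Γ(d/2) / Γ((d+1)/2) sgn(Im l) √|Re l| |(z,t)|_ℍ`. -/
def phase (l : ℂ) (p : Heis d) : ℝ :=
  Real.sqrt ((d : ℝ) / 2) * (Real.Gamma ((d : ℝ) / 2) / Real.Gamma (((d : ℝ) + 1) / 2))
    * sgn l.im * Real.sqrt |l.re| * koranyi p

/-- `u^- = e^{-iψ} u`, with `ψ` the phase above. -/
def uMinus (l : ℂ) (u : Heis d → ℂ) (p : Heis d) : ℂ :=
  Complex.exp (-(Complex.I * (phase l p : ℂ))) * u p

/-- The weighted norm `‖ (|(z,t)|_ℍ^2 / |z|) f ‖_{L^2}`, possibly infinite. -/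
def sourceNorm (f : Heis d → ℂ) : ℝ≥0∞ :=
  eLpNorm (fun p : Heis d => ((koranyi p ^ 2 / zNorm p : ℝ) : ℂ) * f p) 2 volume

/-- The weighted norm `‖ (|z| / |(z,t)|_ℍ^2) u ‖_{L^2}`. -/
def hardyNorm (u : Heis d → ℂ) : ℝ≥0∞ :=
  eLpNorm (fun p : Heis d => ((zNorm p / koranyi p ^ 2 : ℝ) : ℂ) * u p) 2 volume

/-- The term `a` in the definition of `g_{d,δ,b₂}(γ₁,γ₂)`. -/
def aConst (d : ℕ) (δ b₂ γ₁ γ₂ : ℝ) : ℝ :=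
  (4 * d + 1 + γ₁ * Real.sqrt δ / 2 + 1 / (1 - b₂ ^ 2) * (Real.sqrt δ / (8 * d * γ₂)) ^ 2)
    / (2 * d * (1 - b₂ ^ 2) * (1 - γ₂ ^ 2))

/-- The term `b` in the definition of `g_{d,δ,b₂}(γ₁,γ₂)`. -/
def bConst (δ b₂ γ₁ γ₂ : ℝ) : ℝ :=
  Real.sqrt δ / (2 * γ₁ * (1 - b₂ ^ 2) * (1 - γ₂ ^ 2))

/-- `g_{d,δ,b₂}(γ₁,γ₂) = a + √(a^2 + b)`. -/
def gConst (d : ℕ) (δ b₂ γ₁ γ₂ : ℝ) : ℝ :=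
  aConst d δ b₂ γ₁ γ₂ + Real.sqrt (aConst d δ b₂ γ₁ γ₂ ^ 2 + bConst δ b₂ γ₁ γ₂)

/-- The values `g_{d,δ,b₂}(γ₁,γ₂)`, `γ₁ > 0`, `0 < γ₂ < 1`, whose minimum is `M_{d,b₂}(δ)`. -/
def MValues (d : ℕ) (b₂ δ : ℝ) : Set ℝ :=
  {x | ∃ γ₁ γ₂ : ℝ, 0 < γ₁ ∧ 0 < γ₂ ∧ γ₂ < 1 ∧ x = gConst d δ b₂ γ₁ γ₂}

/-- `M_{d,b₂}(δ)`. -/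
def MConst (d : ℕ) (b₂ δ : ℝ) : ℝ := sInf (MValues d b₂ δ)

/-- The values `max {(1 + 1/δ) / (d^2 (1 - b₁^2)), M_{d,b₂}(δ) / d}`, `δ > 0`, whose minimum is
`μ_{d,b₁,b₂}`. -/
def μValues (d : ℕ) (b₁ b₂ : ℝ) : Set ℝ :=
  {x | ∃ δ : ℝ, 0 < δ ∧
    x = max ((1 + 1 / δ) / ((d : ℝ) ^ 2 * (1 - b₁ ^ 2))) (MConst d b₂ δ / d)}

/-- `μ_{d,b₁,b₂}`. -/
def μConst (d : ℕ) (b₁ b₂ : ℝ) : ℝ := sInf (μValues d b₁ b₂)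

end

end HeisenbergResolvent

/-! The problem reduces to an ordinary differential equation for the profile of `u`. The Heisenberg
dilations give polar coordinates in which `dz dt` is `c r^(2d+1) dr ⊗ σ`, with `σ` a probability
measure on the Koranyi unit sphere (`exists_polarDecomposition`). Since `|∇_ℍ ρ|² = |z|²/ρ²` is
homogeneous of degree zero, radial functions see it only through its mean `κ` over the sphere
(`sphereMoment`). A radial `u ∈ H¹` equals `w(ρ)` with `w` locally absolutely continuous on `(0, ∞)`
(`exists_profile`), and radial test functions supported off the origin give `κ (w'' + (2d+1) w'/r) -
U w + λ w = F`, where `U` and `F` are the sphere averages of `V` and `f` (`exists_radial_equation`).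
The potential need not be radial: Jensen's inequality carries both form bounds over to `U` and `U +
r U'` (`radialFormBounded_max`), and Cauchy-Schwarz on the sphere bounds `‖r F‖/√κ` by the weighted
norm of `f` (`lintegral_source_le`). Integrating `exp(-ρ⁴) = exp(-|z|⁴) exp(-t²)` in two ways
evaluates `κ` (`sphereMoment_mul`) and shows that the slope `k` of the phase satisfies `κ k² =
|λ₁|`.

Hardy's inequality for the weight `r^(2d+1)` has constant `1/d²` (`radial_hardy`), so `∫ |w||F| ≤
‖w'‖ ‖r F‖ / d`. Outside the cone the equation is paired with the conjugate of `w`. The imaginary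
part bounds `|λ₂| ‖w‖²` by `∫ |w||F|`; as `λ₁ < |λ₂|/δ`, the real part then bounds `(1 - b₁²) κ
‖w'‖²` (`estimate_outside_cone`).

Inside the cone put `h = e^(-ikr) w`, which removes `λ₁`. The multiplier `2 r h' + (2d+1) h + τ r h`
with `τ = λ₂/(κk)` makes all remaining terms in `k` and `λ₂` purely imaginary
(`multiplier_identity`). The part carrying `τ` is the energy form of `√r h` minus `κ/4 ∫ |h|²/r`;
that form is nonnegative by the bound on `V₋`, and `τ ≥ 0` because the phase contains the sign of
`λ₂`. What is left, `κ ‖h'‖² - ∫ (U + r U')|h|²`, is coercive by the second form bound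
(`energy_bound`). For `X = √κ ‖h'‖`, the source norm `N` and `T = τ √κ ‖w‖` this is a quadratic
inequality, which two applications of Young's inequality, with parameters `γ₁` and `γ₂`, turn into
`X ≤ (a + √(a² + b)) N` (`estimate_inside_cone`, `le_gConst_mul`).

Integrations by parts of the radial equation use logarithmic cutoffs `η` with `r η' = O(1/n)`, so no
boundary behaviour at `0` or `∞` has to be known. The minima are attained because the constants blow
up at the boundary of the parameter domain (`bounds_of_gConst_le`). The uniform bound is Hardy's
inequality applied to `u` or to `u^-`, which have the same modulus. -/

namespace HeisenbergResolvent

open Set Filter Topology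

/-! ### Local integrability on the open half-line. -/

section LocallyIntegrable

variable {E : Type*} [NormedAddCommGroup E]

theorem uIcc_subset_Ioi {a b : ℝ} (ha : 0 < a) (hb : 0 < b) : uIcc a b ⊆ Ioi 0 := by
  intro x hx
  exact lt_of_lt_of_le (lt_min ha hb) hx.1

theorem locallyIntegrableOn_Ioi_of_Icc {B : ℝ → E}
    (h : ∀ a b, 0 < a → a ≤ b → IntegrableOn B (Icc a b)) : LocallyIntegrableOn B (Ioi 0) := by
  intro x hx
  have hx : 0 < x := hx
  exact ⟨Icc (x / 2) (2 * x), mem_nhdsWithin_of_mem_nhds (Icc_mem_nhds (by linarith)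
    (by linarith)), h _ _ (by linarith) (by linarith)⟩

theorem _root_.MeasureTheory.LocallyIntegrableOn.Icc {B : ℝ → E}
    (h : LocallyIntegrableOn B (Ioi 0)) {a b : ℝ} (ha : 0 < a) : IntegrableOn B (Icc a b) :=
  h.integrableOn_compact_subset (fun _ hx => lt_of_lt_of_le ha hx.1) isCompact_Icc

theorem _root_.MeasureTheory.LocallyIntegrableOn.interval {B : ℝ → E}
    (h : LocallyIntegrableOn B (Ioi 0)) {a b : ℝ} (ha : 0 < a) (hb : 0 < b) :
    IntervalIntegrable B volume a b :=
  (h.integrableOn_compact_subset (uIcc_subset_Ioi ha hb) isCompact_uIcc).intervalIntegrable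

end LocallyIntegrable

/-! ### Calculus of locally absolutely continuous functions on the half-line. -/

section LocallyAC

variable {E F : Type*} [NormedAddCommGroup E] [NormedSpace ℝ E] [NormedAddCommGroup F]
  [NormedSpace ℝ F]

/-- `A` is locally absolutely continuous on `(0, ∞)`, with derivative `B` almost everywhere. -/
structure HasACDeriv (A B : ℝ → E) : Prop where
  ac : ∀ a b, 0 < a → 0 < b → AbsolutelyContinuousOnInterval A a b
  deriv : ∀ᵐ x : ℝ, 0 < x → HasDerivAt A (B x) x

theorem absolutelyContinuousOnInterval_of_dist_le {X Y : Type*} [PseudoMetricSpace X]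
    [PseudoMetricSpace Y] {f : ℝ → X} {g : ℝ → Y} {a b C : ℝ}
    (hg : AbsolutelyContinuousOnInterval g a b)
    (h : ∀ x ∈ uIcc a b, ∀ y ∈ uIcc a b, dist (f x) (f y) ≤ C * dist (g x) (g y)) :
    AbsolutelyContinuousOnInterval f a b := by
  unfold AbsolutelyContinuousOnInterval at hg ⊢
  apply squeeze_zero' ?_ ?_ (by simpa using hg.const_mul C)
  · exact Filter.Eventually.of_forall <| fun _ ↦ Finset.sum_nonneg (fun i hi ↦ dist_nonneg)
  rw [eventually_inf_principal]
  filter_upwards with n hn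
  rw [Finset.mul_sum]
  exact Finset.sum_le_sum fun i hi => h _ (hn.1 i hi).1 _ (hn.1 i hi).2

namespace HasACDeriv

theorem congr_deriv {A B B' : ℝ → E} (h : HasACDeriv A B) (hB : ∀ᵐ x : ℝ, 0 < x → B x = B' x) :
    HasACDeriv A B' :=
  ⟨h.ac, by filter_upwards [h.deriv, hB] with x h1 h2 hx; exact h2 hx ▸ h1 hx⟩

theorem add {A B A' B' : ℝ → E} (h : HasACDeriv A B) (h' : HasACDeriv A' B') :
    HasACDeriv (fun x => A x + A' x) (fun x => B x + B' x) :=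
  ⟨fun a b ha hb => (h.ac a b ha hb).fun_add (h'.ac a b ha hb), by
    filter_upwards [h.deriv, h'.deriv] with x h1 h2 hx; exact (h1 hx).add (h2 hx)⟩

theorem clm {A B : ℝ → E} (h : HasACDeriv A B) (L : E →L[ℝ] F) :
    HasACDeriv (fun x => L (A x)) (fun x => L (B x)) :=
  ⟨fun a b ha hb => absolutelyContinuousOnInterval_of_dist_le (C := ‖L‖) (h.ac a b ha hb)
      fun x _ y _ => by
        rw [dist_eq_norm, dist_eq_norm, ← map_sub]; exact L.le_opNorm _, by
    filter_upwards [h.deriv] with x h1 hx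
    exact L.hasFDerivAt.comp_hasDerivAt x (h1 hx)⟩

theorem neg {A B : ℝ → E} (h : HasACDeriv A B) :
    HasACDeriv (fun x => - A x) (fun x => - B x) := by
  simpa using h.clm (-ContinuousLinearMap.id ℝ E)

theorem sub {A B A' B' : ℝ → E} (h : HasACDeriv A B) (h' : HasACDeriv A' B') :
    HasACDeriv (fun x => A x - A' x) (fun x => B x - B' x) := by
  simpa [sub_eq_add_neg] using h.add h'.neg

theorem mul {𝕜 : Type*} [RCLike 𝕜] {A B A' B' : ℝ → 𝕜} (h : HasACDeriv A B)
    (h' : HasACDeriv A' B') :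
    HasACDeriv (fun x => A x * A' x) (fun x => B x * A' x + A x * B' x) :=
  ⟨fun a b ha hb => (h.ac a b ha hb).fun_smul (h'.ac a b ha hb), by
    filter_upwards [h.deriv, h'.deriv] with x h1 h2 hx; exact (h1 hx).mul (h2 hx)⟩

theorem const_mul {𝕜 : Type*} [RCLike 𝕜] {A B : ℝ → 𝕜} (h : HasACDeriv A B) (c : 𝕜) :
    HasACDeriv (fun x => c * A x) (fun x => c * B x) :=
  h.clm (ContinuousLinearMap.mul ℝ 𝕜 c)

theorem re {A B : ℝ → ℂ} (h : HasACDeriv A B) :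
    HasACDeriv (fun x => (A x).re) (fun x => (B x).re) :=
  h.clm Complex.reCLM

theorem im {A B : ℝ → ℂ} (h : HasACDeriv A B) :
    HasACDeriv (fun x => (A x).im) (fun x => (B x).im) :=
  h.clm Complex.imCLM

theorem ofReal {A B : ℝ → ℝ} (h : HasACDeriv A B) :
    HasACDeriv (fun x => (A x : ℂ)) (fun x => (B x : ℂ)) :=
  h.clm Complex.ofRealCLM

/-- A continuous derivative is bounded on compact intervals, so the function is Lipschitz there. -/
theorem of_hasDerivAt {A B : ℝ → E} (h : ∀ x, 0 < x → HasDerivAt A (B x) x)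
    (hB : ContinuousOn B (Ioi 0)) : HasACDeriv A B := by
  refine ⟨fun a b ha hb => ?_, Eventually.of_forall h⟩
  have hsub := uIcc_subset_Ioi ha hb
  obtain ⟨C, hC⟩ := isCompact_uIcc.exists_bound_of_continuousOn (hB.mono hsub)
  refine LipschitzOnWith.absolutelyContinuousOnInterval (K := C.toNNReal) ?_
  refine (convex_uIcc a b).lipschitzOnWith_of_nnnorm_hasDerivWithin_le (f' := B)
    (fun x hx => (h x (hsub hx)).hasDerivWithinAt) fun x hx => ?_
  rw [← NNReal.coe_le_coe]
  exact (hC x hx).trans (Real.le_coe_toNNReal C)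

theorem continuousOn {A B : ℝ → E} (h : HasACDeriv A B) : ContinuousOn A (Ioi 0) := by
  intro x hx
  have hx : 0 < x := hx
  have h1 := (h.ac (x / 2) (2 * x) (by positivity) (by positivity)).continuousOn
  rw [uIcc_of_le (by linarith)] at h1
  exact (h1.continuousAt (Icc_mem_nhds (by linarith) (by linarith))).continuousWithinAt

theorem intervalIntegrable_real {A B : ℝ → ℝ} (h : HasACDeriv A B) {a b : ℝ} (ha : 0 < a)
    (hb : 0 < b) : IntervalIntegrable B volume a b ∧ ∫ x in a..b, B x = A b - A a := by
  have h1 : ∀ᵐ x, x ∈ uIoc a b → _root_.deriv A x = B x := by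
    filter_upwards [h.deriv] with x hx hxm
    exact (hx (uIcc_subset_Ioi ha hb (uIoc_subset_uIcc hxm))).deriv
  constructor
  · exact (h.ac a b ha hb).intervalIntegrable_deriv.congr_ae
      ((ae_restrict_iff' measurableSet_uIoc).2 h1)
  · rw [← (h.ac a b ha hb).integral_deriv_eq_sub]
    exact (intervalIntegral.integral_congr_ae h1).symm

theorem intervalIntegrable {A B : ℝ → ℂ} (h : HasACDeriv A B) {a b : ℝ} (ha : 0 < a)
    (hb : 0 < b) : IntervalIntegrable B volume a b := by
  have h1 := (h.re.intervalIntegrable_real ha hb).1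
  have h2 := (h.im.intervalIntegrable_real ha hb).1
  have h3 : IntervalIntegrable (fun x => ((B x).re : ℂ)) volume a b := ⟨h1.1.ofReal, h1.2.ofReal⟩
  have h4 : IntervalIntegrable (fun x => ((B x).im : ℂ)) volume a b := ⟨h2.1.ofReal, h2.2.ofReal⟩
  refine (h3.add (h4.mul_const Complex.I)).congr fun x _ => ?_
  exact Complex.re_add_im (B x)

theorem integral_eq_sub {A B : ℝ → ℂ} (h : HasACDeriv A B) {a b : ℝ} (ha : 0 < a)
    (hb : 0 < b) : ∫ x in a..b, B x = A b - A a := by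
  have h1 := (h.re.intervalIntegrable_real ha hb)
  have h2 := (h.im.intervalIntegrable_real ha hb)
  have hi := h.intervalIntegrable ha hb
  apply Complex.ext
  · have := Complex.reCLM.intervalIntegral_comp_comm hi
    simp only [Complex.reCLM_apply] at this
    rw [← this, h1.2, Complex.sub_re]
  · have := Complex.imCLM.intervalIntegral_comp_comm hi
    simp only [Complex.imCLM_apply] at this
    rw [← this, h2.2, Complex.sub_im]

end HasACDeriv

namespace HasACDeriv

theorem locallyIntegrableOn_real {A B : ℝ → ℝ} (h : HasACDeriv A B) :
    LocallyIntegrableOn B (Ioi 0) :=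
  locallyIntegrableOn_Ioi_of_Icc fun a b ha hab =>
    (intervalIntegrable_iff_integrableOn_Icc_of_le hab).1
      (h.intervalIntegrable_real ha (ha.trans_le hab)).1

theorem locallyIntegrableOn {A B : ℝ → ℂ} (h : HasACDeriv A B) :
    LocallyIntegrableOn B (Ioi 0) :=
  locallyIntegrableOn_Ioi_of_Icc fun a b ha hab =>
    (intervalIntegrable_iff_integrableOn_Icc_of_le hab).1
      (h.intervalIntegrable ha (ha.trans_le hab))

theorem deriv_eq_zero {A B : ℝ → E} (h : HasACDeriv A B) {a b : ℝ} 
    (hA : ∀ x, 0 < x → x ∉ Icc a b → A x = 0) :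
    ∀ᵐ x, 0 < x → x ∉ Icc a b → B x = 0 := by
  filter_upwards [h.deriv] with x hx h0 hxm
  have hev : A =ᶠ[𝓝 x] fun _ => 0 := by
    filter_upwards [isClosed_Icc.isOpen_compl.mem_nhds hxm, Ioi_mem_nhds h0] with y hy hy0
    exact hA y hy0 hy
  exact (hx h0).unique ((hasDerivAt_const x (0 : E)).congr_of_eventuallyEq hev)

/-- Enlarging `[a, b]` to `[a/2, b+1]` puts the endpoints where `A` is known to vanish, so the
fundamental theorem of calculus leaves no boundary terms. -/
theorem integrableOn_Ioi_aux {A B : ℝ → E} (h : HasACDeriv A B) {a b : ℝ} (ha : 0 < a)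
    (hA : ∀ x, 0 < x → x ∉ Icc a b → A x = 0) (hab : a < b) :
    IntegrableOn B (Ioi 0) = IntegrableOn B (Icc (a / 2) (b + 1)) ∧
    ∫ x in Ioi 0, B x = ∫ x in (a / 2)..(b + 1), B x := by
  have h0 := h.deriv_eq_zero hA
  have hsub : Icc (a / 2) (b + 1) ⊆ Ioi 0 := fun x hx => lt_of_lt_of_le (by linarith) hx.1
  have h1 : ∀ᵐ x, x ∈ Ioi 0 \ Icc (a / 2) (b + 1) → B x = 0 := by
    filter_upwards [h0] with x hx hxm
    exact hx hxm.1 fun hc => hxm.2 ⟨by linarith [hc.1], by linarith [hc.2]⟩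
  constructor
  · apply propext
    refine ⟨fun hi => hi.mono_set hsub, fun hi => ?_⟩
    exact hi.of_ae_sdiff_eq_zero measurableSet_Ioi.nullMeasurableSet h1
  · rw [intervalIntegral.integral_of_le (by linarith), ← integral_Icc_eq_integral_Ioc]
    exact (setIntegral_eq_of_subset_of_ae_sdiff_eq_zero measurableSet_Ioi.nullMeasurableSet
      hsub h1)

theorem integral_Ioi_real {A B : ℝ → ℝ} (h : HasACDeriv A B) {a b : ℝ} (ha : 0 < a) (hab : a < b)
    (hA : ∀ x, 0 < x → x ∉ Icc a b → A x = 0) :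
    IntegrableOn B (Ioi 0) ∧ ∫ x in Ioi 0, B x = 0 := by
  have h1 := h.integrableOn_Ioi_aux ha hA hab
  rw [h1.1, h1.2, (h.intervalIntegrable_real (by linarith) (by linarith)).2,
    hA (a / 2) (by linarith) (fun hc => by linarith [hc.1]),
    hA (b + 1) (by linarith) (fun hc => by linarith [hc.2])]
  exact ⟨h.locallyIntegrableOn_real.Icc (by linarith), by simp⟩

theorem integral_Ioi {A B : ℝ → ℂ} (h : HasACDeriv A B) {a b : ℝ} (ha : 0 < a) (hab : a < b)
    (hA : ∀ x, 0 < x → x ∉ Icc a b → A x = 0) :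
    IntegrableOn B (Ioi 0) ∧ ∫ x in Ioi 0, B x = 0 := by
  have h1 := h.integrableOn_Ioi_aux ha hA hab
  rw [h1.1, h1.2, (h.integral_eq_sub (by linarith) (by linarith)),
    hA (a / 2) (by linarith) (fun hc => by linarith [hc.1]),
    hA (b + 1) (by linarith) (fun hc => by linarith [hc.2])]
  exact ⟨h.locallyIntegrableOn.Icc (by linarith), by simp⟩

theorem of_locallyIntegrableOn_real {B : ℝ → ℝ} (h : LocallyIntegrableOn B (Ioi 0)) :
    HasACDeriv (fun x => ∫ t in (1 : ℝ)..x, B t) B := by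
  constructor
  · intro a b ha hb
    have h1 := (h.interval (a := min a 1) (b := max b 1) (by positivity) (by positivity))
    have hac := (h.interval ha hb).absolutelyContinuousOnInterval_intervalIntegral
      (c := a) left_mem_uIcc
    refine absolutelyContinuousOnInterval_of_dist_le (C := 1) hac fun x hx y hy => ?_
    have hx0 := uIcc_subset_Ioi ha hb hx
    have hy0 := uIcc_subset_Ioi ha hb hy
    rw [dist_eq_norm, dist_eq_norm, one_mul,
      intervalIntegral.integral_interval_sub_left (h.interval one_pos hx0) (h.interval one_pos hy0),
      intervalIntegral.integral_interval_sub_left (h.interval ha hx0) (h.interval ha hy0)]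
  -- Lebesgue differentiation is applied on compact intervals. The intervals `[1/(n+1), n+1]`
  -- exhaust `(0, ∞)` and all contain the base point `1`.
  · have h2 : ∀ n : ℕ, ∀ᵐ x, x ∈ uIcc ((1 : ℝ) / (n + 1)) (n + 1) →
        ∀ c ∈ uIcc ((1 : ℝ) / (n + 1)) (n + 1),
        HasDerivAt (fun x => ∫ (t : ℝ) in c..x, B t) (B x) x := fun n =>
      (h.interval (by positivity) (by positivity)).ae_hasDerivAt_integral
    filter_upwards [ae_all_iff.2 h2] with x hx hx0
    obtain ⟨n, hn⟩ := exists_nat_gt (max x (1 / x))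
    have hn1 : x < n := (le_max_left _ _).trans_lt hn
    have hn2 : 1 / x < n := (le_max_right _ _).trans_lt hn
    have hle : (1 : ℝ) / (n + 1) ≤ n + 1 := by
      rw [div_le_iff₀ (by positivity)]; nlinarith [(Nat.cast_nonneg n : (0 : ℝ) ≤ n)]
    refine hx n ?_ 1 ?_
    · rw [uIcc_of_le hle]
      refine ⟨?_, by linarith⟩
      rw [div_le_iff₀ (by positivity)]
      rw [div_lt_iff₀ hx0] at hn2
      nlinarith
    · rw [uIcc_of_le hle]
      refine ⟨?_, by linarith [(Nat.cast_nonneg n : (0 : ℝ) ≤ n)]⟩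
      rw [div_le_iff₀ (by positivity)]
      linarith [(Nat.cast_nonneg n : (0 : ℝ) ≤ n)]

theorem exists_of_locallyIntegrableOn {B : ℝ → ℂ} (h : LocallyIntegrableOn B (Ioi 0)) :
    ∃ A, HasACDeriv A B := by
  have hr : LocallyIntegrableOn (fun x => (B x).re) (Ioi 0) := fun x hx => by
    obtain ⟨s, hs, hi⟩ := h x hx
    exact ⟨s, hs, Integrable.re hi⟩
  have hm : LocallyIntegrableOn (fun x => (B x).im) (Ioi 0) := fun x hx => by
    obtain ⟨s, hs, hi⟩ := h x hx
    exact ⟨s, hs, Integrable.im hi⟩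
  refine ⟨_, ((of_locallyIntegrableOn_real hr).ofReal.add
    ((of_locallyIntegrableOn_real hm).ofReal.const_mul Complex.I)).congr_deriv
      (Eventually.of_forall fun x _ => ?_)⟩
  rw [mul_comm]
  exact Complex.re_add_im (B x)

end HasACDeriv

end LocallyAC

/-! ### Weak derivatives in one variable. -/

section WeakDerivative

/-- `F ∈ C_c^∞((0, ∞))`. -/
structure IsRadialTest (F : ℝ → ℝ) : Prop where
  contDiff : ContDiff ℝ ∞ F
  compact : HasCompactSupport F
  pos : tsupport F ⊆ Ioi 0

theorem IsRadialTest.exists_Icc {F : ℝ → ℝ} (hF : IsRadialTest F) :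
    ∃ a b : ℝ, 0 < a ∧ a < b ∧ ∀ x, x ∉ Icc a b → F x = 0 := by
  rcases (tsupport F).eq_empty_or_nonempty with he | hne
  · exact ⟨1, 2, one_pos, one_lt_two, fun x _ => image_eq_zero_of_notMem_tsupport (by simp [he])⟩
  · obtain ⟨a, ha, hamin⟩ := hF.compact.isCompact.exists_isLeast hne
    obtain ⟨b, hb, hbmax⟩ := hF.compact.isCompact.exists_isGreatest hne
    refine ⟨a, b + 1, hF.pos ha, by linarith [hamin hb], fun x hx => ?_⟩
    refine image_eq_zero_of_notMem_tsupport fun hxt => hx ⟨hamin hxt, ?_⟩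
    linarith [hbmax hxt]

theorem IsRadialTest.of_Icc {F : ℝ → ℝ} (hF : ContDiff ℝ ∞ F) {a b : ℝ} (ha : 0 < a)
    (h : ∀ x, x ∉ Icc a b → F x = 0) : IsRadialTest F := by
  have hs : tsupport F ⊆ Icc a b :=
    closure_minimal (fun x hx => by_contra fun hc => hx (h x hc)) isClosed_Icc
  exact ⟨hF, isCompact_Icc.of_isClosed_subset (isClosed_tsupport F) hs,
    fun x hx => ha.trans_le (hs hx).1⟩

theorem IsRadialTest.hasDerivAt {F : ℝ → ℝ} (hF : IsRadialTest F) (x : ℝ) :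
    HasDerivAt F (deriv F x) x :=
  (hF.contDiff.differentiable (by simp) x).hasDerivAt

theorem IsRadialTest.deriv {F : ℝ → ℝ} (hF : IsRadialTest F) : IsRadialTest (deriv F) :=
  ⟨(contDiff_infty_iff_deriv.1 hF.contDiff).2, hF.compact.deriv,
    (tsupport_deriv_subset).trans hF.pos⟩

theorem IsRadialTest.hasACDeriv {F : ℝ → ℝ} (hF : IsRadialTest F) :
    HasACDeriv F (_root_.deriv F) :=
  .of_hasDerivAt (fun x _ => hF.hasDerivAt x) hF.deriv.contDiff.continuous.continuousOn

theorem IsRadialTest.integrable_smul {E : Type*} [NormedAddCommGroup E] [NormedSpace ℝ E]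
    {F : ℝ → ℝ} (hF : IsRadialTest F) {A : ℝ → E}
    (hA : LocallyIntegrableOn A (Ioi 0)) : Integrable (fun x => F x • A x) := by
  obtain ⟨a, b, ha, hab, h0⟩ := hF.exists_Icc
  have h1 : IntegrableOn (fun x => F x • A x) (Icc a b) :=
    (hA.Icc ha).continuousOn_smul hF.contDiff.continuous.continuousOn isCompact_Icc
  exact h1.integrable_of_forall_notMem_eq_zero fun x hx => by rw [h0 x hx, zero_smul]

theorem setIntegral_Ioi_eq_integral {E : Type*} [NormedAddCommGroup E] [NormedSpace ℝ E]
    {f : ℝ → E} (h : ∀ x ≤ 0, f x = 0) : ∫ x in Ioi 0, f x = ∫ x, f x :=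
  setIntegral_eq_integral_of_forall_compl_eq_zero fun x hx => h x (not_lt.1 hx)

theorem IsRadialTest.eq_zero {F : ℝ → ℝ} (hF : IsRadialTest F) {x : ℝ} (hx : x ≤ 0) : F x = 0 :=
  image_eq_zero_of_notMem_tsupport fun h => not_lt.2 hx (hF.pos h)

theorem IsRadialTest.integral_deriv_smul {F : ℝ → ℝ} (hF : IsRadialTest F) {A B : ℝ → ℂ}
    (hA : HasACDeriv A B) :
    ∫ x, _root_.deriv F x • A x = - ∫ x, F x • B x := by
  obtain ⟨a, b, ha, hab, h0⟩ := hF.exists_Icc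
  have h1 := (hF.hasACDeriv.ofReal.mul hA).integral_Ioi ha hab
    (fun x _ hx => by simp [h0 x hx])
  have hAl : LocallyIntegrableOn A (Ioi 0) :=
    hA.continuousOn.locallyIntegrableOn measurableSet_Ioi
  have h2 := h1.2
  rw [setIntegral_Ioi_eq_integral (fun x hx => by simp [hF.eq_zero hx, hF.deriv.eq_zero hx])] at h2
  rw [eq_neg_iff_add_eq_zero, ← integral_add (hF.deriv.integrable_smul hAl)
    (hF.integrable_smul hA.locallyIntegrableOn), ← h2]
  simp

theorem exists_isRadialTest_integral_eq_one : ∃ F, IsRadialTest F ∧ ∫ x, F x = 1 := by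
  let f : ContDiffBump (2 : ℝ) := ⟨1 / 2, 1, by norm_num, by norm_num⟩
  refine ⟨f.normed volume, .of_Icc (a := 1) (b := 3) f.contDiff_normed one_pos fun x hx => ?_,
    f.integral_normed⟩
  by_contra hc
  have : x ∈ Function.support (f.normed volume) := hc
  rw [f.support_normed_eq, Metric.mem_ball, Real.dist_eq, abs_lt] at this
  have h2 : f.rOut = 1 := rfl
  rw [h2] at this
  exact hx ⟨by linarith, by linarith⟩

/-- A test function with vanishing integral is the derivative of a test function. -/
theorem IsRadialTest.exists_primitive {G : ℝ → ℝ} (hG : IsRadialTest G) (h : ∫ x, G x = 0) :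
    ∃ F, IsRadialTest F ∧ _root_.deriv F = G := by
  obtain ⟨a, b, ha, hab, h0⟩ := hG.exists_Icc
  have hc : Continuous G := hG.contDiff.continuous
  have hd : ∀ x, HasDerivAt (fun x => ∫ t in (0 : ℝ)..x, G t) (G x) x := fun x =>
    intervalIntegral.integral_hasDerivAt_right (hc.intervalIntegrable _ _)
      (hc.stronglyMeasurableAtFilter _ _) hc.continuousAt
  have hder : _root_.deriv (fun x => ∫ t in (0 : ℝ)..x, G t) = G := funext fun x => (hd x).deriv
  refine ⟨_, .of_Icc (a := a) (b := b) ?_ ha fun x hx => ?_, hder⟩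
  · rw [contDiff_infty_iff_deriv, hder]
    exact ⟨fun x => (hd x).differentiableAt, hG.contDiff⟩
  · rcases lt_or_ge x a with hxa | hxa
    · refine intervalIntegral.integral_zero_ae (Eventually.of_forall fun t ht => h0 t fun hc => ?_)
      have := uIoc_subset_uIcc ht
      have h3 : t ≤ max 0 x := this.2
      rcases le_max_iff.1 h3 with h4 | h4 <;> linarith [hc.1]
    · have hxb : b < x := not_le.1 fun hc => hx ⟨hxa, hc⟩
      rw [intervalIntegral.integral_of_le (by linarith), ← h]
      refine setIntegral_eq_integral_of_forall_compl_eq_zero fun t ht => h0 t fun hc => ht ?_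
      exact ⟨by linarith [hc.1], by linarith [hc.2]⟩

/-- A weakly differentiable function on `(0, ∞)` is locally absolutely continuous. -/
theorem exists_hasACDeriv_of_weak {A B : ℝ → ℂ} (hA : LocallyIntegrableOn A (Ioi 0))
    (hB : LocallyIntegrableOn B (Ioi 0))
    (h : ∀ F, IsRadialTest F → ∫ x, deriv F x • A x = - ∫ x, F x • B x) :
    ∃ A', HasACDeriv A' B ∧ ∀ᵐ x : ℝ, 0 < x → A x = A' x := by
  obtain ⟨P, hP⟩ := HasACDeriv.exists_of_locallyIntegrableOn hB
  have hPl : LocallyIntegrableOn P (Ioi 0) :=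
    hP.continuousOn.locallyIntegrableOn measurableSet_Ioi
  obtain ⟨F₀, hF₀, h1⟩ := exists_isRadialTest_integral_eq_one
  -- Du Bois-Reymond: `A - P` has zero weak derivative and should be constant; pairing it with the
  -- normalized bump `F₀` reads off the constant.
  set K : ℂ := ∫ x, F₀ x • (A x - P x)
  have hAP : LocallyIntegrableOn (fun x => A x - P x) (Ioi 0) := hA.sub hPl
  have hcl : LocallyIntegrableOn (fun _ : ℝ => K) (Ioi 0) :=
    continuousOn_const.locallyIntegrableOn measurableSet_Ioi
  have key : ∀ᵐ x : ℝ, x ∈ Ioi (0 : ℝ) → A x - P x - K = 0 := by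
    refine isOpen_Ioi.ae_eq_zero_of_integral_contDiff_smul_eq_zero (hAP.sub hcl) ?_
    intro G hG1 hG2 hG3
    have hG : IsRadialTest G := ⟨hG1, hG2, hG3⟩
    set m := ∫ x, G x
    have hGi : Integrable G := hG1.continuous.integrable_of_hasCompactSupport hG2
    have hFi : Integrable F₀ := hF₀.contDiff.continuous.integrable_of_hasCompactSupport hF₀.compact
    -- Subtracting `m F₀` makes the integral vanish, so this is the derivative of a test function
    -- and annihilates `A - P`.
    have hH : IsRadialTest (fun x => G x - m * F₀ x) := by
      refine ⟨hG1.sub (contDiff_const.mul hF₀.contDiff), hG2.sub hF₀.compact.mul_left, ?_⟩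
      refine (tsupport_sub G _).trans (union_subset hG3 ?_)
      exact (tsupport_mul_subset_right).trans hF₀.pos
    obtain ⟨F, hF, hFd⟩ := hH.exists_primitive (by
      rw [integral_sub hGi (hFi.const_mul m), integral_const_mul, h1, mul_one, sub_self])
    have h2 : ∫ x, deriv F x • (A x - P x) = 0 := by
      simp_rw [smul_sub]
      rw [integral_sub (hF.deriv.integrable_smul hA) (hF.deriv.integrable_smul hPl), h F hF,
        hF.integral_deriv_smul hP, sub_self]
    rw [hFd] at h2
    have h3 : ∫ x, (G x - m * F₀ x) • (A x - P x) = (∫ x, G x • (A x - P x)) - m • K := by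
      simp_rw [sub_smul, mul_smul]
      rw [integral_sub (hG.integrable_smul hAP) (show Integrable (fun x => m • F₀ x • (A x - P x)) from
          (hF₀.integrable_smul hAP).smul m), integral_smul]
    have h4 : ∫ x, G x • (A x - P x - K) = (∫ x, G x • (A x - P x)) - m • K := by
      simp_rw [smul_sub _ _ K]
      rw [integral_sub (hG.integrable_smul hAP) (hG.integrable_smul hcl),
        integral_smul_const]
    rw [h4, ← h3, h2]
  have hKd : HasACDeriv (fun _ : ℝ => K) (fun _ => 0) :=
    .of_hasDerivAt (fun x _ => hasDerivAt_const x K) continuousOn_const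
  refine ⟨fun x => P x + K, by simpa using hP.add hKd, ?_⟩
  filter_upwards [key] with x hx h0
  have := hx h0
  linear_combination this

end WeakDerivative

/-! ### The radial measure and its divergence theorem. -/

section RadialMeasure

/-- The measure `c r^(2d+1) dr` on `(0, ∞)`. -/
noncomputable def radialMeasure (c : ℝ) (d : ℕ) : Measure ℝ :=
  (volume.restrict (Ioi 0)).withDensity fun r => ENNReal.ofReal (c * r ^ (2 * d + 1))

variable {c : ℝ} {d : ℕ}

theorem ae_radialMeasure (hc : 0 < c) {p : ℝ → Prop} :
    (∀ᵐ r ∂(radialMeasure c d), p r) ↔ ∀ᵐ r : ℝ, 0 < r → p r := by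
  rw [radialMeasure, ae_withDensity_iff (by fun_prop), ae_restrict_iff' measurableSet_Ioi]
  refine eventually_congr (Eventually.of_forall fun r => ?_)
  refine forall_congr' fun hr => ?_
  have hr : 0 < r := hr
  have : ENNReal.ofReal (c * r ^ (2 * d + 1)) ≠ 0 := by
    rw [Ne, ENNReal.ofReal_eq_zero, not_le]; positivity
  simp [this]

theorem ae_radialMeasure_pos (hc : 0 < c) : ∀ᵐ r ∂(radialMeasure c d), 0 < r :=
  (ae_radialMeasure hc).2 (Eventually.of_forall fun _ h => h)

theorem integrable_radialMeasure (hc : 0 < c) {E : Type*} [NormedAddCommGroup E] [NormedSpace ℝ E]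
    {f : ℝ → E} :
    Integrable f (radialMeasure c d) ↔ IntegrableOn (fun r => r ^ (2 * d + 1) • f r) (Ioi 0) := by
  rw [radialMeasure, integrable_withDensity_iff_integrable_smul' (by fun_prop) (by simp)]
  have : ∀ᵐ r ∂(volume.restrict (Ioi (0 : ℝ))),
      (ENNReal.ofReal (c * r ^ (2 * d + 1))).toReal • f r = c • (r ^ (2 * d + 1) • f r) := by
    filter_upwards [ae_restrict_mem measurableSet_Ioi] with r hr
    have hr : 0 < r := hr
    rw [ENNReal.toReal_ofReal (by positivity), mul_smul]
  rw [integrable_congr this]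
  exact integrable_smul_iff hc.ne' _

theorem integral_radialMeasure (hc : 0 < c) {E : Type*} [NormedAddCommGroup E] [NormedSpace ℝ E]
    (f : ℝ → E) :
    ∫ r, f r ∂(radialMeasure c d) = c • ∫ r in Ioi 0, r ^ (2 * d + 1) • f r := by
  rw [radialMeasure, integral_withDensity_eq_integral_toReal_smul (by fun_prop) (by simp),
    ← integral_smul]
  refine setIntegral_congr_fun measurableSet_Ioi fun r hr => ?_
  have hr : 0 < r := hr
  rw [ENNReal.toReal_ofReal (by positivity), mul_smul]

/-- The divergence theorem behind the Hardy, energy and multiplier identities: `A` is a flux that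
contains the Jacobian `r^(2d+1)`, and a compactly supported flux has zero total divergence. -/
theorem HasACDeriv.integral_radialMeasure (hc : 0 < c) {A B S : ℝ → ℝ} (h : HasACDeriv A B)
    {a b : ℝ} (ha : 0 < a) (hab : a < b) (hA : ∀ x, 0 < x → x ∉ Icc a b → A x = 0)
    (hB : ∀ᵐ r : ℝ, 0 < r → B r = r ^ (2 * d + 1) * S r) :
    Integrable S (radialMeasure c d) ∧ ∫ r, S r ∂(radialMeasure c d) = 0 := by
  have h1 := (h.congr_deriv hB).integral_Ioi_real ha hab hA
  rw [integrable_radialMeasure hc, HeisenbergResolvent.integral_radialMeasure hc]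
  exact ⟨h1.1, by simp only [smul_eq_mul, h1.2, mul_zero]⟩

theorem HasACDeriv.integral_radialMeasure_complex (hc : 0 < c) {A B S : ℝ → ℂ}
    (h : HasACDeriv A B)
    {a b : ℝ} (ha : 0 < a) (hab : a < b) (hA : ∀ x, 0 < x → x ∉ Icc a b → A x = 0)
    (hB : ∀ᵐ r : ℝ, 0 < r → B r = (r : ℂ) ^ (2 * d + 1) * S r) :
    Integrable S (radialMeasure c d) ∧ ∫ r, S r ∂(radialMeasure c d) = 0 := by
  have hB' : ∀ᵐ r : ℝ, 0 < r → B r = r ^ (2 * d + 1) • S r := by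
    filter_upwards [hB] with r hr h0
    rw [hr h0, Complex.real_smul]; push_cast; rfl
  have h1 := (h.congr_deriv hB').integral_Ioi ha hab hA
  rw [integrable_radialMeasure hc, HeisenbergResolvent.integral_radialMeasure hc]
  exact ⟨h1.1, by rw [h1.2, smul_zero]⟩

theorem integrable_radialMeasure_of_Icc (hc : 0 < c) {E : Type*} [NormedAddCommGroup E]
    [NormedSpace ℝ E] {f : ℝ → E} {a b : ℝ} (ha : 0 < a) (hf : LocallyIntegrableOn f (Ioi 0))
    (h0 : ∀ x, 0 < x → x ∉ Icc a b → f x = 0) : Integrable f (radialMeasure c d) := by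
  rw [integrable_radialMeasure hc]
  have h1 : IntegrableOn (fun r => r ^ (2 * d + 1) • f r) (Icc a b) :=
    (hf.Icc ha).continuousOn_smul (by fun_prop) isCompact_Icc
  refine h1.of_ae_sdiff_eq_zero measurableSet_Ioi.nullMeasurableSet
    (Eventually.of_forall fun x hx => ?_)
  rw [h0 x hx.1 hx.2, smul_zero]

end RadialMeasure

/-! ### Logarithmic cutoffs. -/

section Cutoff

/-- A smooth plateau function of one variable. -/
noncomputable def plateau (x : ℝ) : ℝ := Real.smoothTransition (2 + x) * Real.smoothTransition (2 - x)

theorem plateau_contDiff : ContDiff ℝ ∞ plateau :=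
  (Real.smoothTransition.contDiff.comp (by fun_prop)).mul
    (Real.smoothTransition.contDiff.comp (by fun_prop))

theorem plateau_nonneg (x : ℝ) : 0 ≤ plateau x :=
  mul_nonneg (Real.smoothTransition.nonneg _) (Real.smoothTransition.nonneg _)

theorem plateau_le_one (x : ℝ) : plateau x ≤ 1 :=
  mul_le_one₀ (Real.smoothTransition.le_one _) (Real.smoothTransition.nonneg _)
    (Real.smoothTransition.le_one _)

theorem plateau_eq_one {x : ℝ} (hx : |x| ≤ 1) : plateau x = 1 := by
  rw [abs_le] at hx
  rw [plateau, Real.smoothTransition.one_of_one_le (by linarith),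
    Real.smoothTransition.one_of_one_le (by linarith), mul_one]

theorem plateau_eq_zero {x : ℝ} (hx : 2 ≤ |x|) : plateau x = 0 := by
  rw [plateau]
  rcases le_abs.1 hx with h | h
  · rw [Real.smoothTransition.zero_of_nonpos (x := 2 - x) (by linarith), mul_zero]
  · rw [Real.smoothTransition.zero_of_nonpos (x := 2 + x) (by linarith), zero_mul]

theorem plateau_monotoneOn : MonotoneOn plateau (Iic 1) := by
  have : ∀ x ∈ Iic (1 : ℝ), plateau x = Real.smoothTransition (2 + x) := fun x hx => by
    rw [plateau, Real.smoothTransition.one_of_one_le (x := 2 - x) (by linarith [mem_Iic.1 hx]),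
      mul_one]
  intro x hx y hy hxy
  rw [this x hx, this y hy]
  exact Real.smoothTransition.monotone (by linarith)

theorem deriv_plateau_nonneg {x : ℝ} (hx : x < 1) : 0 ≤ deriv plateau x := by
  rw [← derivWithin_of_mem_nhds (Iic_mem_nhds hx)]
  exact plateau_monotoneOn.derivWithin_nonneg

theorem hasDerivAt_plateau (x : ℝ) : HasDerivAt plateau (deriv plateau x) x :=
  (plateau_contDiff.differentiable (by simp) x).hasDerivAt

theorem plateau_hasCompactSupport : HasCompactSupport plateau :=
  HasCompactSupport.intro (isCompact_Icc (a := -2) (b := 2)) fun x hx =>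
    plateau_eq_zero (by
      by_contra! hc
      rw [abs_lt] at hc
      exact hx ⟨hc.1.le, hc.2.le⟩)

theorem exists_deriv_plateau_bound : ∃ C : ℝ, 0 ≤ C ∧ ∀ x, |deriv plateau x| ≤ C := by
  obtain ⟨C, hC⟩ := (plateau_contDiff.continuous_deriv (by simp)).bounded_above_of_compact_support
    plateau_hasCompactSupport.deriv
  exact ⟨C, (norm_nonneg _).trans (hC 0), hC⟩

/-- A smooth cutoff on `(0, ∞)`, equal to `1` on `[e^(-(n+1)), e^(n+1)]`. -/
noncomputable def cutoff (n : ℕ) (r : ℝ) : ℝ := plateau (Real.log r / (n + 1))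

theorem cutoff_nonneg (n : ℕ) (r : ℝ) : 0 ≤ cutoff n r := plateau_nonneg _
theorem cutoff_le_one (n : ℕ) (r : ℝ) : cutoff n r ≤ 1 := plateau_le_one _

/-- The function `r ↦ r * (cutoff n)' r`. -/
noncomputable def cutoffDeriv (n : ℕ) (r : ℝ) : ℝ :=
  deriv plateau (Real.log r / (n + 1)) / (n + 1)

theorem hasDerivAt_cutoff (n : ℕ) {r : ℝ} (hr : 0 < r) :
    HasDerivAt (cutoff n) (cutoffDeriv n r / r) r := by
  have h := (hasDerivAt_plateau (Real.log r / (n + 1))).comp r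
    ((Real.hasDerivAt_log hr.ne').div_const ((n : ℝ) + 1))
  refine h.congr_deriv ?_
  rw [cutoffDeriv]
  field_simp

/-- This sign near the origin lets Hardy's inequality be proved without knowing beforehand that
`|w|²/r²` is integrable there. -/
theorem cutoffDeriv_nonneg (n : ℕ) {r : ℝ} (hr : 0 < r) (h : r ≤ 1) : 0 ≤ cutoffDeriv n r := by
  refine div_nonneg (deriv_plateau_nonneg ?_) (by positivity)
  exact lt_of_le_of_lt (div_nonpos_of_nonpos_of_nonneg (Real.log_nonpos hr.le h) (by positivity))
    one_pos

/-- The reason for cutting off in `log r`: the scale invariant derivative is uniformly `O(1/n)`, so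
an error term disappears as soon as the function it multiplies is integrable. -/
theorem exists_cutoffDeriv_bound :
    ∃ C : ℝ, 0 ≤ C ∧ ∀ n r, |cutoffDeriv n r| ≤ C / ((n : ℝ) + 1) := by
  obtain ⟨C, hC0, hC⟩ := exists_deriv_plateau_bound
  refine ⟨C, hC0, fun n r => ?_⟩
  rw [cutoffDeriv, abs_div, abs_of_pos (show (0 : ℝ) < n + 1 by positivity)]
  exact div_le_div_of_nonneg_right (hC _) (by positivity)

theorem cutoff_eq_zero (n : ℕ) {r : ℝ} (hr : 0 < r)
    (h : r ∉ Icc (Real.exp (-(2 * (n + 1)))) (Real.exp (2 * (n + 1)))) : cutoff n r = 0 := by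
  apply plateau_eq_zero
  by_contra! hc
  rw [abs_lt, lt_div_iff₀ (by positivity), div_lt_iff₀ (by positivity)] at hc
  refine h ⟨?_, ?_⟩
  · rw [← Real.le_log_iff_exp_le hr]; linarith
  · rw [← Real.log_le_iff_le_exp hr]; linarith

theorem tendsto_cutoff {r : ℝ} : Tendsto (fun n => cutoff n r) atTop (𝓝 1) := by
  refine tendsto_const_nhds.congr' ?_
  filter_upwards [eventually_ge_atTop ⌈|Real.log r|⌉₊] with n hn
  refine (plateau_eq_one ?_).symm
  have h1 : |Real.log r| ≤ n := (Nat.le_ceil _).trans (by exact_mod_cast hn)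
  have h2 : (0 : ℝ) < n + 1 := by positivity
  rw [abs_div, abs_of_pos h2, div_le_one h2]
  linarith

theorem cutoff_contDiffOn (n : ℕ) : ContDiffOn ℝ ∞ (cutoff n) (Ioi 0) := by
  refine plateau_contDiff.comp_contDiffOn (ContDiffOn.div_const (fun x hx => ?_) _)
  exact (Real.contDiffAt_log.2 (ne_of_gt hx)).contDiffWithinAt

theorem cutoffDeriv_continuousOn (n : ℕ) : ContinuousOn (cutoffDeriv n) (Ioi 0) := by
  refine ContinuousOn.div_const ?_ _
  refine (plateau_contDiff.continuous_deriv (by simp)).comp_continuousOn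
    (ContinuousOn.div_const (Real.continuousOn_log.mono fun x hx => ne_of_gt hx) _)

theorem cutoff_hasACDeriv (n : ℕ) : HasACDeriv (cutoff n) fun r => cutoffDeriv n r / r :=
  .of_hasDerivAt (fun _ hr => hasDerivAt_cutoff n hr)
    ((cutoffDeriv_continuousOn n).div continuousOn_id fun _ hx => ne_of_gt hx)

theorem exp_cutoff_lt (n : ℕ) : Real.exp (-(2 * ((n : ℝ) + 1))) < Real.exp (2 * (n + 1)) :=
  Real.exp_lt_exp.2 (by have : (0 : ℝ) < n + 1 := by positivity
                        linarith)

end Cutoff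

theorem hasACDeriv_pow (k : ℕ) : HasACDeriv (fun r : ℝ => r ^ k) fun r => k * r ^ (k - 1) :=
  .of_hasDerivAt (fun r _ => hasDerivAt_pow k r) (by fun_prop)

/-! ### Fatou's lemma along the cutoffs and the radial Hardy inequality. -/

section Hardy

variable {c : ℝ} {d : ℕ}

theorem integrable_cutoff_mul (hc : 0 < c) (n : ℕ) {f : ℝ → ℝ}
    (hf : LocallyIntegrableOn f (Ioi 0)) :
    Integrable (fun r => cutoff n r * f r) (radialMeasure c d) :=
  integrable_radialMeasure_of_Icc hc (Real.exp_pos _)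
    (hf.continuousOn_mul (cutoff_hasACDeriv n).continuousOn isOpen_Ioi.isLocallyClosed)
    fun r hr h => by rw [cutoff_eq_zero n hr h, zero_mul]

/-- Fatou's lemma for the exhaustion of `(0, ∞)` by the cutoffs. -/
theorem integrable_of_cutoff_bound (hc : 0 < c) {f : ℝ → ℝ} {K : ℕ → ℝ} {K₀ : ℝ}
    (hf0 : ∀ r, 0 < r → 0 ≤ f r) (hf : LocallyIntegrableOn f (Ioi 0))
    (hK : Tendsto K atTop (𝓝 K₀))
    (hb : ∀ n, ∫ r, cutoff n r * f r ∂(radialMeasure c d) ≤ K n) :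
    Integrable f (radialMeasure c d) ∧ ∫ r, f r ∂(radialMeasure c d) ≤ K₀ := by
  have hint := fun n => integrable_cutoff_mul (d := d) hc n hf
  have hpos : ∀ n, 0 ≤ᵐ[radialMeasure c d] fun r => cutoff n r * f r := fun n => by
    filter_upwards [ae_radialMeasure_pos hc] with r hr
    exact mul_nonneg (cutoff_nonneg n r) (hf0 r hr)
  have hf0' : 0 ≤ᵐ[radialMeasure c d] f := by
    filter_upwards [ae_radialMeasure_pos hc] with r hr using hf0 r hr
  have hlim : ∀ᵐ r ∂(radialMeasure c d), Tendsto (fun n => cutoff n r * f r) atTop (𝓝 (f r)) :=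
    Eventually.of_forall fun r => by simpa using tendsto_cutoff.mul_const (f r)
  have hm : AEStronglyMeasurable f (radialMeasure c d) :=
    aestronglyMeasurable_of_tendsto_ae atTop (fun n => (hint n).1) hlim
  have hK0 : ∀ n, 0 ≤ K n := fun n => (integral_nonneg_of_ae (hpos n)).trans (hb n)
  have hK₀ : 0 ≤ K₀ := ge_of_tendsto' hK hK0
  have hl : ∫⁻ r, ENNReal.ofReal (f r) ∂(radialMeasure c d) ≤ ENNReal.ofReal K₀ := by
    have h1 : ∀ᵐ r ∂(radialMeasure c d), liminf (fun n => ENNReal.ofReal (cutoff n r * f r)) atTop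
        = ENNReal.ofReal (f r) := by
      filter_upwards [hlim] with r hr
      exact (ENNReal.tendsto_ofReal hr).liminf_eq
    rw [← lintegral_congr_ae h1]
    refine (lintegral_liminf_le' fun n => (hint n).1.aemeasurable.ennreal_ofReal).trans ?_
    rw [← (ENNReal.tendsto_ofReal hK).liminf_eq]
    refine liminf_le_liminf (Eventually.of_forall fun n => ?_)
    rw [← ofReal_integral_eq_lintegral_ofReal (hint n) (hpos n)]
    exact ENNReal.ofReal_le_ofReal (hb n)
  have hi : Integrable f (radialMeasure c d) :=
    ⟨hm, by
      rw [hasFiniteIntegral_iff_ofReal hf0']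
      exact hl.trans_lt ENNReal.ofReal_lt_top⟩
  refine ⟨hi, ?_⟩
  rw [← ofReal_integral_eq_lintegral_ofReal hi hf0'] at hl
  exact (ENNReal.ofReal_le_ofReal_iff hK₀).1 hl

theorem tendsto_const_div_nat (C : ℝ) : Tendsto (fun n : ℕ => C / ((n : ℝ) + 1)) atTop (𝓝 0) := by
  have := (tendsto_one_div_add_atTop_nhds_zero_nat (𝕜 := ℝ)).const_mul C
  simpa [div_eq_mul_inv] using this

theorem HasACDeriv.normSq {w w₁ : ℝ → ℂ} (h : HasACDeriv w w₁) :
    HasACDeriv (fun r => ‖w r‖ ^ 2)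
      fun r => 2 * ((w r).re * (w₁ r).re + (w r).im * (w₁ r).im) := by
  have h1 := (h.re.mul h.re).add (h.im.mul h.im)
  have h2 : (fun r => ‖w r‖ ^ 2) = fun r => (w r).re * (w r).re + (w r).im * (w r).im := by
    funext r; rw [← Complex.normSq_eq_norm_sq, Complex.normSq_apply]
  rw [h2]
  exact h1.congr_deriv (Eventually.of_forall fun r _ => by ring)

theorem integrable_norm_sq {α E : Type*} [NormedAddCommGroup E] [MeasurableSpace α]
    {ν : Measure α} {w : α → E} (hw : MemLp w 2 ν) : Integrable (fun r => ‖w r‖ ^ 2) ν :=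
  hw.integrable_norm_pow (by norm_num)

theorem re_mul_add_im_mul_le (a b : ℂ) : |a.re * b.re + a.im * b.im| ≤ ‖a‖ * ‖b‖ := by
  have h : a.re * b.re + a.im * b.im = (star a * b).re := by
    simp [Complex.mul_re]
  rw [h]
  refine (Complex.abs_re_le_norm _).trans ?_
  rw [norm_mul, norm_star]

/-- Hardy's inequality for radial functions. -/
theorem radial_hardy (hc : 0 < c) (hd : 1 ≤ d) {w w₁ : ℝ → ℂ} (h : HasACDeriv w w₁)
    (hw : MemLp w 2 (radialMeasure c d)) (hw₁ : MemLp w₁ 2 (radialMeasure c d)) :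
    Integrable (fun r => ‖w r‖ ^ 2 / r ^ 2) (radialMeasure c d) ∧
    ∫ r, ‖w r‖ ^ 2 / r ^ 2 ∂(radialMeasure c d)
      ≤ (∫ r, ‖w₁ r‖ ^ 2 ∂(radialMeasure c d)) / d ^ 2 := by
  obtain ⟨C, hC0, hC⟩ := exists_cutoffDeriv_bound
  have hdpos : (0 : ℝ) < d := by exact_mod_cast hd
  set Y := ∫ r, ‖w₁ r‖ ^ 2 ∂(radialMeasure c d)
  set U := ∫ r, ‖w r‖ ^ 2 ∂(radialMeasure c d)
  have hl : LocallyIntegrableOn (fun r => ‖w r‖ ^ 2 / r ^ 2) (Ioi 0) :=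
    ((h.continuousOn.norm.pow 2).div (continuousOn_id.pow 2)
      fun x hx => pow_ne_zero 2 (ne_of_gt hx)).locallyIntegrableOn measurableSet_Ioi
  have hlim : Tendsto (fun n : ℕ => Y / d ^ 2 + (C * U / d) / ((n : ℝ) + 1)) atTop
      (𝓝 (Y / d ^ 2)) := by
    simpa using (tendsto_const_div_nat (C * U / d)).const_add (Y / d ^ 2)
  refine integrable_of_cutoff_bound hc (fun r _ => by positivity) hl hlim fun n => ?_
  -- The flux is `η r^(2d) |w|²`; relative to the Jacobian, its divergence has the Hardy density `2d
  -- |w|²/r²` as main term.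
  have hP := ((cutoff_hasACDeriv n).mul (hasACDeriv_pow (2 * d))).mul h.normSq
  obtain ⟨hSi, hS⟩ := hP.integral_radialMeasure (d := d) hc (Real.exp_pos _) (exp_cutoff_lt n)
    (fun r hr hm => by rw [cutoff_eq_zero n hr hm]; ring)
    (S := fun r => cutoffDeriv n r * (‖w r‖ ^ 2 / r ^ 2)
      + 2 * d * (cutoff n r * (‖w r‖ ^ 2 / r ^ 2))
      + 2 * cutoff n r * ((w r).re * (w₁ r).re + (w r).im * (w₁ r).im) / r)
    (Eventually.of_forall fun r hr => by
      have : r ^ (2 * d) = r ^ (2 * d - 1) * r := by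
        rw [← pow_succ]; congr 1; omega
      rw [pow_succ r (2 * d), this]
      generalize r ^ (2 * d - 1) = q
      push_cast
      field_simp)
  have hηi := integrable_cutoff_mul (d := d) hc n hl
  have hUi := integrable_norm_sq hw
  have hYi := integrable_norm_sq hw₁
  have hn : (0 : ℝ) < n + 1 := by positivity
  have key : ∫ r, (d * (cutoff n r * (‖w r‖ ^ 2 / r ^ 2)) - (1 / d) * ‖w₁ r‖ ^ 2
      - (C / (n + 1)) * ‖w r‖ ^ 2) ∂(radialMeasure c d) ≤ 0 := by
    rw [← hS]
    refine integral_mono_ae (((hηi.const_mul _).sub (hYi.const_mul _)).sub (hUi.const_mul _)) hSi ?_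
    filter_upwards [ae_radialMeasure_pos hc] with r hr
    -- For `r ≤ 1` the cutoff error has the good sign; for `r > 1` it is dominated by `|w|²`, which
    -- is integrable by assumption.
    have h1 : -(C / (n + 1) * ‖w r‖ ^ 2) ≤ cutoffDeriv n r * (‖w r‖ ^ 2 / r ^ 2) := by
      have hCn : 0 ≤ C / ((n : ℝ) + 1) := by positivity
      rcases le_or_gt r 1 with h1 | h1
      · exact (neg_nonpos.2 (by positivity)).trans
          (mul_nonneg (cutoffDeriv_nonneg n hr h1) (by positivity))
      · have h2 := (abs_le.1 (hC n r)).1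
        have h3 : ‖w r‖ ^ 2 / r ^ 2 ≤ ‖w r‖ ^ 2 := div_le_self (by positivity) (by nlinarith)
        have h4 : 0 ≤ ‖w r‖ ^ 2 / r ^ 2 := by positivity
        nlinarith
    have h2 := (abs_le.1 (re_mul_add_im_mul_le (w r) (w₁ r))).1
    have hη0 := cutoff_nonneg n r
    have hη1 := cutoff_le_one n r
    have h3 : -(d * (cutoff n r * (‖w r‖ ^ 2 / r ^ 2)) + 1 / d * ‖w₁ r‖ ^ 2) ≤
        2 * cutoff n r * ((w r).re * (w₁ r).re + (w r).im * (w₁ r).im) / r := by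
      -- Young's inequality with weight `d` uses up half of `2d |w|²/r²`; the other half against
      -- `|w'|²/d` gives the constant `1/d²`.
      have h4 : -(d * (‖w r‖ / r) ^ 2 + 1 / d * ‖w₁ r‖ ^ 2) ≤
          2 * ((w r).re * (w₁ r).re + (w r).im * (w₁ r).im) / r := by
        have h5 : 2 * (‖w r‖ / r) * ‖w₁ r‖ ≤ d * (‖w r‖ / r) ^ 2 + 1 / d * ‖w₁ r‖ ^ 2 := by
          have : d * (‖w r‖ / r) ^ 2 + 1 / d * ‖w₁ r‖ ^ 2 - 2 * (‖w r‖ / r) * ‖w₁ r‖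
              = d * (‖w r‖ / r - ‖w₁ r‖ / d) ^ 2 := by field_simp; ring
          have : 0 ≤ d * (‖w r‖ / r - ‖w₁ r‖ / d) ^ 2 := by positivity
          linarith
        have h6 : -(2 * (‖w r‖ / r) * ‖w₁ r‖) ≤
            2 * ((w r).re * (w₁ r).re + (w r).im * (w₁ r).im) / r := by
          rw [show 2 * (‖w r‖ / r) * ‖w₁ r‖ = 2 * (‖w r‖ * ‖w₁ r‖) / r by ring, ← neg_div]
          exact div_le_div_of_nonneg_right (by linarith) hr.le
        linarith
      have h7 := mul_le_mul_of_nonneg_left h4 hη0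
      have h8 : cutoff n r * (1 / d * ‖w₁ r‖ ^ 2) ≤ 1 / d * ‖w₁ r‖ ^ 2 :=
        mul_le_of_le_one_left (by positivity) hη1
      rw [div_pow] at h7
      have h9 : 2 * cutoff n r * ((w r).re * (w₁ r).re + (w r).im * (w₁ r).im) / r
        = cutoff n r * (2 * ((w r).re * (w₁ r).re + (w r).im * (w₁ r).im) / r) := by ring
      rw [h9]
      linarith
    linarith
  have hsub : Integrable (fun r => d * (cutoff n r * (‖w r‖ ^ 2 / r ^ 2)) - (1 / d) * ‖w₁ r‖ ^ 2)
      (radialMeasure c d) := (hηi.const_mul _).sub (hYi.const_mul _)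
  rw [integral_sub hsub (hUi.const_mul _), integral_sub (hηi.const_mul _) (hYi.const_mul _), integral_const_mul, integral_const_mul,
    integral_const_mul] at key
  have hfin : (d : ℝ) * ∫ r, cutoff n r * (‖w r‖ ^ 2 / r ^ 2) ∂(radialMeasure c d)
      ≤ d * (Y / d ^ 2 + (C * U / d) / ((n : ℝ) + 1)) := by
    have : d * (Y / d ^ 2 + (C * U / d) / ((n : ℝ) + 1)) = 1 / d * Y + C / (n + 1) * U := by
      field_simp
    rw [this]; linarith
  exact le_of_mul_le_mul_left hfin hdpos

end Hardy

/-! ### Square-integrability tools on the half-line. -/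

section RadialTools

variable {c : ℝ} {d : ℕ}

theorem aestronglyMeasurable_radialMeasure {E : Type*} [NormedAddCommGroup E] {f : ℝ → E}
    (hf : LocallyIntegrableOn f (Ioi 0)) : AEStronglyMeasurable f (radialMeasure c d) :=
  hf.aestronglyMeasurable.mono_ac (withDensity_absolutelyContinuous _ _)

theorem _root_.ContinuousOn.locallyIntegrableOn_Ioi {E : Type*} [NormedAddCommGroup E]
    [SecondCountableTopologyEither ℝ E] {f : ℝ → E} (hf : ContinuousOn f (Ioi 0)) :
    LocallyIntegrableOn f (Ioi 0) :=
  hf.locallyIntegrableOn measurableSet_Ioi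

theorem _root_.ContinuousOn.aesm_radial {E : Type*} [NormedAddCommGroup E]
    [SecondCountableTopologyEither ℝ E] {f : ℝ → E} (hf : ContinuousOn f (Ioi 0)) :
    AEStronglyMeasurable f (radialMeasure c d) :=
  aestronglyMeasurable_radialMeasure hf.locallyIntegrableOn_Ioi

theorem memLp_two_of_Icc (hc : 0 < c) {f : ℝ → ℂ} {a b : ℝ} (ha : 0 < a)
    (hf : ContinuousOn f (Ioi 0)) (h0 : ∀ x, 0 < x → x ∉ Icc a b → f x = 0) :
    MemLp f 2 (radialMeasure c d) := by
  rw [memLp_two_iff_integrable_sq_norm hf.aesm_radial]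
  exact integrable_radialMeasure_of_Icc (a := a) (b := b) hc ha
    (hf.norm.pow 2).locallyIntegrableOn_Ioi fun x hx hm => by rw [h0 x hx hm]; simp

theorem integral_norm_mul_norm_le {α E : Type*} [MeasurableSpace α] [NormedAddCommGroup E]
    {ν : Measure α} {f g : α → E} (hf : MemLp f 2 ν) (hg : MemLp g 2 ν) :
    ∫ x, ‖f x‖ * ‖g x‖ ∂ν ≤ √(∫ x, ‖f x‖ ^ 2 ∂ν) * √(∫ x, ‖g x‖ ^ 2 ∂ν) := by
  have h := integral_mul_norm_le_Lp_mul_Lq (μ := ν) (f := f) (g := g)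
    Real.HolderConjugate.two_two (by simpa using hf) (by simpa using hg)
  simpa only [Real.rpow_two, ← Real.sqrt_eq_rpow] using h

/-- `Re (conj a * b)`. -/
def dotRe (a b : ℂ) : ℝ := a.re * b.re + a.im * b.im

/-- `Im (conj a * b)`. -/
def dotIm (a b : ℂ) : ℝ := a.re * b.im - a.im * b.re

theorem abs_dotRe_le (a b : ℂ) : |dotRe a b| ≤ ‖a‖ * ‖b‖ := re_mul_add_im_mul_le a b

theorem abs_dotIm_le (a b : ℂ) : |dotIm a b| ≤ ‖a‖ * ‖b‖ := by
  have h : dotIm a b = (star a * b).im := by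
    simp [dotIm, Complex.mul_im]; ring
  rw [h]
  refine (Complex.abs_im_le_norm _).trans ?_
  rw [norm_mul, norm_star]

theorem dotRe_self (a : ℂ) : dotRe a a = ‖a‖ ^ 2 := by
  rw [dotRe, ← Complex.normSq_eq_norm_sq, Complex.normSq_apply]

theorem integrable_norm_mul_norm {α E : Type*} [MeasurableSpace α] [NormedAddCommGroup E]
    {ν : Measure α} {f g : α → E} (hf : MemLp f 2 ν) (hg : MemLp g 2 ν) :
    Integrable (fun r => ‖f r‖ * ‖g r‖) ν :=
  hf.norm.integrable_mul hg.norm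

theorem integrable_dotRe {α : Type*} [MeasurableSpace α] {ν : Measure α} {f g : α → ℂ}
    (hf : AEStronglyMeasurable f ν) (hg : AEStronglyMeasurable g ν)
    (h : Integrable (fun r => ‖f r‖ * ‖g r‖) ν) : Integrable (fun r => dotRe (f r) (g r)) ν := by
  refine h.mono' ?_ (Eventually.of_forall fun r => abs_dotRe_le _ _)
  exact ((Complex.continuous_re.comp_aestronglyMeasurable hf).mul
    (Complex.continuous_re.comp_aestronglyMeasurable hg)).add
    ((Complex.continuous_im.comp_aestronglyMeasurable hf).mul
    (Complex.continuous_im.comp_aestronglyMeasurable hg))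

theorem integrable_dotIm {α : Type*} [MeasurableSpace α] {ν : Measure α} {f g : α → ℂ}
    (hf : AEStronglyMeasurable f ν) (hg : AEStronglyMeasurable g ν)
    (h : Integrable (fun r => ‖f r‖ * ‖g r‖) ν) : Integrable (fun r => dotIm (f r) (g r)) ν := by
  refine h.mono' ?_ (Eventually.of_forall fun r => abs_dotIm_le _ _)
  exact ((Complex.continuous_re.comp_aestronglyMeasurable hf).mul
    (Complex.continuous_im.comp_aestronglyMeasurable hg)).sub
    ((Complex.continuous_im.comp_aestronglyMeasurable hf).mul
    (Complex.continuous_re.comp_aestronglyMeasurable hg))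

theorem integrable_cutoff_pow_mul {f : ℝ → ℝ} (hf : Integrable f (radialMeasure c d)) (n j : ℕ) :
    Integrable (fun r => cutoff n r ^ j * f r) (radialMeasure c d) :=
  hf.bdd_mul (c := 1) (((cutoff_hasACDeriv n).continuousOn.pow j).aesm_radial)
    (Eventually.of_forall fun r => by
      rw [Real.norm_eq_abs, abs_of_nonneg (pow_nonneg (cutoff_nonneg n r) j)]
      exact pow_le_one₀ (cutoff_nonneg n r) (cutoff_le_one n r))

theorem tendsto_integral_cutoff_pow_mul {f : ℝ → ℝ} (hf : Integrable f (radialMeasure c d))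
    (j : ℕ) :
    Tendsto (fun n => ∫ r, cutoff n r ^ j * f r ∂(radialMeasure c d)) atTop
      (𝓝 (∫ r, f r ∂(radialMeasure c d))) := by
  refine tendsto_integral_of_dominated_convergence (fun r => |f r|)
    (fun n => (integrable_cutoff_pow_mul hf n j).1) hf.abs (fun n => Eventually.of_forall fun r => ?_)
    (Eventually.of_forall fun r => ?_)
  · rw [Real.norm_eq_abs, abs_mul, abs_of_nonneg (pow_nonneg (cutoff_nonneg n r) j)]
    exact mul_le_of_le_one_left (abs_nonneg _)
      (pow_le_one₀ (cutoff_nonneg n r) (cutoff_le_one n r))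
  · simpa using (tendsto_cutoff.pow j).mul_const (f r)

theorem tendsto_integral_cutoff_mul {f : ℝ → ℝ} (hf : Integrable f (radialMeasure c d)) :
    Tendsto (fun n => ∫ r, cutoff n r * f r ∂(radialMeasure c d)) atTop
      (𝓝 (∫ r, f r ∂(radialMeasure c d))) := by
  simpa using tendsto_integral_cutoff_pow_mul hf 1

theorem integrable_cutoffDeriv_mul {f : ℝ → ℝ} (hf : Integrable f (radialMeasure c d)) (n : ℕ) :
    Integrable (fun r => cutoffDeriv n r * f r) (radialMeasure c d) := by
  obtain ⟨C, hC0, hC⟩ := exists_cutoffDeriv_bound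
  exact hf.bdd_mul (cutoffDeriv_continuousOn n).aesm_radial (Eventually.of_forall (hC n))

theorem tendsto_integral_cutoffDeriv_mul {f : ℝ → ℝ} (hf : Integrable f (radialMeasure c d)) :
    Tendsto (fun n => ∫ r, cutoffDeriv n r * f r ∂(radialMeasure c d)) atTop (𝓝 0) := by
  obtain ⟨C, hC0, hC⟩ := exists_cutoffDeriv_bound
  refine squeeze_zero_norm (fun n => ?_)
    (by simpa using (tendsto_const_div_nat C).mul_const (∫ r, |f r| ∂(radialMeasure c d)))
  rw [← integral_const_mul]
  refine (norm_integral_le_integral_norm _).trans (integral_mono_of_nonneg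
    (Eventually.of_forall fun r => norm_nonneg _) (hf.abs.const_mul _)
    (Eventually.of_forall fun r => ?_))
  simp only [norm_mul]
  exact mul_le_mul_of_nonneg_right (hC n r) (abs_nonneg _)

theorem memLp_div_id (hc : 0 < c) (hd : 1 ≤ d) {w w₁ : ℝ → ℂ} (h : HasACDeriv w w₁)
    (hw : MemLp w 2 (radialMeasure c d)) (hw₁ : MemLp w₁ 2 (radialMeasure c d)) :
    MemLp (fun r => w r / (r : ℂ)) 2 (radialMeasure c d) := by
  have hcont : ContinuousOn (fun r : ℝ => w r / (r : ℂ)) (Ioi 0) :=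
    h.continuousOn.div Complex.continuous_ofReal.continuousOn
      fun x hx => by exact_mod_cast (ne_of_gt hx)
  rw [memLp_two_iff_integrable_sq_norm hcont.aesm_radial]
  refine (radial_hardy hc hd h hw hw₁).1.congr (Eventually.of_forall fun r => ?_)
  simp [div_pow]

theorem norm_div_mul_norm {w F : ℂ} {r : ℝ} (hr : 0 < r) :
    ‖w / (r : ℂ)‖ * ‖(r : ℂ) * F‖ = ‖w‖ * ‖F‖ := by
  rw [norm_div, norm_mul, Complex.norm_of_nonneg hr.le]
  field_simp

theorem integrable_norm_mul_source (hc : 0 < c) (hd : 1 ≤ d) {w w₁ F : ℝ → ℂ}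
    (h : HasACDeriv w w₁) (hw : MemLp w 2 (radialMeasure c d))
    (hw₁ : MemLp w₁ 2 (radialMeasure c d))
    (hF : MemLp (fun r : ℝ => (r : ℂ) * F r) 2 (radialMeasure c d)) :
    Integrable (fun r => ‖w r‖ * ‖F r‖) (radialMeasure c d) := by
  refine (integrable_norm_mul_norm (memLp_div_id hc hd h hw hw₁) hF).congr ?_
  filter_upwards [ae_radialMeasure_pos hc] with r hr using norm_div_mul_norm hr

theorem sqrt_integral_div_id_le (hc : 0 < c) (hd : 1 ≤ d) {w w₁ : ℝ → ℂ}
    (h : HasACDeriv w w₁) (hw : MemLp w 2 (radialMeasure c d))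
    (hw₁ : MemLp w₁ 2 (radialMeasure c d)) :
    √(∫ r, ‖w r / (r : ℂ)‖ ^ 2 ∂(radialMeasure c d)) ≤
      √(∫ r, ‖w₁ r‖ ^ 2 ∂(radialMeasure c d)) / d := by
  have hdp : (0 : ℝ) < d := by exact_mod_cast hd
  have h3 : ∫ r, ‖w r / (r : ℂ)‖ ^ 2 ∂(radialMeasure c d) =
      ∫ r, ‖w r‖ ^ 2 / r ^ 2 ∂(radialMeasure c d) :=
    integral_congr_ae (Eventually.of_forall fun r => by simp [div_pow])
  rw [h3]
  refine (Real.sqrt_le_sqrt (radial_hardy hc hd h hw hw₁).2).trans_eq ?_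
  rw [Real.sqrt_div' _ (by positivity), Real.sqrt_sq hdp.le]

/-- Write `|w||F|` as `(|w|/r)(r|F|)` and apply Hardy to the first factor; the source then enters
only through `r F`. -/
theorem integral_norm_mul_source_le (hc : 0 < c) (hd : 1 ≤ d) {w w₁ F : ℝ → ℂ}
    (h : HasACDeriv w w₁) (hw : MemLp w 2 (radialMeasure c d))
    (hw₁ : MemLp w₁ 2 (radialMeasure c d))
    (hF : MemLp (fun r : ℝ => (r : ℂ) * F r) 2 (radialMeasure c d)) :
    ∫ r, ‖w r‖ * ‖F r‖ ∂(radialMeasure c d) ≤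
      √(∫ r, ‖w₁ r‖ ^ 2 ∂(radialMeasure c d)) / d *
        √(∫ r, ‖(r : ℂ) * F r‖ ^ 2 ∂(radialMeasure c d)) := by
  have h1 : ∫ r, ‖w r‖ * ‖F r‖ ∂(radialMeasure c d) =
      ∫ r, ‖w r / (r : ℂ)‖ * ‖(r : ℂ) * F r‖ ∂(radialMeasure c d) := by
    refine integral_congr_ae ?_
    filter_upwards [ae_radialMeasure_pos hc] with r hr using (norm_div_mul_norm hr).symm
  rw [h1]
  exact (integral_norm_mul_norm_le (memLp_div_id hc hd h hw hw₁) hF).trans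
    (mul_le_mul_of_nonneg_right (sqrt_integral_div_id_le hc hd h hw hw₁) (Real.sqrt_nonneg _))

theorem aesm_of_weighted (hc : 0 < c) {F : ℝ → ℂ}
    (hF : AEStronglyMeasurable (fun r : ℝ => (r : ℂ) * F r) (radialMeasure c d)) :
    AEStronglyMeasurable F (radialMeasure c d) := by
  have h1 : AEStronglyMeasurable (fun r : ℝ => ((r : ℂ)⁻¹)) (radialMeasure c d) :=
    (Complex.measurable_ofReal.inv).aestronglyMeasurable
  refine (h1.mul hF).congr ?_
  filter_upwards [ae_radialMeasure_pos hc] with r hr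
  have : (r : ℂ) ≠ 0 := by exact_mod_cast hr.ne'
  simp [this]

/-- The one-dimensional form of the form bound `∫ W |φ|² ≤ b² ∫ |∇_ℍ φ|²` on radial functions,
`κ` being the mean of `|∇_ℍ ρ|²`. -/
def RadialFormBounded (c : ℝ) (d : ℕ) (κ : ℝ) (W : ℝ → ℝ) (b : ℝ) : Prop :=
  ∀ φ φ₁ : ℝ → ℂ, HasACDeriv φ φ₁ → MemLp φ 2 (radialMeasure c d) →
    MemLp φ₁ 2 (radialMeasure c d) →
    Integrable (fun r => W r * ‖φ r‖ ^ 2) (radialMeasure c d) ∧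
    ∫ r, W r * ‖φ r‖ ^ 2 ∂(radialMeasure c d)
      ≤ b ^ 2 * (κ * ∫ r, ‖φ₁ r‖ ^ 2 ∂(radialMeasure c d))

end RadialTools

/-! ### Energy identities and the estimate outside the cone. -/

section EnergyIdentities

variable {c : ℝ} {d : ℕ} {κ : ℝ} {V : ℝ → ℝ} {w w₁ w₂ F : ℝ → ℂ} {l : ℂ}

/-- A finite energy solution of the radial resolvent equation
`κ (w'' + (2d+1)/r w') - V w + l w = F`. -/
structure RadialSolution (c : ℝ) (d : ℕ) (κ : ℝ) (V : ℝ → ℝ) (l : ℂ) (F w w₁ w₂ : ℝ → ℂ) :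
    Prop where
  c_pos : 0 < c
  one_le : 1 ≤ d
  κ_pos : 0 < κ
  contV : ContinuousOn V (Ioi 0)
  ac : HasACDeriv w w₁
  ac₁ : HasACDeriv w₁ w₂
  memLp : MemLp w 2 (radialMeasure c d)
  memLp₁ : MemLp w₁ 2 (radialMeasure c d)
  source : MemLp (fun r : ℝ => (r : ℂ) * F r) 2 (radialMeasure c d)
  ode : ∀ᵐ r : ℝ, 0 < r →
    (κ : ℂ) * (w₂ r + ((2 * d + 1 : ℝ) : ℂ) / (r : ℂ) * w₁ r) - (V r : ℂ) * w r + l * w r = F r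

namespace RadialSolution

/-- After clearing the denominator and splitting into real coordinates, the equation can be fed to
`linear_combination`, so each energy identity becomes a polynomial identity. -/
theorem ode_re_im (h : RadialSolution c d κ V l F w w₁ w₂) : ∀ᵐ r : ℝ, 0 < r →
    (r * (κ * (w₂ r).re) = r * ((F r).re + V r * (w r).re - l.re * (w r).re + l.im * (w r).im)
      - κ * (2 * d + 1) * (w₁ r).re) ∧
    (r * (κ * (w₂ r).im) = r * ((F r).im + V r * (w r).im - l.re * (w r).im - l.im * (w r).re)
      - κ * (2 * d + 1) * (w₁ r).im) := by
  filter_upwards [h.ode] with r hr h0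
  have hr := hr h0
  rw [← Complex.ofReal_div] at hr
  have h1 := congrArg Complex.re hr
  have h2 := congrArg Complex.im hr
  simp only [Complex.add_re, Complex.sub_re, Complex.mul_re, Complex.ofReal_re, Complex.ofReal_im,
    Complex.add_im, Complex.sub_im, Complex.mul_im, zero_mul, sub_zero, add_zero] at h1 h2
  have h3 : (2 * (d : ℝ) + 1) / r * r = 2 * d + 1 := div_mul_cancel₀ _ h0.ne'
  constructor
  · linear_combination r * h1 - κ * (w₁ r).re * h3
  · linear_combination r * h2 - κ * (w₁ r).im * h3

theorem integrable_w_F (h : RadialSolution c d κ V l F w w₁ w₂) :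
    Integrable (fun r => ‖w r‖ * ‖F r‖) (radialMeasure c d) :=
  integrable_norm_mul_source h.c_pos h.one_le h.ac h.memLp h.memLp₁ h.source

theorem integral_w_F_le (h : RadialSolution c d κ V l F w w₁ w₂) :
    ∫ r, ‖w r‖ * ‖F r‖ ∂(radialMeasure c d) ≤
      √(∫ r, ‖w₁ r‖ ^ 2 ∂(radialMeasure c d)) / d *
        √(∫ r, ‖(r : ℂ) * F r‖ ^ 2 ∂(radialMeasure c d)) :=
  integral_norm_mul_source_le h.c_pos h.one_le h.ac h.memLp h.memLp₁ h.source

theorem integrable_ww₁_div (h : RadialSolution c d κ V l F w w₁ w₂) :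
    Integrable (fun r => ‖w r‖ * ‖w₁ r‖ / r) (radialMeasure c d) := by
  refine (integrable_norm_mul_norm (memLp_div_id h.c_pos h.one_le h.ac h.memLp h.memLp₁)
    h.memLp₁).congr ?_
  filter_upwards [ae_radialMeasure_pos h.c_pos] with r hr
  rw [norm_div, Complex.norm_of_nonneg hr.le]
  ring

theorem integrable_dotRe_div (h : RadialSolution c d κ V l F w w₁ w₂) :
    Integrable (fun r => dotRe (w r) (w₁ r) / r) (radialMeasure c d) := by
  refine h.integrable_ww₁_div.mono' ?_ ?_
  · have := (integrable_dotRe h.memLp.1 h.memLp₁.1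
      (integrable_norm_mul_norm h.memLp h.memLp₁)).1
    exact this.mul measurable_inv.aestronglyMeasurable
  · filter_upwards [ae_radialMeasure_pos h.c_pos] with r hr
    rw [Real.norm_eq_abs, abs_div, abs_of_pos hr]
    exact div_le_div_of_nonneg_right (abs_dotRe_le _ _) hr.le

theorem integrable_dotIm_div (h : RadialSolution c d κ V l F w w₁ w₂) :
    Integrable (fun r => dotIm (w r) (w₁ r) / r) (radialMeasure c d) := by
  refine h.integrable_ww₁_div.mono' ?_ ?_
  · have := (integrable_dotIm h.memLp.1 h.memLp₁.1
      (integrable_norm_mul_norm h.memLp h.memLp₁)).1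
    exact this.mul measurable_inv.aestronglyMeasurable
  · filter_upwards [ae_radialMeasure_pos h.c_pos] with r hr
    rw [Real.norm_eq_abs, abs_div, abs_of_pos hr]
    exact div_le_div_of_nonneg_right (abs_dotIm_le _ _) hr.le

theorem integrable_dotRe_F (h : RadialSolution c d κ V l F w w₁ w₂) :
    Integrable (fun r => dotRe (w r) (F r)) (radialMeasure c d) :=
  integrable_dotRe h.memLp.1 (aesm_of_weighted h.c_pos h.source.1) h.integrable_w_F

theorem integrable_dotIm_F (h : RadialSolution c d κ V l F w w₁ w₂) :
    Integrable (fun r => dotIm (w r) (F r)) (radialMeasure c d) :=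
  integrable_dotIm h.memLp.1 (aesm_of_weighted h.c_pos h.source.1) h.integrable_w_F

/-- The flux is `κ η r^(2d+1) Im(w̄ w')`; the real potential and the gradient term drop out of the
imaginary part. -/
theorem cutoff_energy_im (h : RadialSolution c d κ V l F w w₁ w₂) (n : ℕ) :
    ∫ r, (κ * (cutoffDeriv n r * (dotIm (w r) (w₁ r) / r)) + cutoff n r * dotIm (w r) (F r)
      - l.im * (cutoff n r * ‖w r‖ ^ 2)) ∂(radialMeasure c d) = 0 := by
  have hP := ((cutoff_hasACDeriv n).mul (hasACDeriv_pow (2 * d + 1))).mul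
    (((h.ac.re.mul h.ac₁.im).sub (h.ac.im.mul h.ac₁.re)).const_mul κ)
  refine (hP.integral_radialMeasure (d := d) h.c_pos (Real.exp_pos _) (exp_cutoff_lt n)
    (fun r hr hm => by rw [cutoff_eq_zero n hr hm]; ring) ?_).2
  filter_upwards [h.ode_re_im] with r hr h0
  obtain ⟨h1, h2⟩ := hr h0
  rw [← dotRe_self, dotRe, dotIm, dotIm]
  have h3 : cutoffDeriv n r * (((w r).re * (w₁ r).im - (w r).im * (w₁ r).re) / r)
    = cutoffDeriv n r / r * ((w r).re * (w₁ r).im - (w r).im * (w₁ r).re) := by ring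
  rw [h3, pow_succ r (2 * d)]
  generalize cutoffDeriv n r / r = e
  simp only [add_tsub_cancel_right, Nat.cast_add, Nat.cast_mul, Nat.cast_one, Nat.cast_ofNat]
  generalize r ^ (2 * d) = s
  linear_combination cutoff n r * s * ((w r).re * h2 - (w r).im * h1)

theorem cutoff_energy_re (h : RadialSolution c d κ V l F w w₁ w₂) (n : ℕ) :
    ∫ r, (κ * (cutoffDeriv n r * (dotRe (w r) (w₁ r) / r)) + κ * (cutoff n r * ‖w₁ r‖ ^ 2)
      + cutoff n r * dotRe (w r) (F r) + cutoff n r * (V r * ‖w r‖ ^ 2)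
      - l.re * (cutoff n r * ‖w r‖ ^ 2)) ∂(radialMeasure c d) = 0 := by
  have hP := ((cutoff_hasACDeriv n).mul (hasACDeriv_pow (2 * d + 1))).mul
    (((h.ac.re.mul h.ac₁.re).add (h.ac.im.mul h.ac₁.im)).const_mul κ)
  refine (hP.integral_radialMeasure (d := d) h.c_pos (Real.exp_pos _) (exp_cutoff_lt n)
    (fun r hr hm => by rw [cutoff_eq_zero n hr hm]; ring) ?_).2
  filter_upwards [h.ode_re_im] with r hr h0
  obtain ⟨h1, h2⟩ := hr h0
  rw [← dotRe_self, ← dotRe_self, dotRe, dotRe, dotRe, dotRe]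
  have h3 : cutoffDeriv n r * (((w r).re * (w₁ r).re + (w r).im * (w₁ r).im) / r)
    = cutoffDeriv n r / r * ((w r).re * (w₁ r).re + (w r).im * (w₁ r).im) := by ring
  rw [h3, pow_succ r (2 * d)]
  generalize cutoffDeriv n r / r = e
  simp only [add_tsub_cancel_right, Nat.cast_add, Nat.cast_mul, Nat.cast_one, Nat.cast_ofNat]
  generalize r ^ (2 * d) = s
  linear_combination cutoff n r * s * ((w r).re * h1 + (w r).im * h2)

/-- Limit of the cutoff identity. The cutoff error pairs `r η'` with `Im(w̄ w')/r`, which is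
integrable because `w/r` is square integrable by Hardy. -/
theorem energy_im (h : RadialSolution c d κ V l F w w₁ w₂) :
    l.im * ∫ r, ‖w r‖ ^ 2 ∂(radialMeasure c d) = ∫ r, dotIm (w r) (F r) ∂(radialMeasure c d) := by
  have hU := integrable_norm_sq h.memLp
  have h1 := ((tendsto_integral_cutoffDeriv_mul h.integrable_dotIm_div).const_mul κ).add
    (tendsto_integral_cutoff_mul h.integrable_dotIm_F)
  have h2 := h1.sub ((tendsto_integral_cutoff_mul hU).const_mul l.im)
  have h3 := tendsto_nhds_unique (h2.congr fun n => ?_) (tendsto_const_nhds (x := (0 : ℝ)))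
  · linarith
  · rw [← h.cutoff_energy_im n]
    have i1 := (integrable_cutoffDeriv_mul h.integrable_dotIm_div n).const_mul κ
    have i2 := integrable_cutoff_pow_mul h.integrable_dotIm_F n 1
    have i3 := (integrable_cutoff_pow_mul hU n 1).const_mul l.im
    simp only [pow_one] at i2 i3
    have i12 := i1.fun_add i2
    rw [integral_sub i12 i3, integral_add i1 i2, integral_const_mul, integral_const_mul]

theorem abs_im_mul_le (h : RadialSolution c d κ V l F w w₁ w₂) :
    |l.im| * ∫ r, ‖w r‖ ^ 2 ∂(radialMeasure c d) ≤ ∫ r, ‖w r‖ * ‖F r‖ ∂(radialMeasure c d) := by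
  have hU : 0 ≤ ∫ r, ‖w r‖ ^ 2 ∂(radialMeasure c d) := integral_nonneg fun r => by positivity
  rw [← abs_of_nonneg hU, ← abs_mul, h.energy_im]
  exact abs_integral_le_integral_abs.trans (integral_mono h.integrable_dotIm_F.abs
    h.integrable_w_F fun r => abs_dotIm_le _ _)

/-- Integrability of `V|w|²` is part of the conclusion. The form bound handles `V₋`; adding it to
the cutoff identity leaves the positive part with a convergent right-hand side, and Fatou's lemma
handles `V₊`. -/
theorem energy_re (h : RadialSolution c d κ V l F w w₁ w₂) {b : ℝ}
    (hneg : RadialFormBounded c d κ (fun r => max 0 (-V r)) b) :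
    Integrable (fun r => V r * ‖w r‖ ^ 2) (radialMeasure c d) ∧
    κ * ∫ r, ‖w₁ r‖ ^ 2 ∂(radialMeasure c d) + ∫ r, V r * ‖w r‖ ^ 2 ∂(radialMeasure c d)
      = l.re * ∫ r, ‖w r‖ ^ 2 ∂(radialMeasure c d)
        - ∫ r, dotRe (w r) (F r) ∂(radialMeasure c d) := by
  have hU := integrable_norm_sq h.memLp
  have hY := integrable_norm_sq h.memLp₁
  obtain ⟨hni, -⟩ := hneg w w₁ h.ac h.memLp h.memLp₁
  have hVl : LocallyIntegrableOn (fun r => V r * ‖w r‖ ^ 2) (Ioi 0) :=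
    (h.contV.mul (h.ac.continuousOn.norm.pow 2)).locallyIntegrableOn_Ioi
  have hVpl : LocallyIntegrableOn (fun r => max 0 (V r) * ‖w r‖ ^ 2) (Ioi 0) :=
    ((continuousOn_const.sup h.contV).mul (h.ac.continuousOn.norm.pow 2)).locallyIntegrableOn_Ioi
  have i1 := fun n => (integrable_cutoffDeriv_mul h.integrable_dotRe_div n).const_mul κ
  have i2 := fun n => (integrable_cutoff_pow_mul hY n 1).const_mul κ
  have i3 := fun n => integrable_cutoff_pow_mul h.integrable_dotRe_F n 1
  have i4 := fun n => integrable_cutoff_mul (d := d) h.c_pos n hVl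
  have i5 := fun n => (integrable_cutoff_pow_mul hU n 1).const_mul l.re
  have i6 := fun n => integrable_cutoff_pow_mul hni n 1
  simp only [pow_one] at i2 i3 i5 i6
  have hid : ∀ n, ∫ r, cutoff n r * (V r * ‖w r‖ ^ 2) ∂(radialMeasure c d)
      = l.re * ∫ r, cutoff n r * ‖w r‖ ^ 2 ∂(radialMeasure c d)
        - ∫ r, cutoff n r * dotRe (w r) (F r) ∂(radialMeasure c d)
        - κ * ∫ r, cutoff n r * ‖w₁ r‖ ^ 2 ∂(radialMeasure c d)
        - κ * ∫ r, cutoffDeriv n r * (dotRe (w r) (w₁ r) / r) ∂(radialMeasure c d) := by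
    intro n
    have h0 := h.cutoff_energy_re n
    have i12 := (i1 n).fun_add (i2 n)
    have i123 := i12.fun_add (i3 n)
    have i1234 := i123.fun_add (i4 n)
    rw [integral_sub i1234 (i5 n), integral_add i123 (i4 n), integral_add i12 (i3 n),
      integral_add (i1 n) (i2 n), integral_const_mul, integral_const_mul, integral_const_mul] at h0
    linarith
  have t1 := (tendsto_integral_cutoffDeriv_mul h.integrable_dotRe_div).const_mul κ
  have t2 := (tendsto_integral_cutoff_mul hY).const_mul κ
  have t3 := tendsto_integral_cutoff_mul h.integrable_dotRe_F
  have t5 := (tendsto_integral_cutoff_mul hU).const_mul l.re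
  have t6 := tendsto_integral_cutoff_mul hni
  have t := ((t5.sub t3).sub t2).sub t1
  have hVp := integrable_of_cutoff_bound (d := d) h.c_pos (f := fun r => max 0 (V r) * ‖w r‖ ^ 2)
    (fun r _ => by positivity) hVpl (t.add t6) fun n => by
      rw [← hid n, ← integral_add (i4 n) (i6 n)]
      refine le_of_eq (integral_congr_ae (Eventually.of_forall fun r => ?_))
      have : max 0 (V r) = V r + max 0 (-V r) := by
        rcases le_total 0 (V r) with h1 | h1
        · rw [max_eq_right h1, max_eq_left (by linarith)]; ring
        · rw [max_eq_left h1, max_eq_right (by linarith)]; ring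
      dsimp only
      rw [this]; ring
  have hVi : Integrable (fun r => V r * ‖w r‖ ^ 2) (radialMeasure c d) := by
    refine (hVp.1.sub hni).congr (Eventually.of_forall fun r => ?_)
    have : V r = max 0 (V r) - max 0 (-V r) := by
      rcases le_total 0 (V r) with h1 | h1
      · rw [max_eq_right h1, max_eq_left (by linarith)]; ring
      · rw [max_eq_left h1, max_eq_right (by linarith)]; ring
    simp only [Pi.sub_apply]
    nth_rw 3 [this]; ring
  refine ⟨hVi, ?_⟩
  have h3 := tendsto_nhds_unique ((tendsto_integral_cutoff_mul hVi).congr hid) t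
  linarith

/-- The resolvent estimate outside the cone `|Im l| ≤ δ Re l`. -/
theorem estimate_outside_cone (h : RadialSolution c d κ V l F w w₁ w₂) {b : ℝ} (hb0 : 0 ≤ b)
    (hb : b < 1) (hneg : RadialFormBounded c d κ (fun r => max 0 (-V r)) b) {δ : ℝ} (hδ : 0 < δ)
    (hl : δ * l.re < |l.im|) :
    √(κ * ∫ r, ‖w₁ r‖ ^ 2 ∂(radialMeasure c d)) ≤ (1 + 1 / δ) / (d * (1 - b ^ 2)) *
      √((∫ r, ‖(r : ℂ) * F r‖ ^ 2 ∂(radialMeasure c d)) / κ) := by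
  obtain ⟨hVi, he⟩ := h.energy_re hneg
  obtain ⟨hni, hn⟩ := hneg w w₁ h.ac h.memLp h.memLp₁
  have h1 := h.abs_im_mul_le
  have h2 := h.integral_w_F_le
  have hκ := h.κ_pos
  have hdp : (0 : ℝ) < d := by exact_mod_cast h.one_le
  set Y := ∫ r, ‖w₁ r‖ ^ 2 ∂(radialMeasure c d)
  set U := ∫ r, ‖w r‖ ^ 2 ∂(radialMeasure c d)
  set G := ∫ r, ‖(r : ℂ) * F r‖ ^ 2 ∂(radialMeasure c d)
  set B := ∫ r, ‖w r‖ * ‖F r‖ ∂(radialMeasure c d)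
  have hU : 0 ≤ U := integral_nonneg fun r => by positivity
  have hY : 0 ≤ Y := integral_nonneg fun r => by positivity
  have hG : 0 ≤ G := integral_nonneg fun r => by positivity
  have hB : 0 ≤ B := integral_nonneg fun r => by positivity
  have h3 : |∫ r, dotRe (w r) (F r) ∂(radialMeasure c d)| ≤ B :=
    abs_integral_le_integral_abs.trans (integral_mono h.integrable_dotRe_F.abs
      h.integrable_w_F fun r => abs_dotRe_le _ _)
  have h4 : -(b ^ 2 * (κ * Y)) ≤ ∫ r, V r * ‖w r‖ ^ 2 ∂(radialMeasure c d) := by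
    refine le_trans (neg_le_neg hn) ?_
    rw [← integral_neg]
    refine integral_mono hni.neg hVi fun r => ?_
    have := le_max_right 0 (-V r)
    have h0 : 0 ≤ ‖w r‖ ^ 2 := by positivity
    simp only
    nlinarith
  -- The only use of the cone condition: the `λ₁` term is dominated by `|λ₂| ‖w‖²/δ`, which the
  -- imaginary identity controls. No sign of `λ₁` is needed.
  have h5 : l.re * U ≤ 1 / δ * B := by
    rw [div_mul_eq_mul_div, one_mul, le_div_iff₀ hδ]
    nlinarith
  have h6 : (1 - b ^ 2) * (κ * Y) ≤ (1 + 1 / δ) * B := by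
    have := (abs_le.1 h3).1
    linarith
  have hb2 : 0 < 1 - b ^ 2 := by nlinarith
  set X := √(κ * Y)
  have hX : X ^ 2 = κ * Y := Real.sq_sqrt (by positivity)
  have hX0 : 0 ≤ X := Real.sqrt_nonneg _
  have hN0 : 0 ≤ √(G / κ) := Real.sqrt_nonneg _
  have h7 : B ≤ X * √(G / κ) / d := by
    refine h2.trans_eq ?_
    rw [div_mul_eq_mul_div, ← Real.sqrt_mul hY, ← Real.sqrt_mul (by positivity)]
    congr 2
    field_simp
  have hδ' : 0 < 1 + 1 / δ := by positivity
  have h8 : (1 - b ^ 2) * X ^ 2 ≤ (1 + 1 / δ) * (X * √(G / κ) / d) := by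
    rw [hX]
    exact h6.trans (mul_le_mul_of_nonneg_left h7 hδ'.le)
  rcases hX0.eq_or_lt with h9 | h9
  · rw [← h9]; positivity
  · rw [div_mul_eq_mul_div, le_div_iff₀ (by positivity)]
    have h10 : X * ((1 - b ^ 2) * X * d) ≤ X * ((1 + 1 / δ) * √(G / κ)) := by
      have := mul_le_mul_of_nonneg_right h8 hdp.le
      field_simp at this ⊢
      linarith
    linarith [le_of_mul_le_mul_left h10 h9]

end RadialSolution

end EnergyIdentities

theorem _root_.MeasureTheory.Integrable.sub_fun {α : Type*} [MeasurableSpace α] {ν : Measure α}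
    {f g : α → ℝ} (hf : Integrable f ν) (hg : Integrable g ν) :
    Integrable (fun x => f x - g x) ν := hf.sub hg

/-! ### The multiplier identity for the phase-conjugated equation. -/

section Multiplier

variable {c : ℝ} {d : ℕ} {κ : ℝ} {V V₁ : ℝ → ℝ} {h h₁ h₂ G : ℝ → ℂ} {k li τ : ℝ}

/-- The radial resolvent equation after conjugation with the phase `e^(-ikr)`, in real form. -/
structure PhasedSolution (c : ℝ) (d : ℕ) (κ : ℝ) (V V₁ : ℝ → ℝ) (k li : ℝ) (G h h₁ h₂ : ℝ → ℂ) :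
    Prop where
  c_pos : 0 < c
  one_le : 1 ≤ d
  κ_pos : 0 < κ
  acV : HasACDeriv V V₁
  ac : HasACDeriv h h₁
  ac₁ : HasACDeriv h₁ h₂
  memLp : MemLp h 2 (radialMeasure c d)
  memLp₁ : MemLp h₁ 2 (radialMeasure c d)
  source : MemLp (fun r : ℝ => (r : ℂ) * G r) 2 (radialMeasure c d)
  ode : ∀ᵐ r : ℝ, 0 < r →
    (r * (κ * (h₂ r).re) = r * ((G r).re + V r * (h r).re + li * (h r).im + 2 * κ * k * (h₁ r).im)
      - κ * (2 * d + 1) * ((h₁ r).re - k * (h r).im)) ∧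
    (r * (κ * (h₂ r).im) = r * ((G r).im + V r * (h r).im - li * (h r).re - 2 * κ * k * (h₁ r).re)
      - κ * (2 * d + 1) * ((h₁ r).im + k * (h r).re))

namespace PhasedSolution

/-- Pair the equation with the conjugate of `η² (2 r h' + (2d+1) h + τ r h)` and take real parts.
The factor `2d+1` makes the two cross terms in `k` add up to an imaginary multiple of `Re(h̄ h')`,
and `λ₂ = τ κ k` does the same for the term in `λ₂` from `2 r h'` and the term in `k` from `τ r h`.
-/
theorem multiplier_identity (H : PhasedSolution c d κ V V₁ k li G h h₁ h₂)
    (hτ : li = τ * κ * k) (n : ℕ) :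
    Integrable (fun r => κ * (cutoff n r ^ 2 * ‖h₁ r‖ ^ 2)
      + 2 * κ * cutoff n r * cutoffDeriv n r * ‖h₁ r‖ ^ 2
      - cutoff n r ^ 2 * (V r + r * V₁ r) * ‖h r‖ ^ 2
      - 2 * cutoff n r * cutoffDeriv n r * V r * ‖h r‖ ^ 2
      + 2 * (2 * d + 1) * κ * cutoff n r * (cutoffDeriv n r / r) * dotRe (h r) (h₁ r)
      + τ * (κ * cutoff n r ^ 2 * r * ‖h₁ r‖ ^ 2
        + κ * (2 * cutoff n r * cutoffDeriv n r + cutoff n r ^ 2) * dotRe (h r) (h₁ r)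
        + cutoff n r ^ 2 * r * V r * ‖h r‖ ^ 2)
      + cutoff n r ^ 2 * (2 * r * dotRe (h₁ r) (G r) + (2 * d + 1) * dotRe (h r) (G r)
        + τ * r * dotRe (h r) (G r))) (radialMeasure c d) ∧
    ∫ r, (κ * (cutoff n r ^ 2 * ‖h₁ r‖ ^ 2)
      + 2 * κ * cutoff n r * cutoffDeriv n r * ‖h₁ r‖ ^ 2
      - cutoff n r ^ 2 * (V r + r * V₁ r) * ‖h r‖ ^ 2
      - 2 * cutoff n r * cutoffDeriv n r * V r * ‖h r‖ ^ 2
      + 2 * (2 * d + 1) * κ * cutoff n r * (cutoffDeriv n r / r) * dotRe (h r) (h₁ r)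
      + τ * (κ * cutoff n r ^ 2 * r * ‖h₁ r‖ ^ 2
        + κ * (2 * cutoff n r * cutoffDeriv n r + cutoff n r ^ 2) * dotRe (h r) (h₁ r)
        + cutoff n r ^ 2 * r * V r * ‖h r‖ ^ 2)
      + cutoff n r ^ 2 * (2 * r * dotRe (h₁ r) (G r) + (2 * d + 1) * dotRe (h r) (G r)
        + τ * r * dotRe (h r) (G r))) ∂(radialMeasure c d) = 0 := by
  have hη := cutoff_hasACDeriv n
  have hdot := (H.ac.re.mul H.ac₁.re).add (H.ac.im.mul H.ac₁.im)
  -- The flux before localization: `r (κ|h'|² - V|h|²) + (2d+1) κ Re(h̄ h') + τ κ r Re(h̄ h')`.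
  have hQ := ((hasACDeriv_pow 1).mul ((H.ac₁.normSq.const_mul κ).sub (H.acV.mul H.ac.normSq))).add
    ((hdot.const_mul ((2 * d + 1) * κ)).add (((hasACDeriv_pow 1).mul hdot).const_mul (τ * κ)))
  have hP := ((hη.mul hη).mul (hasACDeriv_pow (2 * d + 1))).mul hQ
  refine hP.integral_radialMeasure (d := d) H.c_pos (Real.exp_pos _) (exp_cutoff_lt n)
    (fun r hr hm => by rw [cutoff_eq_zero n hr hm]; ring) ?_
  filter_upwards [H.ode] with r hr h0
  obtain ⟨h1, h2⟩ := hr h0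
  rw [← dotRe_self, ← dotRe_self, dotRe, dotRe, dotRe, dotRe, dotRe]
  have h3 : cutoffDeriv n r = cutoffDeriv n r / r * r := by field_simp
  rw [h3, pow_succ r (2 * d), mul_div_cancel_right₀ _ h0.ne']
  generalize cutoffDeriv n r / r = e
  simp only [add_tsub_cancel_right, Nat.cast_add, Nat.cast_mul, Nat.cast_one, Nat.cast_ofNat,
    pow_one, tsub_self, pow_zero]
  generalize r ^ (2 * d) = s
  subst hτ
  -- The coefficients are the real and imaginary parts of the multiplier.
  linear_combination cutoff n r ^ 2 * s * (
    (2 * r * (h₁ r).re + (2 * d + 1) * (h r).re + τ * r * (h r).re) * h1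
    + (2 * r * (h₁ r).im + (2 * d + 1) * (h r).im + τ * r * (h r).im) * h2)

theorem integrable_source (H : PhasedSolution c d κ V V₁ k li G h h₁ h₂) :
    Integrable (fun r => ‖h r‖ * ‖G r‖) (radialMeasure c d) :=
  integrable_norm_mul_source H.c_pos H.one_le H.ac H.memLp H.memLp₁ H.source

theorem integrable_weighted {f : ℝ → ℂ} (H : PhasedSolution c d κ V V₁ k li G h h₁ h₂)
    (hf : MemLp f 2 (radialMeasure c d)) :
    Integrable (fun r => r * (‖f r‖ * ‖G r‖)) (radialMeasure c d) := by
  refine (integrable_norm_mul_norm hf H.source).congr ?_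
  filter_upwards [ae_radialMeasure_pos H.c_pos] with r hr
  rw [norm_mul, Complex.norm_of_nonneg hr.le]
  ring

theorem integral_weighted_le {f : ℝ → ℂ} (H : PhasedSolution c d κ V V₁ k li G h h₁ h₂)
    (hf : MemLp f 2 (radialMeasure c d)) :
    ∫ r, r * (‖f r‖ * ‖G r‖) ∂(radialMeasure c d) ≤
      √(∫ r, ‖f r‖ ^ 2 ∂(radialMeasure c d)) *
        √(∫ r, ‖(r : ℂ) * G r‖ ^ 2 ∂(radialMeasure c d)) := by
  refine le_trans (le_of_eq (integral_congr_ae ?_)) (integral_norm_mul_norm_le hf H.source)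
  filter_upwards [ae_radialMeasure_pos H.c_pos] with r hr
  rw [norm_mul, Complex.norm_of_nonneg hr.le]
  ring

theorem integrable_div {f : ℝ → ℂ} (H : PhasedSolution c d κ V V₁ k li G h h₁ h₂)
    (hf : MemLp f 2 (radialMeasure c d)) :
    Integrable (fun r => ‖h r‖ * ‖f r‖ / r) (radialMeasure c d) := by
  refine (integrable_norm_mul_norm
    (memLp_div_id H.c_pos H.one_le H.ac H.memLp H.memLp₁) hf).congr ?_
  filter_upwards [ae_radialMeasure_pos H.c_pos] with r hr
  rw [norm_div, Complex.norm_of_nonneg hr.le]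
  ring

/-- The form bound for `V₋` applied to `√r` times a cutoff times `h`. -/
theorem cutoff_form_nonneg (H : PhasedSolution c d κ V V₁ k li G h h₁ h₂) {b : ℝ} (hb0 : 0 ≤ b)
    (hb : b < 1) (hneg : RadialFormBounded c d κ (fun r => max 0 (-V r)) b) (n : ℕ) :
    Integrable (fun r => κ * ((cutoff n r / 2 + cutoffDeriv n r) ^ 2 * (‖h r‖ ^ 2 / r)
      + (2 * cutoff n r * cutoffDeriv n r + cutoff n r ^ 2) * dotRe (h r) (h₁ r)
      + cutoff n r ^ 2 * r * ‖h₁ r‖ ^ 2) + V r * (cutoff n r ^ 2 * r * ‖h r‖ ^ 2))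
      (radialMeasure c d) ∧
    0 ≤ ∫ r, (κ * ((cutoff n r / 2 + cutoffDeriv n r) ^ 2 * (‖h r‖ ^ 2 / r)
      + (2 * cutoff n r * cutoffDeriv n r + cutoff n r ^ 2) * dotRe (h r) (h₁ r)
      + cutoff n r ^ 2 * r * ‖h₁ r‖ ^ 2) + V r * (cutoff n r ^ 2 * r * ‖h r‖ ^ 2))
      ∂(radialMeasure c d) := by
  have hsqrt : HasACDeriv (fun r => √r) fun r => 1 / (2 * √r) :=
    .of_hasDerivAt (fun r hr => Real.hasDerivAt_sqrt hr.ne')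
      (continuousOn_const.div (by fun_prop) fun r hr => by
        have : 0 < √r := Real.sqrt_pos.2 hr
        positivity)
  -- Nothing says that `√r h` lies in the form domain; the cutoff makes `η √r h` admissible, at the
  -- price of terms in `r η'`.
  have hm := (((cutoff_hasACDeriv n).mul hsqrt).ofReal.mul H.ac)
  have hz : ∀ r, 0 < r → r ∉ Icc (Real.exp (-(2 * (n + 1)))) (Real.exp (2 * (n + 1))) →
      ((cutoff n r * √r : ℝ) : ℂ) * h r = 0 := fun r hr hr' => by
    rw [cutoff_eq_zero n hr hr']; simp
  have hcz : ∀ r, 0 < r → r ∉ Icc (Real.exp (-(2 * (n + 1)))) (Real.exp (2 * (n + 1))) →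
      cutoffDeriv n r = 0 := fun r hr hr' => by
    have h1 : cutoff n =ᶠ[𝓝 r] fun _ => 0 := by
      filter_upwards [isClosed_Icc.isOpen_compl.mem_nhds hr', Ioi_mem_nhds hr] with y hy hy0
      exact cutoff_eq_zero n hy0 hy
    have h2 := (hasDerivAt_cutoff n hr).unique
      ((hasDerivAt_const r (0 : ℝ)).congr_of_eventuallyEq h1)
    rcases div_eq_zero_iff.1 h2 with h3 | h3
    · exact h3
    · exact absurd h3 hr.ne'
  have hcont : ContinuousOn (fun r => ((cutoffDeriv n r / r * √r + cutoff n r * (1 / (2 * √r)) : ℝ) : ℂ)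
      * h r + ((cutoff n r * √r : ℝ) : ℂ) * h₁ r) (Ioi 0) := by
    have hs : ContinuousOn (fun r => √r) (Ioi 0) := by fun_prop
    refine ContinuousOn.add (ContinuousOn.mul ?_ H.ac.continuousOn)
      (ContinuousOn.mul ?_ H.ac₁.continuousOn)
    · refine Complex.continuous_ofReal.comp_continuousOn (((cutoffDeriv_continuousOn n).div
        continuousOn_id fun r hr => ne_of_gt hr).mul hs |>.add
        ((cutoff_hasACDeriv n).continuousOn.mul (continuousOn_const.div (by fun_prop) fun r hr => ?_)))
      have : 0 < √r := Real.sqrt_pos.2 hr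
      positivity
    · exact Complex.continuous_ofReal.comp_continuousOn
        ((cutoff_hasACDeriv n).continuousOn.mul hs)
  have hφ := memLp_two_of_Icc (d := d) H.c_pos (Real.exp_pos _) hm.continuousOn hz
  have hφ₁ := memLp_two_of_Icc (d := d) H.c_pos (Real.exp_pos (-(2 * ((n : ℝ) + 1))))
    (b := Real.exp (2 * ((n : ℝ) + 1))) hcont
    fun r hr hr' => by rw [cutoff_eq_zero n hr hr', hcz r hr hr']; simp
  obtain ⟨hi, hle⟩ := hneg _ _ hm hφ hφ₁
  have hVi : Integrable (fun r => V r * ‖((cutoff n r * √r : ℝ) : ℂ) * h r‖ ^ 2)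
      (radialMeasure c d) :=
    integrable_radialMeasure_of_Icc H.c_pos (Real.exp_pos (-(2 * ((n : ℝ) + 1))))
      (b := Real.exp (2 * ((n : ℝ) + 1)))
      (H.acV.continuousOn.mul (hm.continuousOn.norm.pow 2)).locallyIntegrableOn_Ioi
      fun r hr hr' => by rw [hz r hr hr']; simp
  have hφi := (integrable_norm_sq hφ₁).const_mul κ
  have hcongr : (fun r => κ * ‖((cutoffDeriv n r / r * √r + cutoff n r * (1 / (2 * √r)) : ℝ) : ℂ)
      * h r + ((cutoff n r * √r : ℝ) : ℂ) * h₁ r‖ ^ 2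
      + V r * ‖((cutoff n r * √r : ℝ) : ℂ) * h r‖ ^ 2) =ᵐ[radialMeasure c d] fun r =>
      κ * ((cutoff n r / 2 + cutoffDeriv n r) ^ 2 * (‖h r‖ ^ 2 / r)
      + (2 * cutoff n r * cutoffDeriv n r + cutoff n r ^ 2) * dotRe (h r) (h₁ r)
      + cutoff n r ^ 2 * r * ‖h₁ r‖ ^ 2) + V r * (cutoff n r ^ 2 * r * ‖h r‖ ^ 2) := by
    filter_upwards [ae_radialMeasure_pos H.c_pos] with r hr
    have hq : 0 < √r := Real.sqrt_pos.2 hr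
    have hq2 : r = √r ^ 2 := (Real.sq_sqrt hr.le).symm
    set q := √r
    rw [← dotRe_self, ← dotRe_self, ← dotRe_self, ← dotRe_self, dotRe, dotRe, dotRe, dotRe, dotRe]
    simp only [Complex.add_re, Complex.add_im, Complex.re_ofReal_mul, Complex.im_ofReal_mul]
    rw [hq2]
    field_simp
    ring
  refine ⟨(hφi.fun_add hVi).congr hcongr, ?_⟩
  rw [← integral_congr_ae hcongr, integral_add hφi hVi, integral_const_mul]
  have hY : 0 ≤ κ * ∫ r, ‖((cutoffDeriv n r / r * √r + cutoff n r * (1 / (2 * √r)) : ℝ) : ℂ)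
      * h r + ((cutoff n r * √r : ℝ) : ℂ) * h₁ r‖ ^ 2 ∂(radialMeasure c d) :=
    mul_nonneg H.κ_pos.le (integral_nonneg fun r => by positivity)
  have h5 : -∫ r, max 0 (-V r) * ‖((cutoff n r * √r : ℝ) : ℂ) * h r‖ ^ 2 ∂(radialMeasure c d)
      ≤ ∫ r, V r * ‖((cutoff n r * √r : ℝ) : ℂ) * h r‖ ^ 2 ∂(radialMeasure c d) := by
    rw [← integral_neg]
    refine integral_mono hi.neg hVi fun r => ?_
    have h1 := le_max_right 0 (-V r)
    have h0 : 0 ≤ ‖((cutoff n r * √r : ℝ) : ℂ) * h r‖ ^ 2 := by positivity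
    simp only
    nlinarith
  have hb2 : b ^ 2 ≤ 1 := by nlinarith
  nlinarith [mul_le_mul_of_nonneg_right hb2 hY]

/-- Here `e = r η'`, `ε = C/(n+1)`, `m = 2d+1`, `a = |h|`, `a₁ = |h'|`, `g = |G|`, and the `D`s are
real parts of pairings. The bracket multiplied by `τ` is kept whole, since only its integral has a
sign. Completing it to the energy density of `η √r h` costs `τ κ |h|²/(4r)`, and the other terms in
`e` are collected with the factor `ε`. -/
theorem multiplier_pointwise_bound {η e ε C κ τ m r V V₁ a a₁ g D₁ D₂ D₃ : ℝ} (hr : 0 < r)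
    (hκ : 0 < κ) (hτ0 : 0 ≤ τ) (hm : 0 ≤ m) (hε0 : 0 ≤ ε) (hεC : ε ≤ C)
    (hη0 : 0 ≤ η) (hη1 : η ≤ 1) (he : |e| ≤ ε) (ha : 0 ≤ a) (ha₁ : 0 ≤ a₁) (hg : 0 ≤ g)
    (hD₁ : |D₁| ≤ a * a₁) (hD₂ : |D₂| ≤ a₁ * g) (hD₃ : |D₃| ≤ a * g) :
    κ * (η ^ 2 * a₁ ^ 2) - max 0 (V + r * V₁) * a ^ 2
      - (τ * κ / 4 * (a * a / r) + 2 * (r * (a₁ * g)) + m * (a * g) + τ * (r * (a * g)))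
      - ε * (2 * κ * a₁ ^ 2 + 2 * |V * a ^ 2| + 2 * m * κ * (a * a₁ / r)
        + τ * κ * (1 + C) * (a * a / r))
      + τ * (κ * ((η / 2 + e) ^ 2 * (a ^ 2 / r) + (2 * η * e + η ^ 2) * D₁ + η ^ 2 * r * a₁ ^ 2)
        + V * (η ^ 2 * r * a ^ 2)) ≤
    κ * (η ^ 2 * a₁ ^ 2) + 2 * κ * η * e * a₁ ^ 2 - η ^ 2 * (V + r * V₁) * a ^ 2
      - 2 * η * e * V * a ^ 2 + 2 * m * κ * η * (e / r) * D₁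
      + τ * (κ * η ^ 2 * r * a₁ ^ 2 + κ * (2 * η * e + η ^ 2) * D₁ + η ^ 2 * r * V * a ^ 2)
      + η ^ 2 * (2 * r * D₂ + m * D₃ + τ * r * D₃) := by
  have hηe : |η * e| ≤ ε := by
    rw [abs_mul, abs_of_nonneg hη0]
    exact (mul_le_of_le_one_left (abs_nonneg _) hη1).trans he
  have hη2 : η ^ 2 ≤ 1 := pow_le_one₀ hη0 hη1
  have hη20 : 0 ≤ η ^ 2 := by positivity
  have e1 : -(ε * (2 * κ * a₁ ^ 2)) ≤ 2 * κ * η * e * a₁ ^ 2 := by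
    have h0 : 0 ≤ 2 * κ * a₁ ^ 2 := by positivity
    have := mul_le_mul_of_nonneg_right (neg_le_of_abs_le hηe) h0
    linarith
  have e2 : η ^ 2 * (V + r * V₁) * a ^ 2 ≤ max 0 (V + r * V₁) * a ^ 2 := by
    refine mul_le_mul_of_nonneg_right ?_ (by positivity)
    have h1 := le_max_left 0 (V + r * V₁)
    have h2 := le_max_right 0 (V + r * V₁)
    exact (mul_le_mul_of_nonneg_left h2 hη20).trans (mul_le_of_le_one_left h1 hη2)
  have e3 : 2 * η * e * V * a ^ 2 ≤ ε * (2 * |V * a ^ 2|) := by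
    calc 2 * η * e * V * a ^ 2 = 2 * ((η * e) * (V * a ^ 2)) := by ring
      _ ≤ 2 * (ε * |V * a ^ 2|) := by
        refine mul_le_mul_of_nonneg_left ((le_abs_self _).trans ?_) (by norm_num)
        rw [abs_mul]
        exact mul_le_mul_of_nonneg_right hηe (abs_nonneg _)
      _ = _ := by ring
  have e4 : -(ε * (2 * m * κ * (a * a₁ / r))) ≤ 2 * m * κ * η * (e / r) * D₁ := by
    have h1 : |η * e * D₁| ≤ ε * (a * a₁) := by
      rw [abs_mul]
      exact mul_le_mul hηe hD₁ (abs_nonneg _) hε0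
    have h2 : 2 * m * κ * η * (e / r) * D₁ = 2 * m * κ / r * (η * e * D₁) := by ring
    have h3 : ε * (2 * m * κ * (a * a₁ / r)) = 2 * m * κ / r * (ε * (a * a₁)) := by ring
    rw [h2, h3, ← mul_neg]
    exact mul_le_mul_of_nonneg_left (neg_le_of_abs_le h1) (by positivity)
  have e5 : κ * ((η / 2 + e) ^ 2 * (a ^ 2 / r)) ≤
      κ * ((1 / 4 + ε * (1 + C)) * (a * a / r)) := by
    rw [← pow_two a]
    refine mul_le_mul_of_nonneg_left (mul_le_mul_of_nonneg_right ?_ (by positivity)) hκ.le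
    have h1 := (abs_le.1 hηe).2
    have h2 : e ^ 2 ≤ ε * C := by
      rw [← sq_abs, pow_two]
      exact mul_le_mul he (he.trans hεC) (abs_nonneg _) hε0
    calc (η / 2 + e) ^ 2 = η ^ 2 / 4 + η * e + e ^ 2 := by ring
      _ ≤ 1 / 4 + ε + ε * C := by linarith
      _ = _ := by ring
  have e6 : -(2 * (r * (a₁ * g)) + m * (a * g) + τ * (r * (a * g))) ≤
      η ^ 2 * (2 * r * D₂ + m * D₃ + τ * r * D₃) := by
    have q1 := mul_le_mul_of_nonneg_left (abs_le.1 hD₂).1 (show 0 ≤ 2 * r by positivity)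
    have q2 := mul_le_mul_of_nonneg_left (abs_le.1 hD₃).1 hm
    have q3 := mul_le_mul_of_nonneg_left (abs_le.1 hD₃).1 (show 0 ≤ τ * r by positivity)
    have h3 : -(2 * (r * (a₁ * g)) + m * (a * g) + τ * (r * (a * g))) ≤
        2 * r * D₂ + m * D₃ + τ * r * D₃ := by linarith
    have h4 : 0 ≤ 2 * (r * (a₁ * g)) + m * (a * g) + τ * (r * (a * g)) := by positivity
    have h5 := mul_le_mul_of_nonneg_left h3 hη20
    have h6 := mul_le_of_le_one_left h4 hη2
    linarith
  have e7 := mul_le_mul_of_nonneg_left e5 hτ0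
  linarith

/-- In the integrated pointwise bound the multiplier identity contributes zero, the form of `η √r h`
has the good sign since `τ ≥ 0`, and the cutoff errors are `C/(n+1)` times one fixed integral. After
the limit the term with `V + r V'` is absorbed through `b₂² < 1` or kept as the factor `1 - b₂²`. -/
theorem energy_bound (H : PhasedSolution c d κ V V₁ k li G h h₁ h₂) (hτ0 : 0 ≤ τ)
    (hτ : li = τ * κ * k) {b₁ b₂ : ℝ} (hb₁0 : 0 ≤ b₁) (hb₁ : b₁ < 1)
    (hneg : RadialFormBounded c d κ (fun r => max 0 (-V r)) b₁)
    (hrad : RadialFormBounded c d κ (fun r => max 0 (V r + r * V₁ r)) b₂)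
    (hVi : Integrable (fun r => V r * ‖h r‖ ^ 2) (radialMeasure c d)) :
    (1 - b₂ ^ 2) * (κ * ∫ r, ‖h₁ r‖ ^ 2 ∂(radialMeasure c d)) ≤
      τ * κ / 4 * ∫ r, ‖h r‖ * ‖h r‖ / r ∂(radialMeasure c d)
      + 2 * ∫ r, r * (‖h₁ r‖ * ‖G r‖) ∂(radialMeasure c d)
      + (2 * d + 1) * ∫ r, ‖h r‖ * ‖G r‖ ∂(radialMeasure c d)
      + τ * ∫ r, r * (‖h r‖ * ‖G r‖) ∂(radialMeasure c d) := by
  obtain ⟨C, hC0, hC⟩ := exists_cutoffDeriv_bound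
  have hκ := H.κ_pos
  obtain ⟨iW, hW⟩ := hrad h h₁ H.ac H.memLp H.memLp₁
  have iY := integrable_norm_sq H.memLp₁
  have iD1 := (H.integrable_div H.memLp).const_mul (τ * κ / 4)
  have iD2 := (H.integrable_weighted H.memLp₁).const_mul 2
  have iD3 := H.integrable_source.const_mul (2 * (d : ℝ) + 1)
  have iD4 := (H.integrable_weighted H.memLp).const_mul τ
  have iD := ((iD1.fun_add iD2).fun_add iD3).fun_add iD4
  have iE := (((iY.const_mul (2 * κ)).fun_add (hVi.abs.const_mul 2)).fun_add
    ((H.integrable_div H.memLp₁).const_mul (2 * (2 * d + 1) * κ))).fun_add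
    ((H.integrable_div H.memLp).const_mul (τ * κ * (1 + C)))
  set E := ∫ r, (2 * κ * ‖h₁ r‖ ^ 2 + 2 * |V r * ‖h r‖ ^ 2|
    + 2 * (2 * d + 1) * κ * (‖h r‖ * ‖h₁ r‖ / r) + τ * κ * (1 + C) * (‖h r‖ * ‖h r‖ / r))
    ∂(radialMeasure c d)
  set D := ∫ r, (τ * κ / 4 * (‖h r‖ * ‖h r‖ / r) + 2 * (r * (‖h₁ r‖ * ‖G r‖))
    + (2 * d + 1) * (‖h r‖ * ‖G r‖) + τ * (r * (‖h r‖ * ‖G r‖))) ∂(radialMeasure c d) with hD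
  set W := ∫ r, max 0 (V r + r * V₁ r) * ‖h r‖ ^ 2 ∂(radialMeasure c d)
  have step : ∀ n, κ * ∫ r, cutoff n r ^ 2 * ‖h₁ r‖ ^ 2 ∂(radialMeasure c d) ≤
      W + D + C / ((n : ℝ) + 1) * E := by
    intro n
    obtain ⟨iT, hT⟩ := H.multiplier_identity hτ n
    obtain ⟨iB, hB⟩ := H.cutoff_form_nonneg hb₁0 hb₁ hneg n
    have iη := (integrable_cutoff_pow_mul iY n 2).const_mul κ
    have i1 := iη.sub_fun iW
    have i2 := i1.sub_fun iD
    have i3 := i2.sub_fun (iE.const_mul (C / ((n : ℝ) + 1)))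
    have i4 := i3.fun_add (iB.const_mul τ)
    have key := integral_mono_ae i4 iT ?_
    · rw [hT, integral_add i3 (iB.const_mul τ),
        integral_sub i2 (iE.const_mul (C / ((n : ℝ) + 1))), integral_sub i1 iD,
        integral_sub iη iW, integral_const_mul, integral_const_mul, integral_const_mul] at key
      have := mul_nonneg hτ0 hB
      linarith
    filter_upwards [ae_radialMeasure_pos H.c_pos] with r hr
    exact multiplier_pointwise_bound hr hκ hτ0 (by positivity) (by positivity)
      (div_le_self hC0 (by linarith [(Nat.cast_nonneg n : (0 : ℝ) ≤ n)])) (cutoff_nonneg n r)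
      (cutoff_le_one n r) (hC n r) (norm_nonneg _) (norm_nonneg _) (norm_nonneg _)
      (abs_dotRe_le _ _) (abs_dotRe_le _ _) (abs_dotRe_le _ _)
  have hlim := ((tendsto_integral_cutoff_pow_mul iY 2).const_mul κ)
  have hlim2 := ((tendsto_const_div_nat C).mul_const E).const_add (W + D)
  have := le_of_tendsto_of_tendsto' hlim hlim2 step
  rw [hD, integral_add ((iD1.fun_add iD2).fun_add iD3) iD4, integral_add (iD1.fun_add iD2) iD3,
    integral_add iD1 iD2, integral_const_mul, integral_const_mul, integral_const_mul,
    integral_const_mul] at this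
  linarith

end PhasedSolution

end Multiplier

/-! ### Conjugation with the phase and the estimate inside the cone. -/

section PhaseConjugation

variable {c : ℝ} {d : ℕ} {κ : ℝ} {V V₁ : ℝ → ℝ} {w w₁ w₂ F : ℝ → ℂ} {l : ℂ}

/-- The phase factor `e^(-ikr)`. -/
noncomputable def phaseFactor (k r : ℝ) : ℂ := Complex.exp (-(Complex.I * ((k * r : ℝ) : ℂ)))

theorem norm_phaseFactor (k r : ℝ) : ‖phaseFactor k r‖ = 1 := by
  rw [phaseFactor, ← mul_neg, ← Complex.ofReal_neg, mul_comm, Complex.norm_exp_ofReal_mul_I]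

theorem continuous_phaseFactor (k : ℝ) : Continuous (phaseFactor k) := by
  unfold phaseFactor; fun_prop

theorem hasACDeriv_phaseFactor (k : ℝ) :
    HasACDeriv (phaseFactor k) fun r => -(Complex.I * k) * phaseFactor k r := by
  refine .of_hasDerivAt (fun r _ => ?_) (by have := continuous_phaseFactor k; fun_prop)
  have h1 : HasDerivAt (fun r : ℝ => ((k * r : ℝ) : ℂ)) (k : ℂ) r := by
    simpa using ((hasDerivAt_id r).const_mul k).ofReal_comp
  have h2 := (h1.const_mul Complex.I).neg.cexp
  refine h2.congr_deriv ?_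
  rw [phaseFactor]; simp only [Pi.neg_apply]; ring

theorem HasACDeriv.phase {w w₁ : ℝ → ℂ} (h : HasACDeriv w w₁) (k : ℝ) :
    HasACDeriv (fun r => phaseFactor k r * w r)
      fun r => phaseFactor k r * (w₁ r - Complex.I * k * w r) :=
  ((hasACDeriv_phaseFactor k).mul h).congr_deriv (Eventually.of_forall fun r _ => by ring)

theorem memLp_phase {f : ℝ → ℂ} {ν : Measure ℝ} (k : ℝ) (hf : MemLp f 2 ν) :
    MemLp (fun r => phaseFactor k r * f r) 2 ν :=
  hf.congr_norm ((continuous_phaseFactor k).aestronglyMeasurable.mul hf.1)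
    (Eventually.of_forall fun r => by rw [norm_mul, norm_phaseFactor, one_mul])

/-- With `h = e^(-ikr) w` the operator `∂_r` becomes `∂_r + ik`. The zeroth-order term `-κ k² h` so
produced cancels `λ₁ h`, and the price is first-order terms with the imaginary factor `ik`. -/
theorem RadialSolution.phasedSolution (h : RadialSolution c d κ V l F w w₁ w₂)
    (hV : HasACDeriv V V₁) {k : ℝ} (hk : κ * k ^ 2 = l.re) :
    PhasedSolution c d κ V V₁ k l.im (fun r => phaseFactor k r * F r)
      (fun r => phaseFactor k r * w r)
      (fun r => phaseFactor k r * (w₁ r - Complex.I * k * w r))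
      (fun r => phaseFactor k r * ((w₂ r - Complex.I * k * w₁ r)
        - Complex.I * k * (w₁ r - Complex.I * k * w r))) := by
  have hw₁ : HasACDeriv (fun r => w₁ r - Complex.I * k * w r)
      (fun r => w₂ r - Complex.I * k * w₁ r) := h.ac₁.sub (h.ac.const_mul _)
  refine ⟨h.c_pos, h.one_le, h.κ_pos, hV, h.ac.phase k, hw₁.phase k, memLp_phase k h.memLp,
    memLp_phase k (h.memLp₁.sub (h.memLp.const_mul _)), ?_, ?_⟩
  · exact (memLp_phase k h.source).congr_norm ((Complex.continuous_ofReal.aestronglyMeasurable).mul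
      ((continuous_phaseFactor k).aestronglyMeasurable.mul (aesm_of_weighted h.c_pos h.source.1)))
      (Eventually.of_forall fun r => by simp only [norm_mul]; ring)
  · filter_upwards [h.ode] with r hr h0
    have hr := hr h0
    have h3 : (2 * (d : ℝ) + 1) / r * r = 2 * d + 1 := div_mul_cancel₀ _ h0.ne'
    have hl : l = (κ * k ^ 2 : ℝ) + l.im * Complex.I := by rw [hk]; exact (Complex.re_add_im l).symm
    have hk' : ((κ * k ^ 2 : ℝ) : ℂ) = κ * k ^ 2 := by push_cast; ring
    have key : (κ : ℂ) * (phaseFactor k r * ((w₂ r - Complex.I * k * w₁ r)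
        - Complex.I * k * (w₁ r - Complex.I * k * w r)))
        = phaseFactor k r * F r + V r * (phaseFactor k r * w r)
          - Complex.I * l.im * (phaseFactor k r * w r)
          - Complex.I * (2 * κ * k) * (phaseFactor k r * (w₁ r - Complex.I * k * w r))
          - κ * ((((2 * d + 1) / r : ℝ) : ℂ) * (phaseFactor k r * (w₁ r - Complex.I * k * w r)
            + Complex.I * k * (phaseFactor k r * w r))) := by
      rw [← Complex.ofReal_div] at hr
      rw [hl, hk'] at hr
      linear_combination phaseFactor k r * hr
        - phaseFactor k r * w r * κ * k ^ 2 * Complex.I_sq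
    generalize phaseFactor k r * ((w₂ r - Complex.I * k * w₁ r)
        - Complex.I * k * (w₁ r - Complex.I * k * w r)) = z₂ at *
    generalize phaseFactor k r * (w₁ r - Complex.I * k * w r) = z₁ at *
    generalize phaseFactor k r * w r = z at *
    generalize phaseFactor k r * F r = g at *
    have h1 := congrArg Complex.re key
    have h2 := congrArg Complex.im key
    simp only [Complex.add_re, Complex.sub_re, Complex.mul_re, Complex.ofReal_re,
      Complex.ofReal_im, Complex.add_im, Complex.sub_im, Complex.mul_im, Complex.I_re,
      Complex.I_im, Complex.re_ofNat, Complex.im_ofNat] at h1 h2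
    ring_nf at h1 h2
    constructor
    · linear_combination r * h1 - κ * (z₁.re - k * z.im) * h3
    · linear_combination r * h2 - κ * (z₁.im + k * z.re) * h3

/-- The resolvent estimate inside the cone `|Im l| ≤ δ Re l`, before the parameters are
optimized. -/
theorem RadialSolution.estimate_inside_cone (h : RadialSolution c d κ V l F w w₁ w₂)
    (hV : HasACDeriv V V₁) {b₁ b₂ : ℝ} (hb₁0 : 0 ≤ b₁) (hb₁ : b₁ < 1)
    (hneg : RadialFormBounded c d κ (fun r => max 0 (-V r)) b₁)
    (hrad : RadialFormBounded c d κ (fun r => max 0 (V r + r * V₁ r)) b₂)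
    {δ k X N : ℝ} (hδ : 0 < δ) (hl : |l.im| ≤ δ * l.re) (hk : κ * k ^ 2 = l.re)
    (hkl : 0 ≤ l.im * k)
    (hX : X = √(κ * ∫ r, ‖phaseFactor k r * (w₁ r - Complex.I * k * w r)‖ ^ 2
      ∂(radialMeasure c d)))
    (hN : N = √((∫ r, ‖(r : ℂ) * F r‖ ^ 2 ∂(radialMeasure c d)) / κ)) :
    ∃ T : ℝ, 0 ≤ T ∧ T ^ 2 ≤ δ * (X * N / d) ∧
      (1 - b₂ ^ 2) * X ^ 2 ≤ T * X / (4 * d) + (4 * d + 1) / d * (X * N) + T * N := by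
  have H := h.phasedSolution hV hk
  have hκ := h.κ_pos
  have hdp : (0 : ℝ) < d := by exact_mod_cast h.one_le
  have hre : 0 ≤ l.re := by rw [← hk]; positivity
  -- Since `κ k² = λ₁`, `τ = λ₂/(κk)` equals `λ₂ k/λ₁`, nonnegative by the sign condition, and `τ² κ
  -- = λ₂²/λ₁ ≤ δ |λ₂|` in the cone. If `k = 0`, then `λ₁ = 0`, the cone forces `λ₂ = 0`, and `τ =
  -- 0` works.
  obtain ⟨τ, hτ0, hτ, hτ2⟩ : ∃ τ : ℝ, 0 ≤ τ ∧ l.im = τ * κ * k ∧ τ ^ 2 * κ ≤ δ * |l.im| := by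
    rcases eq_or_ne k 0 with hk0 | hk0
    · have h0 : l.re = 0 := by rw [← hk, hk0]; ring
      have h1 : l.im = 0 := by
        rw [h0, mul_zero] at hl
        exact abs_eq_zero.1 (le_antisymm hl (abs_nonneg _))
      exact ⟨0, le_rfl, by rw [h1]; ring, by rw [h1]; simp⟩
    · have hk2 : 0 < k ^ 2 := by positivity
      have hrep : 0 < l.re := by rw [← hk]; positivity
      refine ⟨l.im * k / l.re, div_nonneg hkl hrep.le, ?_, ?_⟩
      · rw [← hk]; field_simp
      · have h1 : (l.im * k / l.re) ^ 2 * κ = |l.im| * |l.im| / l.re := by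
          rw [← pow_two, sq_abs, ← hk]; field_simp
        rw [h1, div_le_iff₀ hrep]
        nlinarith [abs_nonneg l.im]
  have hVi : Integrable (fun r => V r * ‖phaseFactor k r * w r‖ ^ 2) (radialMeasure c d) := by
    refine (h.energy_re hneg).1.congr (Eventually.of_forall fun r => ?_)
    simp only [norm_mul, norm_phaseFactor, one_mul]
  have hE := H.energy_bound hτ0 hτ hb₁0 hb₁ hneg hrad hVi
  have hUF := h.abs_im_mul_le
  have hG1 : ∫ r, ‖(r : ℂ) * (phaseFactor k r * F r)‖ ^ 2 ∂(radialMeasure c d)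
      = ∫ r, ‖(r : ℂ) * F r‖ ^ 2 ∂(radialMeasure c d) :=
    integral_congr_ae (Eventually.of_forall fun r => by
      simp only [norm_mul, norm_phaseFactor, one_mul])
  have hU1 : ∫ r, ‖phaseFactor k r * w r‖ ^ 2 ∂(radialMeasure c d)
      = ∫ r, ‖w r‖ ^ 2 ∂(radialMeasure c d) :=
    integral_congr_ae (Eventually.of_forall fun r => by
      simp only [norm_mul, norm_phaseFactor, one_mul])
  have hF1 : ∫ r, ‖phaseFactor k r * w r‖ * ‖phaseFactor k r * F r‖ ∂(radialMeasure c d)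
      = ∫ r, ‖w r‖ * ‖F r‖ ∂(radialMeasure c d) :=
    integral_congr_ae (Eventually.of_forall fun r => by
      simp only [norm_mul, norm_phaseFactor, one_mul])
  have b1 := integral_norm_mul_source_le H.c_pos H.one_le H.ac H.memLp H.memLp₁ H.source
  have b2 := H.integral_weighted_le H.memLp₁
  have b3 := H.integral_weighted_le H.memLp
  have b4 : ∫ r, ‖phaseFactor k r * w r‖ * ‖phaseFactor k r * w r‖ / r ∂(radialMeasure c d) ≤
      √(∫ r, ‖phaseFactor k r * (w₁ r - Complex.I * k * w r)‖ ^ 2 ∂(radialMeasure c d)) / d *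
      √(∫ r, ‖phaseFactor k r * w r‖ ^ 2 ∂(radialMeasure c d)) := by
    refine le_trans (le_of_eq (integral_congr_ae ?_)) ((integral_norm_mul_norm_le
      (memLp_div_id H.c_pos H.one_le H.ac H.memLp H.memLp₁) H.memLp).trans
      (mul_le_mul_of_nonneg_right (sqrt_integral_div_id_le H.c_pos H.one_le H.ac H.memLp H.memLp₁)
        (Real.sqrt_nonneg _)))
    filter_upwards [ae_radialMeasure_pos H.c_pos] with r hr
    rw [norm_div, Complex.norm_of_nonneg hr.le]
    ring
  rw [hG1] at b1 b2 b3
  rw [hF1] at b1 hE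
  rw [hU1] at b3 b4
  set Y := ∫ r, ‖phaseFactor k r * (w₁ r - Complex.I * k * w r)‖ ^ 2 ∂(radialMeasure c d)
  set U := ∫ r, ‖w r‖ ^ 2 ∂(radialMeasure c d)
  set S := ∫ r, ‖(r : ℂ) * F r‖ ^ 2 ∂(radialMeasure c d)
  have hY : 0 ≤ Y := integral_nonneg fun r => by positivity
  have hU : 0 ≤ U := integral_nonneg fun r => by positivity
  have hS : 0 ≤ S := integral_nonneg fun r => by positivity
  have hXY : X = √κ * √Y := by rw [hX, Real.sqrt_mul hκ.le]
  have hNS : √S = √κ * N := by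
    rw [hN, ← Real.sqrt_mul hκ.le]; congr 1; field_simp
  have hκ2 : √κ * √κ = κ := Real.mul_self_sqrt hκ.le
  have hX2 : X ^ 2 = κ * Y := by rw [hX]; exact Real.sq_sqrt (by positivity)
  have hXN : √Y * √S = X * N := by rw [hNS, hXY]; ring
  -- The quantity `T` gathers the two terms that carry `τ`. Its square is controlled by the
  -- imaginary identity for `w`, because `|h| = |w|`.
  refine ⟨τ * √κ * √U, by positivity, ?_, ?_⟩
  · have h1 : (τ * √κ * √U) ^ 2 = τ ^ 2 * κ * U := by
      rw [mul_pow, mul_pow, Real.sq_sqrt hκ.le, Real.sq_sqrt hU]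
    have h2 : √Y / d * √S = X * N / d := by rw [← hXN]; ring
    rw [h1]
    calc τ ^ 2 * κ * U ≤ δ * |l.im| * U := mul_le_mul_of_nonneg_right hτ2 hU
      _ = δ * (|l.im| * U) := by ring
      _ ≤ δ * (X * N / d) := by
        refine mul_le_mul_of_nonneg_left ?_ hδ.le
        rw [← h2]
        exact hUF.trans b1
  · rw [hX2]
    refine hE.trans ?_
    have c1 := mul_le_mul_of_nonneg_left b4 (show 0 ≤ τ * κ / 4 by positivity)
    have c2 := mul_le_mul_of_nonneg_left b2 (show (0 : ℝ) ≤ 2 by norm_num)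
    have c3 := mul_le_mul_of_nonneg_left b1 (show (0 : ℝ) ≤ 2 * d + 1 by positivity)
    have c4 := mul_le_mul_of_nonneg_left b3 hτ0
    have e1 : τ * κ / 4 * (√Y / d * √U) = τ * √κ * √U * X / (4 * d) := by
      rw [hXY]
      linear_combination (-(τ * √Y * √U / (4 * d))) * hκ2
    -- The constant `4d+1` of the theorem comes from `2 + (2d+1)/d`: the source paired with `2 r h'`
    -- and with `(2d+1) h`, the latter after Hardy.
    have e2 : 2 * (√Y * √S) + (2 * d + 1) * (√Y / d * √S) = (4 * d + 1) / d * (X * N) := by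
      rw [← hXN]; field_simp; ring
    have e3 : τ * (√U * √S) = τ * √κ * √U * N := by rw [hNS]; ring
    linarith

end PhaseConjugation

/-! ### The constants: attained minima and the quadratic inequality. -/

section Constants

theorem one_sub_sq_pos {b : ℝ} (hb0 : 0 ≤ b) (hb : b < 1) : 0 < 1 - b ^ 2 := by nlinarith

/-- Coercive form of the extreme value theorem: outside `K` the function exceeds its value at `x₀`,
which itself lies in `K`. -/
theorem exists_isLeast_image_of_compact {E : Type*} [TopologicalSpace E] {S K : Set E} {f : E → ℝ}
    {x₀ : E} (hx₀ : x₀ ∈ S) (hK : IsCompact K) (hKS : K ⊆ S) (hf : ContinuousOn f S)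
    (h : ∀ x ∈ S, f x ≤ f x₀ → x ∈ K) : ∃ x ∈ S, ∀ y ∈ S, f x ≤ f y := by
  have hx₀K := h x₀ hx₀ le_rfl
  obtain ⟨x, hxK, hx⟩ := hK.exists_isMinOn ⟨x₀, hx₀K⟩ (hf.mono hKS)
  refine ⟨x, hKS hxK, fun y hy => ?_⟩
  rcases le_or_gt (f y) (f x₀) with hyx | hyx
  · exact hx (h y hy hyx)
  · exact (hx hx₀K).trans hyx.le

variable {d : ℕ} {b δ γ₁ γ₂ : ℝ}

theorem aConst_pos (hd : 1 ≤ d) (hb0 : 0 ≤ b) (hb : b < 1) (h₁ : 0 < γ₁) (h₂ : 0 < γ₂)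
    (h₂' : γ₂ < 1) : 0 < aConst d δ b γ₁ γ₂ := by
  have hdp : (0 : ℝ) < d := by exact_mod_cast hd
  have hβ := one_sub_sq_pos hb0 hb
  have hγ := one_sub_sq_pos h₂.le h₂'
  unfold aConst
  positivity

theorem bConst_pos (hδ : 0 < δ) (hb0 : 0 ≤ b) (hb : b < 1) (h₁ : 0 < γ₁) (h₂ : 0 < γ₂)
    (h₂' : γ₂ < 1) : 0 < bConst δ b γ₁ γ₂ := by
  have hβ := one_sub_sq_pos hb0 hb
  have hγ := one_sub_sq_pos h₂.le h₂'
  have := Real.sqrt_pos.2 hδ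
  unfold bConst
  positivity

theorem gConst_pos (hd : 1 ≤ d) (hb0 : 0 ≤ b) (hb : b < 1) (h₁ : 0 < γ₁)
    (h₂ : 0 < γ₂) (h₂' : γ₂ < 1) : 0 < gConst d δ b γ₁ γ₂ :=
  add_pos_of_pos_of_nonneg (aConst_pos hd hb0 hb h₁ h₂ h₂') (Real.sqrt_nonneg _)

theorem two_mul_aConst_le_gConst (hδ : 0 < δ) (hb0 : 0 ≤ b) (hb : b < 1)
    (h₁ : 0 < γ₁) (h₂ : 0 < γ₂) (h₂' : γ₂ < 1) :
    2 * aConst d δ b γ₁ γ₂ ≤ gConst d δ b γ₁ γ₂ := by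
  have h2 := (bConst_pos hδ hb0 hb h₁ h₂ h₂').le
  have : aConst d δ b γ₁ γ₂ ≤ √(aConst d δ b γ₁ γ₂ ^ 2 + bConst δ b γ₁ γ₂) :=
    Real.le_sqrt_of_sq_le (by linarith)
  unfold gConst
  linarith

theorem bConst_le_gConst_sq (hd : 1 ≤ d) (hb0 : 0 ≤ b) (hb : b < 1)
    (h₁ : 0 < γ₁) (h₂ : 0 < γ₂) (h₂' : γ₂ < 1) :
    bConst δ b γ₁ γ₂ ≤ gConst d δ b γ₁ γ₂ ^ 2 := by
  have h1 := (aConst_pos (δ := δ) hd hb0 hb h₁ h₂ h₂').le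
  have h3 : √(aConst d δ b γ₁ γ₂ ^ 2 + bConst δ b γ₁ γ₂) ≤ gConst d δ b γ₁ γ₂ := by
    unfold gConst; linarith
  have := Real.sqrt_le_left (Real.sqrt_nonneg _ |>.trans h3) |>.1 h3
  nlinarith [sq_nonneg (aConst d δ b γ₁ γ₂)]

/-- Any part of the numerator of `a` may be kept alone, since the factors `1 - b²` and `1 - γ₂²` in
the denominator are at most `1`. -/
theorem div_le_aConst (hd : 1 ≤ d) (hb0 : 0 ≤ b) (hb : b < 1) (h₂ : 0 < γ₂) (h₂' : γ₂ < 1)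
    {x : ℝ} (hx0 : 0 ≤ x) (hx : x ≤ 4 * d + 1 + γ₁ * Real.sqrt δ / 2
      + 1 / (1 - b ^ 2) * (Real.sqrt δ / (8 * d * γ₂)) ^ 2) :
    x / (2 * d) ≤ aConst d δ b γ₁ γ₂ := by
  have hdp : (0 : ℝ) < d := by exact_mod_cast hd
  have hβ := one_sub_sq_pos hb0 hb
  have hγ := one_sub_sq_pos h₂.le h₂'
  have hle : 2 * d * (1 - b ^ 2) * (1 - γ₂ ^ 2) ≤ 2 * d := by
    have h1 : (1 - b ^ 2) * (1 - γ₂ ^ 2) ≤ 1 :=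
      mul_le_one₀ (by nlinarith) hγ.le (by nlinarith)
    nlinarith
  unfold aConst
  exact div_le_div₀ (hx0.trans hx) hx (by positivity) hle

/-- Sublevel sets of `g_{d,δ,b}` are bounded away from the boundary. -/
theorem bounds_of_gConst_le (hd : 1 ≤ d) (hδ : 0 < δ) (hb0 : 0 ≤ b) (hb : b < 1)
    (h₁ : 0 < γ₁) (h₂ : 0 < γ₂) (h₂' : γ₂ < 1) {g : ℝ} (hg : gConst d δ b γ₁ γ₂ ≤ g) :
    0 < g ∧ √δ / (2 * g ^ 2) ≤ γ₁ ∧ γ₁ ≤ 2 * d * g / √δ ∧ δ / (64 * d ^ 3 * g) ≤ γ₂ ∧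
      γ₂ ≤ 1 - 1 / g ∧ δ ≤ 64 * d ^ 3 * g := by
  have hdp : (0 : ℝ) < d := by exact_mod_cast hd
  have hd1 : (1 : ℝ) ≤ d := by exact_mod_cast hd
  have hβ := one_sub_sq_pos hb0 hb
  have hβ1 : 1 - b ^ 2 ≤ 1 := by nlinarith
  have hγ := one_sub_sq_pos h₂.le h₂'
  have hs := Real.sqrt_pos.2 hδ
  have hs2 : √δ ^ 2 = δ := Real.sq_sqrt hδ.le
  have hg0 : 0 < g := (gConst_pos hd hb0 hb h₁ h₂ h₂').trans_le hg
  have ha := (two_mul_aConst_le_gConst (d := d) hδ hb0 hb h₁ h₂ h₂').trans hg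
  have hbg := (bConst_le_gConst_sq (δ := δ) hd hb0 hb h₁ h₂ h₂').trans
    (pow_le_pow_left₀ (gConst_pos hd hb0 hb h₁ h₂ h₂').le hg 2)
  have hsq : 0 ≤ 1 / (1 - b ^ 2) * (√δ / (8 * d * γ₂)) ^ 2 := by positivity
  have hγs : 0 ≤ γ₁ * √δ / 2 := by positivity
  -- The summand of `a` in `1/γ₂²` keeps `γ₂` away from `0`; since `γ₂ < 1` it also bounds `δ` from
  -- above.
  have h64 : δ ≤ 64 * d ^ 3 * g * γ₂ ^ 2 := by
    have h1 := div_le_aConst (γ₁ := γ₁) (δ := δ) hd hb0 hb h₂ h₂'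
      (x := (√δ / (8 * d * γ₂)) ^ 2) (by positivity) (by
        have : 1 ≤ 1 / (1 - b ^ 2) := by rw [le_div_iff₀ hβ]; linarith
        have h3 : 0 ≤ (√δ / (8 * d * γ₂)) ^ 2 := by positivity
        nlinarith)
    have h2 : 2 * ((√δ / (8 * d * γ₂)) ^ 2 / (2 * d)) ≤ g := by linarith
    rw [div_pow, hs2] at h2
    have h3 : 2 * (δ / (8 * d * γ₂) ^ 2 / (2 * d)) = δ / (64 * d ^ 3 * γ₂ ^ 2) := by
      field_simp; ring
    rw [h3, div_le_iff₀ (by positivity)] at h2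
    linarith
  -- The remaining barriers: `b` blows up as `γ₁ → 0`, the linear term of `a` as `γ₁ → ∞`, and the
  -- denominator factor `1 - γ₂²` as `γ₂ → 1`.
  refine ⟨hg0, ?_, ?_, ?_, ?_, ?_⟩
  · have h1 : √δ / (2 * γ₁) ≤ bConst δ b γ₁ γ₂ := by
      unfold bConst
      refine div_le_div_of_nonneg_left hs.le (by positivity) ?_
      have h1 : (1 - b ^ 2) * (1 - γ₂ ^ 2) ≤ 1 := mul_le_one₀ hβ1 hγ.le (by nlinarith)
      nlinarith
    have h2 := h1.trans hbg
    rw [div_le_iff₀ (by positivity)] at h2 ⊢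
    linarith
  · have h1 := div_le_aConst (γ₁ := γ₁) (δ := δ) hd hb0 hb h₂ h₂'
      (x := γ₁ * √δ / 2) (by positivity) (by linarith)
    have h2 : 2 * (γ₁ * √δ / 2 / (2 * d)) ≤ g := by linarith
    have h3 : 2 * (γ₁ * √δ / 2 / (2 * d)) = γ₁ * √δ / (2 * d) := by ring
    rw [h3, div_le_iff₀ (by positivity)] at h2
    rw [le_div_iff₀ hs]
    linarith
  · rw [div_le_iff₀ (by positivity)]
    have : γ₂ ^ 2 ≤ γ₂ := by nlinarith
    have h3 : 0 ≤ 64 * d ^ 3 * g := by positivity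
    nlinarith
  · have h1 : 1 / (1 - γ₂) ≤ aConst d δ b γ₁ γ₂ := by
      unfold aConst
      rw [div_le_div_iff₀ (by linarith) (by positivity)]
      have h2 : 2 * d * (1 - b ^ 2) * (1 - γ₂ ^ 2) ≤ 4 * d * (1 - γ₂) := by
        have e1 : 1 - γ₂ ^ 2 = (1 - γ₂) * (1 + γ₂) := by ring
        have e2 : (1 - b ^ 2) * (1 + γ₂) ≤ 2 := by nlinarith
        rw [e1]
        nlinarith [mul_le_mul_of_nonneg_left e2 (show 0 ≤ 2 * d * (1 - γ₂) by
          have : 0 ≤ 1 - γ₂ := by linarith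
          positivity)]
      have h3 : 0 < 1 - γ₂ := by linarith
      nlinarith [mul_nonneg (add_nonneg (add_nonneg zero_le_one hγs) hsq) h3.le]
    have h2 : 1 / (1 - γ₂) ≤ g := by
      have := (aConst_pos (δ := δ) hd hb0 hb h₁ h₂ h₂').le
      linarith
    have h3 : 0 < 1 - γ₂ := by linarith
    rw [div_le_iff₀ h3] at h2
    have : 1 / g ≤ 1 - γ₂ := by rw [div_le_iff₀ hg0]; linarith
    linarith
  · have : γ₂ ^ 2 ≤ 1 := by nlinarith
    have h3 : 0 ≤ 64 * d ^ 3 * g := by positivity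
    nlinarith

theorem gConst_continuousOn (hd : 1 ≤ d) (hb0 : 0 ≤ b) (hb : b < 1) :
    ContinuousOn (fun x : ℝ × ℝ × ℝ => gConst d x.1 b x.2.1 x.2.2)
      (Ioi 0 ×ˢ Ioi 0 ×ˢ Ioo 0 1) := by
  have hdp : (0 : ℝ) < d := by exact_mod_cast hd
  have hβ := one_sub_sq_pos hb0 hb
  have h1 : ContinuousOn (fun x : ℝ × ℝ × ℝ => aConst d x.1 b x.2.1 x.2.2)
      (Ioi 0 ×ˢ Ioi 0 ×ˢ Ioo 0 1) := by
    unfold aConst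
    refine ContinuousOn.div (ContinuousOn.add (by fun_prop) (continuousOn_const.mul
      (ContinuousOn.pow (ContinuousOn.div (by fun_prop) (by fun_prop) ?_) 2))) (by fun_prop) ?_
    · rintro ⟨x, y, z⟩ ⟨hx, hy, hz⟩
      have : 0 < z := hz.1
      positivity
    · rintro ⟨x, y, z⟩ ⟨hx, hy, hz⟩
      have := one_sub_sq_pos hz.1.le hz.2
      positivity
  have h2 : ContinuousOn (fun x : ℝ × ℝ × ℝ => bConst x.1 b x.2.1 x.2.2)
      (Ioi 0 ×ˢ Ioi 0 ×ˢ Ioo 0 1) := by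
    unfold bConst
    refine ContinuousOn.div (by fun_prop) (by fun_prop) ?_
    rintro ⟨x, y, z⟩ ⟨hx, hy, hz⟩
    have := one_sub_sq_pos hz.1.le hz.2
    have : 0 < y := hy
    positivity
  unfold gConst
  exact h1.add ((h1.pow 2).add h2).sqrt

/-- The minimum defining `M_{d,b}(δ)` is attained. -/
theorem exists_gConst_min (hd : 1 ≤ d) (hb0 : 0 ≤ b) (hb : b < 1) (hδ : 0 < δ) :
    ∃ γ₁ γ₂ : ℝ, 0 < γ₁ ∧ 0 < γ₂ ∧ γ₂ < 1 ∧
      ∀ γ₁' γ₂', 0 < γ₁' → 0 < γ₂' → γ₂' < 1 → gConst d δ b γ₁ γ₂ ≤ gConst d δ b γ₁' γ₂' := by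
  have hdp : (0 : ℝ) < d := by exact_mod_cast hd
  have hs := Real.sqrt_pos.2 hδ
  set g := gConst d δ b 1 (1 / 2) with hgdef
  have hg : 0 < g := gConst_pos hd hb0 hb one_pos (by norm_num) (by norm_num)
  set K := Icc (√δ / (2 * g ^ 2)) (2 * d * g / √δ) ×ˢ Icc (δ / (64 * d ^ 3 * g)) (1 - 1 / g)
  have hKS : K ⊆ Ioi (0 : ℝ) ×ˢ Ioo (0 : ℝ) 1 := by
    rintro ⟨y, z⟩ ⟨hy, hz⟩
    refine ⟨lt_of_lt_of_le ?_ hy.1, lt_of_lt_of_le ?_ hz.1, lt_of_le_of_lt hz.2 ?_⟩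
    · positivity
    · positivity
    · have : 0 < 1 / g := by positivity
      linarith
  have hcont : ContinuousOn (fun x : ℝ × ℝ => gConst d δ b x.1 x.2)
      (Ioi (0 : ℝ) ×ˢ Ioo (0 : ℝ) 1) :=
    (gConst_continuousOn hd hb0 hb).comp (f := fun x : ℝ × ℝ => (δ, x)) (by fun_prop)
      fun x hx => ⟨hδ, hx⟩
  have hsub : ∀ x ∈ Ioi (0 : ℝ) ×ˢ Ioo (0 : ℝ) 1, gConst d δ b x.1 x.2 ≤ g → x ∈ K := by
    rintro ⟨y, z⟩ ⟨hy, hz⟩ hyz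
    obtain ⟨-, h1, h2, h3, h4, -⟩ := bounds_of_gConst_le hd hδ hb0 hb hy hz.1 hz.2 hyz
    exact ⟨⟨h1, h2⟩, h3, h4⟩
  obtain ⟨x, hx, hmin⟩ := exists_isLeast_image_of_compact (S := Ioi (0 : ℝ) ×ˢ Ioo (0 : ℝ) 1)
    (x₀ := ((1 : ℝ), (1 / 2 : ℝ))) ⟨by norm_num, by norm_num, by norm_num⟩ (isCompact_Icc.prod isCompact_Icc) hKS hcont hsub
  exact ⟨x.1, x.2, hx.1, hx.2.1, hx.2.2, fun y z hy hz hz' => hmin (y, z) ⟨hy, hz, hz'⟩⟩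

theorem isLeast_MConst (hd : 1 ≤ d) (hb0 : 0 ≤ b) (hb : b < 1) (hδ : 0 < δ) :
    IsLeast (MValues d b δ) (MConst d b δ) := by
  obtain ⟨γ₁, γ₂, h1, h2, h3, hmin⟩ := exists_gConst_min hd hb0 hb hδ
  have h : IsLeast (MValues d b δ) (gConst d δ b γ₁ γ₂) :=
    ⟨⟨γ₁, γ₂, h1, h2, h3, rfl⟩, by
      rintro _ ⟨y, z, hy, hz, hz', rfl⟩
      exact hmin y z hy hz hz'⟩
  rwa [MConst, h.csInf_eq]

theorem MConst_pos (hd : 1 ≤ d) (hb0 : 0 ≤ b) (hb : b < 1) (hδ : 0 < δ) : 0 < MConst d b δ := by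
  obtain ⟨γ₁, γ₂, h1, h2, h3, h⟩ := (isLeast_MConst hd hb0 hb hδ).1
  rw [h]
  exact gConst_pos hd hb0 hb h1 h2 h3

/-- The minimum defining `μ_{d,b₁,b₂}` is attained. -/
theorem isLeast_μConst (hd : 1 ≤ d) {b₁ b₂ : ℝ} (hb₁0 : 0 ≤ b₁) (hb₁ : b₁ < 1) (hb₂0 : 0 ≤ b₂)
    (hb₂ : b₂ < 1) : IsLeast (μValues d b₁ b₂) (μConst d b₁ b₂) := by
  have hdp : (0 : ℝ) < d := by exact_mod_cast hd
  have hβ := one_sub_sq_pos hb₁0 hb₁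
  -- Minimizing jointly in `(δ, γ₁, γ₂)` makes continuity of `MConst` in `δ` unnecessary.
  set F : ℝ × ℝ × ℝ → ℝ := fun x => max ((1 + 1 / x.1) / ((d : ℝ) ^ 2 * (1 - b₁ ^ 2)))
    (gConst d x.1 b₂ x.2.1 x.2.2 / d)
  set S : Set (ℝ × ℝ × ℝ) := Ioi 0 ×ˢ Ioi 0 ×ˢ Ioo 0 1
  set x₀ : ℝ × ℝ × ℝ := (1, 1, 1 / 2)
  have hx₀ : x₀ ∈ S := ⟨by norm_num [x₀], by norm_num [x₀], by norm_num [x₀], by norm_num [x₀]⟩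
  set m := F x₀
  have hm : 0 < m := lt_max_of_lt_right
    (div_pos (gConst_pos hd hb₂0 hb₂ one_pos (by norm_num [x₀]) (by norm_num [x₀])) hdp)
  set g := m * d
  have hg : 0 < g := by positivity
  set δ₀ := 1 / (m * d ^ 2)
  set δ₁ := 64 * d ^ 3 * g
  have hδ₀ : 0 < δ₀ := by positivity
  have hsδ₀ := Real.sqrt_pos.2 hδ₀
  have hcont : ContinuousOn F S := by
    refine ContinuousOn.sup ?_ ((gConst_continuousOn hd hb₂0 hb₂).div_const _)
    refine ContinuousOn.div_const (continuousOn_const.add (continuousOn_const.div (by fun_prop) ?_)) _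
    rintro x ⟨hx, -⟩
    exact ne_of_gt hx
  obtain ⟨x, hx, hmin⟩ := exists_isLeast_image_of_compact (S := S)
    (K := Icc δ₀ δ₁ ×ˢ Icc (√δ₀ / (2 * g ^ 2)) (2 * d * g / √δ₀) ×ˢ
      Icc (δ₀ / (64 * d ^ 3 * g)) (1 - 1 / g)) hx₀
    (isCompact_Icc.prod (isCompact_Icc.prod isCompact_Icc)) (by
      rintro ⟨a, y, z⟩ ⟨ha, hy, hz⟩
      refine ⟨lt_of_lt_of_le hδ₀ ha.1, lt_of_lt_of_le ?_ hy.1, lt_of_lt_of_le ?_ hz.1,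
        lt_of_le_of_lt hz.2 ?_⟩
      · positivity
      · positivity
      · have : 0 < 1 / g := by positivity
        linarith) hcont (by
      rintro ⟨a, y, z⟩ ⟨ha, hy, hz⟩ hle
      have ha : 0 < a := ha
      have hF := max_le_iff.1 hle
      obtain ⟨hF1, hF2⟩ := hF
      change _ ≤ m at hF1 hF2
      simp only at hF1 hF2
      rw [div_le_iff₀ hdp] at hF2
      obtain ⟨-, h1, h2, h3, h4, h5⟩ := bounds_of_gConst_le hd ha hb₂0 hb₂ hy hz.1 hz.2 hF2
      -- The term `1/δ` in the first entry of the maximum keeps `δ` away from `0`; `h5` is the upper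
      -- bound.
      have hle : δ₀ ≤ a := by
        rw [div_le_iff₀ (by positivity)] at hF1
        have h6 : 1 / a ≤ m * d ^ 2 := by
          have h7 : m * (d ^ 2 * (1 - b₁ ^ 2)) ≤ m * d ^ 2 := by
            have : (0 : ℝ) ≤ m * d ^ 2 * b₁ ^ 2 := by positivity
            nlinarith
          linarith
        rw [div_le_iff₀ ha] at h6
        rw [div_le_iff₀ (by positivity)]
        linarith
      have hsle : √δ₀ ≤ √a := Real.sqrt_le_sqrt hle
      refine ⟨⟨hle, h5⟩, ⟨?_, ?_⟩, ?_, h4⟩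
      · exact (div_le_div_of_nonneg_right hsle (by positivity)).trans h1
      · exact h2.trans (div_le_div_of_nonneg_left (by positivity) hsδ₀ hsle)
      · exact (div_le_div_of_nonneg_right hle (by positivity)).trans h3)
  have hxδ : 0 < x.1 := hx.1
  have hL := isLeast_MConst hd hb₂0 hb₂ hxδ
  have hval : ∀ δ : ℝ, 0 < δ → F x ≤
      max ((1 + 1 / δ) / ((d : ℝ) ^ 2 * (1 - b₁ ^ 2))) (MConst d b₂ δ / d) := by
    intro δ hδ
    obtain ⟨γ₁, γ₂, h1, h2, h3, h4⟩ := (isLeast_MConst hd hb₂0 hb₂ hδ).1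
    rw [h4]
    exact hmin (δ, γ₁, γ₂) ⟨hδ, h1, h2, h3⟩
  have h : IsLeast (μValues d b₁ b₂)
      (max ((1 + 1 / x.1) / ((d : ℝ) ^ 2 * (1 - b₁ ^ 2))) (MConst d b₂ x.1 / d)) := by
    refine ⟨⟨x.1, hxδ, rfl⟩, ?_⟩
    rintro _ ⟨δ, hδ, rfl⟩
    refine le_trans ?_ (hval δ hδ)
    refine max_le_max le_rfl (div_le_div_of_nonneg_right (hL.2 ⟨x.2.1, x.2.2, hx.2.1, hx.2.2.1,
      hx.2.2.2, rfl⟩) hdp.le)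
  rwa [μConst, h.csInf_eq]

/-- The quadratic inequality behind `M_{d,b}(δ)`. -/
theorem le_gConst_mul (hd : 1 ≤ d) (hδ : 0 < δ) (hb0 : 0 ≤ b) (hb : b < 1) (h₁ : 0 < γ₁)
    (h₂ : 0 < γ₂) (h₂' : γ₂ < 1) {X N T : ℝ} (hX : 0 ≤ X) (hN : 0 ≤ N)
    (hT : T ^ 2 ≤ δ * (X * N / d))
    (h : (1 - b ^ 2) * X ^ 2 ≤ T * X / (4 * d) + (4 * d + 1) / d * (X * N) + T * N) :
    X ≤ gConst d δ b γ₁ γ₂ * N := by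
  have hdp : (0 : ℝ) < d := by exact_mod_cast hd
  have hβ := one_sub_sq_pos hb0 hb
  have hγ := one_sub_sq_pos h₂.le h₂'
  have hs := Real.sqrt_pos.2 hδ
  have hs2 : √δ ^ 2 = δ := Real.sq_sqrt hδ.le
  set β := 1 - b ^ 2 with hβdef
  set s := √δ with hsdef
  -- Then `T ≤ √δ q`, and both applications of Young's inequality produce multiples of `q² = X N/d`,
  -- the quantity that already multiplies `4d+1`.
  set q := √(X * N / d) with hqdef
  have hq0 : 0 ≤ q := Real.sqrt_nonneg _
  have hq2 : q ^ 2 = X * N / d := Real.sq_sqrt (by positivity)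
  have hTq : T ≤ s * q := by
    refine le_of_sq_le_sq ?_ (by positivity)
    rw [mul_pow, hs2, hq2]; exact hT
  -- The weight is chosen so that exactly the fraction `γ₂²` of `(1 - b²) X²` moves to the left-hand
  -- side.
  have e1 : T * X / (4 * d) ≤ γ₂ ^ 2 * β * X ^ 2 + 1 / β * (s / (8 * d * γ₂)) ^ 2 * q ^ 2 := by
    have h1 : T * X / (4 * d) ≤ s * q * X / (4 * d) := by gcongr
    have h2 : γ₂ ^ 2 * β * X ^ 2 + 1 / β * (s / (8 * d * γ₂)) ^ 2 * q ^ 2 - s * q * X / (4 * d)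
        = (γ₂ * β * X - s / (8 * d * γ₂) * q) ^ 2 / β := by
      field_simp; ring
    have h3 : 0 ≤ (γ₂ * β * X - s / (8 * d * γ₂) * q) ^ 2 / β := by positivity
    linarith
  have e2 : T * N ≤ s * (γ₁ * q ^ 2 / 2 + N ^ 2 / (2 * γ₁)) := by
    have h1 : T * N ≤ s * (q * N) := by
      rw [← mul_assoc]; gcongr
    have h2 : γ₁ * q ^ 2 / 2 + N ^ 2 / (2 * γ₁) - q * N = (γ₁ * q - N) ^ 2 / (2 * γ₁) := by
      field_simp; ring
    have h3 : 0 ≤ (γ₁ * q - N) ^ 2 / (2 * γ₁) := by positivity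
    refine h1.trans (mul_le_mul_of_nonneg_left (by linarith) hs.le)
  have hden : 0 < β * (1 - γ₂ ^ 2) := by positivity
  have key : X ^ 2 ≤ 2 * aConst d δ b γ₁ γ₂ * (X * N) + bConst δ b γ₁ γ₂ * N ^ 2 := by
    have h3 : (β * (1 - γ₂ ^ 2)) * X ^ 2 ≤ (4 * d + 1 + γ₁ * s / 2
        + 1 / β * (s / (8 * d * γ₂)) ^ 2) * q ^ 2 + s / (2 * γ₁) * N ^ 2 := by
      have : (4 * d + 1) / d * (X * N) = (4 * d + 1) * q ^ 2 := by rw [hq2]; ring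
      have e3 : s * (γ₁ * q ^ 2 / 2 + N ^ 2 / (2 * γ₁)) =
        γ₁ * s / 2 * q ^ 2 + s / (2 * γ₁) * N ^ 2 := by ring
      linarith
    have h4 : 2 * aConst d δ b γ₁ γ₂ * (X * N) + bConst δ b γ₁ γ₂ * N ^ 2
        = ((4 * d + 1 + γ₁ * s / 2
        + 1 / β * (s / (8 * d * γ₂)) ^ 2) * q ^ 2 + s / (2 * γ₁) * N ^ 2)
          / (β * (1 - γ₂ ^ 2)) := by
      rw [aConst, bConst, hq2, ← hβdef, ← hsdef]
      generalize 4 * (d : ℝ) + 1 + γ₁ * s / 2 + 1 / β * (s / (8 * d * γ₂)) ^ 2 = z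
      field_simp
    rw [h4, le_div_iff₀ hden]
    linarith
  set a := aConst d δ b γ₁ γ₂
  set b' := bConst δ b γ₁ γ₂ with hb'
  have hb'0 : 0 < b' := bConst_pos hδ hb0 hb h₁ h₂ h₂'
  -- Completing the square in `X² ≤ 2a X N + b N²`.
  have h5 : X - a * N ≤ √(a ^ 2 + b') * N := by
    refine le_of_sq_le_sq ?_ (by positivity)
    rw [mul_pow, Real.sq_sqrt (by positivity)]
    nlinarith
  rw [gConst]
  linarith

end Constants

/-! ### The Koranyi norm and its horizontal derivatives. -/

section Koranyi

variable {d : ℕ}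

/-- `|z|²`. -/
noncomputable def zSq (p : Heis d) : ℝ := ∑ j, ‖p.1 j‖ ^ 2

/-- `|z|⁴ + t²`, the fourth power of the Koranyi norm. -/
noncomputable def koranyi4 (p : Heis d) : ℝ := zSq p ^ 2 + p.2 ^ 2

theorem zSq_nonneg (p : Heis d) : 0 ≤ zSq p := Finset.sum_nonneg fun _ _ => by positivity

theorem koranyi4_nonneg (p : Heis d) : 0 ≤ koranyi4 p := by unfold koranyi4; positivity

theorem zNorm_sq (p : Heis d) : zNorm p ^ 2 = zSq p := Real.sq_sqrt (zSq_nonneg p)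

theorem zNorm_nonneg (p : Heis d) : 0 ≤ zNorm p := Real.sqrt_nonneg _

theorem koranyi_eq (p : Heis d) : koranyi p = koranyi4 p ^ (1 / 4 : ℝ) := by
  rw [koranyi, koranyi4, ← zNorm_sq]; ring_nf

theorem koranyi_nonneg (p : Heis d) : 0 ≤ koranyi p := by
  rw [koranyi_eq]; exact Real.rpow_nonneg (koranyi4_nonneg p) _

theorem koranyi_pow_four (p : Heis d) : koranyi p ^ 4 = koranyi4 p := by
  rw [koranyi_eq, ← Real.rpow_natCast, ← Real.rpow_mul (koranyi4_nonneg p)]; norm_num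

theorem zSq_le (p : Heis d) : zSq p ≤ koranyi p ^ 2 := by
  refine le_of_sq_le_sq ?_ (by positivity)
  rw [← pow_mul, koranyi_pow_four, koranyi4]; nlinarith [sq_nonneg p.2]

theorem zNorm_le (p : Heis d) : zNorm p ≤ koranyi p :=
  le_of_sq_le_sq (by rw [zNorm_sq]; exact zSq_le p) (koranyi_nonneg p)

theorem abs_snd_le (p : Heis d) : |p.2| ≤ koranyi p ^ 2 := by
  refine le_of_sq_le_sq ?_ (by positivity)
  rw [← pow_mul, koranyi_pow_four, koranyi4, sq_abs]; nlinarith [sq_nonneg (zSq p)]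

theorem norm_fst_apply_le (p : Heis d) (j : Fin d) : ‖p.1 j‖ ≤ koranyi p := by
  refine le_of_sq_le_sq (le_trans ?_ (zSq_le p)) (koranyi_nonneg p)
  exact Finset.single_le_sum (f := fun j => ‖p.1 j‖ ^ 2) (fun _ _ => by positivity)
    (Finset.mem_univ j)

theorem koranyi_eq_zero {p : Heis d} : koranyi p = 0 ↔ p = 0 := by
  constructor
  · intro h
    refine Prod.ext (funext fun j => ?_) ?_
    · have := norm_fst_apply_le p j
      rw [h] at this
      exact norm_le_zero_iff.1 this
    · have := abs_snd_le p
      rw [h] at this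
      exact abs_eq_zero.1 (le_antisymm (by simpa using this) (abs_nonneg _))
  · rintro rfl
    rw [koranyi_eq, koranyi4, zSq]; simp

theorem koranyi_pos {p : Heis d} : 0 < koranyi p ↔ p ≠ 0 :=
  (koranyi_nonneg p).lt_iff_ne'.trans koranyi_eq_zero.not

theorem contDiff_zSq : ContDiff ℝ ∞ (zSq (d := d)) := by
  unfold zSq
  refine ContDiff.sum fun j _ => (contDiff_norm_sq ℝ).comp ?_
  fun_prop

theorem contDiff_koranyi4 : ContDiff ℝ ∞ (koranyi4 (d := d)) :=
  (contDiff_zSq.pow 2).add (contDiff_snd.pow 2)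

theorem continuous_koranyi : Continuous (koranyi (d := d)) := by
  simp_rw [funext (koranyi_eq (d := d))]
  exact contDiff_koranyi4.continuous.rpow_const fun _ => Or.inr (by norm_num)

theorem continuous_zNorm : Continuous (zNorm (d := d)) := by
  unfold zNorm
  exact contDiff_zSq.continuous.sqrt

theorem fderiv_zSq (p v : Heis d) :
    fderiv ℝ zSq p v = 2 * ∑ j, ((p.1 j).re * (v.1 j).re + (p.1 j).im * (v.1 j).im) := by
  have h : ∀ j ∈ Finset.univ, HasFDerivAt (fun p : Heis d => ‖p.1 j‖ ^ 2)
      (2 • (innerSL ℝ (p.1 j)).comp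
        ((ContinuousLinearMap.proj (R := ℝ) (φ := fun _ : Fin d => ℂ) j).comp
          (ContinuousLinearMap.fst ℝ (Fin d → ℂ) ℝ))) p := by
    intro j _
    exact ((ContinuousLinearMap.proj (R := ℝ) (φ := fun _ : Fin d => ℂ) j).comp
          (ContinuousLinearMap.fst ℝ (Fin d → ℂ) ℝ)).hasFDerivAt.norm_sq
  have h2 : HasFDerivAt (zSq (d := d)) _ p := HasFDerivAt.fun_sum h
  rw [h2.fderiv]
  simp only [Finset.mul_sum]
  simp [Complex.inner]
  exact Finset.sum_congr rfl fun j _ => by ring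

theorem fderiv_koranyi4 (p v : Heis d) :
    fderiv ℝ koranyi4 p v = 2 * zSq p * fderiv ℝ zSq p v + 2 * p.2 * v.2 := by
  have h1 : HasFDerivAt (zSq (d := d)) _ p :=
    (contDiff_zSq.differentiable (by simp) p).hasFDerivAt
  have h2 : HasFDerivAt (fun p : Heis d => p.2) (ContinuousLinearMap.snd ℝ (Fin d → ℂ) ℝ) p :=
    (ContinuousLinearMap.snd ℝ (Fin d → ℂ) ℝ).hasFDerivAt
  have h3 : HasFDerivAt (koranyi4 (d := d)) _ p := (h1.pow 2).add (h2.pow 2)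
  rw [h3.fderiv]
  simp

/-- The polynomials `ρ³ Z_i ρ`. -/
noncomputable def gradPoly (i : Fin d ⊕ Fin d) (p : Heis d) : ℝ :=
  match i with
  | Sum.inl j => zSq p * (p.1 j).re + p.2 * (p.1 j).im
  | Sum.inr j => zSq p * (p.1 j).im - p.2 * (p.1 j).re

theorem fderiv_koranyi4_frame (i : Fin d ⊕ Fin d) (p : Heis d) :
    fderiv ℝ koranyi4 p (horizontalFrame i p) = 4 * gradPoly i p := by
  rw [fderiv_koranyi4, fderiv_zSq]
  rcases i with j | j
  · simp only [horizontalFrame, fieldX, gradPoly]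
    rw [Finset.sum_eq_single j (fun k _ hk => by simp [Pi.single_eq_of_ne hk]) (by simp)]
    simp; ring
  · simp only [horizontalFrame, fieldY, gradPoly]
    rw [Finset.sum_eq_single j (fun k _ hk => by simp [Pi.single_eq_of_ne hk]) (by simp)]
    simp; ring

theorem fderiv_koranyi4_euler (p : Heis d) :
    fderiv ℝ koranyi4 p (p.1, 2 * p.2) = 4 * koranyi4 p := by
  rw [fderiv_koranyi4, fderiv_zSq, koranyi4]
  have : ∑ j, ((p.1 j).re * (p.1 j).re + (p.1 j).im * (p.1 j).im) = zSq p := by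
    unfold zSq
    exact Finset.sum_congr rfl fun j _ => by
      rw [← Complex.normSq_eq_norm_sq, Complex.normSq_apply]
  simp only [this]; ring

theorem contDiff_gradPoly (i : Fin d ⊕ Fin d) : ContDiff ℝ ∞ (gradPoly i) := by
  have hre : ∀ j : Fin d, ContDiff ℝ ∞ fun p : Heis d => (p.1 j).re := fun j =>
    Complex.reCLM.contDiff.comp (by fun_prop)
  have him : ∀ j : Fin d, ContDiff ℝ ∞ fun p : Heis d => (p.1 j).im := fun j =>
    Complex.imCLM.contDiff.comp (by fun_prop)
  rcases i with j | j
  · exact (contDiff_zSq.mul (hre j)).add (contDiff_snd.mul (him j))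
  · exact (contDiff_zSq.mul (him j)).sub (contDiff_snd.mul (hre j))

/-- The mixed terms of each pair `X_j`, `Y_j` cancel. Divided by `ρ⁶` this is `|∇_ℍ ρ|² = |z|²/ρ²`.
-/
theorem sum_gradPoly_sq (p : Heis d) : ∑ i, gradPoly i p ^ 2 = zSq p * koranyi4 p := by
  rw [Fintype.sum_sum_type, ← Finset.sum_add_distrib]
  simp only [gradPoly]
  have : ∀ j, (zSq p * (p.1 j).re + p.2 * (p.1 j).im) ^ 2
      + (zSq p * (p.1 j).im - p.2 * (p.1 j).re) ^ 2 = koranyi4 p * ‖p.1 j‖ ^ 2 := fun j => by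
    rw [← Complex.normSq_eq_norm_sq, Complex.normSq_apply, koranyi4]; ring
  simp_rw [this]
  rw [← Finset.mul_sum, mul_comm]; rfl

theorem fderiv_gradPoly_frame (i : Fin d ⊕ Fin d) (p : Heis d) :
    fderiv ℝ (gradPoly i) p (horizontalFrame i p) =
      zSq p + 2 * ‖p.1 (Sum.elim id id i)‖ ^ 2 := by
  have h1 : HasFDerivAt (zSq (d := d)) _ p :=
    (contDiff_zSq.differentiable (by simp) p).hasFDerivAt
  have h2 : HasFDerivAt (fun p : Heis d => p.2) (ContinuousLinearMap.snd ℝ (Fin d → ℂ) ℝ) p :=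
    (ContinuousLinearMap.snd ℝ (Fin d → ℂ) ℝ).hasFDerivAt
  have hj : ∀ j : Fin d, HasFDerivAt (fun p : Heis d => p.1 j)
      ((ContinuousLinearMap.proj (R := ℝ) (φ := fun _ : Fin d => ℂ) j).comp
          (ContinuousLinearMap.fst ℝ (Fin d → ℂ) ℝ)) p := fun j =>
    ((ContinuousLinearMap.proj (R := ℝ) (φ := fun _ : Fin d => ℂ) j).comp
          (ContinuousLinearMap.fst ℝ (Fin d → ℂ) ℝ)).hasFDerivAt
  have hre := fun j => Complex.reCLM.hasFDerivAt.comp p (hj j)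
  have him := fun j => Complex.imCLM.hasFDerivAt.comp p (hj j)
  rcases i with j | j
  · have h3 : HasFDerivAt (gradPoly (Sum.inl j)) _ p := (h1.mul (hre j)).add (h2.mul (him j))
    rw [h3.fderiv]
    simp only [horizontalFrame, fieldX, Sum.elim_inl, id]
    rw [← Complex.normSq_eq_norm_sq, Complex.normSq_apply]
    simp [fderiv_zSq]
    rw [Finset.sum_eq_single j (fun k _ hk => by simp [Pi.single_eq_of_ne hk]) (by simp)]
    simp; ring
  · have h3 : HasFDerivAt (gradPoly (Sum.inr j)) _ p := (h1.mul (him j)).sub (h2.mul (hre j))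
    rw [h3.fderiv]
    simp only [horizontalFrame, fieldY, Sum.elim_inr, id]
    rw [← Complex.normSq_eq_norm_sq, Complex.normSq_apply]
    simp [fderiv_zSq]
    rw [Finset.sum_eq_single j (fun k _ hk => by simp [Pi.single_eq_of_ne hk]) (by simp)]
    simp; ring

/-- The horizontal divergence of `ρ³ ∇_ℍ ρ`. Each of the `2d` fields contributes `|z|²`, and the
summands `2|z_j|²` occur twice, for `X_j` and for `Y_j`. -/
theorem sum_fderiv_gradPoly_frame (p : Heis d) :
    ∑ i, fderiv ℝ (gradPoly i) p (horizontalFrame i p) = (2 * d + 4) * zSq p := by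
  simp_rw [fderiv_gradPoly_frame]
  rw [Fintype.sum_sum_type]
  simp only [Sum.elim_inl, Sum.elim_inr, id, Finset.sum_add_distrib, ← Finset.mul_sum]
  simp only [Finset.sum_const, Finset.card_univ, Fintype.card_fin, nsmul_eq_mul]
  change d * zSq p + 2 * zSq p + (d * zSq p + 2 * zSq p) = _
  ring

/-- The horizontal gradient `Z_i ρ` of the Koranyi norm. -/
noncomputable def gradKoranyi (i : Fin d ⊕ Fin d) (p : Heis d) : ℝ := gradPoly i p / koranyi p ^ 3

theorem sum_gradKoranyi_sq (p : Heis d) :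
    ∑ i, gradKoranyi i p ^ 2 = zSq p / koranyi p ^ 2 := by
  simp_rw [gradKoranyi, div_pow]
  rw [← Finset.sum_div, sum_gradPoly_sq, ← koranyi_pow_four]
  rcases eq_or_ne (koranyi p) 0 with h | h
  · simp [h]
  · field_simp

theorem abs_gradKoranyi_le (i : Fin d ⊕ Fin d) (p : Heis d) : |gradKoranyi i p| ≤ 1 := by
  rw [← sq_le_one_iff_abs_le_one]
  refine (Finset.single_le_sum (f := fun i => gradKoranyi i p ^ 2) (fun _ _ => by positivity)
    (Finset.mem_univ i)).trans ?_
  rw [sum_gradKoranyi_sq]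
  exact div_le_one_of_le₀ (zSq_le p) (by positivity)

theorem measurable_gradKoranyi (i : Fin d ⊕ Fin d) : Measurable (gradKoranyi i) :=
  (contDiff_gradPoly i).continuous.measurable.div (continuous_koranyi.measurable.pow_const 3)

theorem fderiv_koranyi {p : Heis d} (hp : p ≠ 0) :
    HasFDerivAt koranyi ((1 / (4 * koranyi p ^ 3)) • fderiv ℝ koranyi4 p) p := by
  have hp' := koranyi_pos.2 hp
  have h4 : 0 < koranyi4 p := by rw [← koranyi_pow_four]; positivity
  have h1 : HasFDerivAt (koranyi4 (d := d)) _ p :=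
    (contDiff_koranyi4.differentiable (by simp) p).hasFDerivAt
  have h2 := h1.rpow_const (p := (1 / 4 : ℝ)) (Or.inl h4.ne')
  rw [funext (koranyi_eq (d := d))]
  refine h2.congr_fderiv ?_
  congr 1
  dsimp only
  rw [← koranyi_eq, ← koranyi_pow_four, ← Real.rpow_natCast, ← Real.rpow_mul (koranyi_nonneg p)]
  rw [show ((4 : ℕ) : ℝ) * (1 / 4 - 1) = -((3 : ℕ) : ℝ) by norm_num, Real.rpow_neg
    (koranyi_nonneg p), Real.rpow_natCast]
  field_simp

end Koranyi

/-! ### Radial test functions and integration by parts on the group. -/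

section RadialTest

variable {d : ℕ}

theorem isCompact_koranyi_le (b : ℝ) : IsCompact {p : Heis d | koranyi p ≤ b} := by
  have h1 : IsCompact ((Set.univ.pi fun _ : Fin d => Metric.closedBall (0 : ℂ) b) ×ˢ
      Metric.closedBall (0 : ℝ) (b ^ 2)) :=
    (isCompact_univ_pi fun _ => isCompact_closedBall _ _).prod (isCompact_closedBall _ _)
  refine h1.of_isClosed_subset (isClosed_le continuous_koranyi continuous_const) ?_
  intro p hp
  have hp : koranyi p ≤ b := hp
  refine ⟨fun j _ => ?_, ?_⟩
  · simpa using (norm_fst_apply_le p j).trans hp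
  · have h2 := abs_snd_le p
    have h3 := pow_le_pow_left₀ (koranyi_nonneg p) hp 2
    simpa using h2.trans h3

/-- The Koranyi norm is not smooth at the origin; a profile supported in `(0, ∞)` hides this point.
-/
theorem IsRadialTest.comp_koranyi_eventually_zero {F : ℝ → ℝ} (hF : IsRadialTest F) :
    (fun p : Heis d => F (koranyi p)) =ᶠ[𝓝 0] fun _ => 0 := by
  obtain ⟨a, b, ha, hab, h0⟩ := hF.exists_Icc
  have : {p : Heis d | koranyi p < a} ∈ 𝓝 (0 : Heis d) :=
    (isOpen_lt continuous_koranyi continuous_const).mem_nhds (by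
      change koranyi (0 : Heis d) < a
      rw [koranyi_eq_zero.2 rfl]; exact ha)
  filter_upwards [this] with p hp
  exact h0 _ fun hc => not_lt.2 hc.1 hp

theorem IsRadialTest.isTestFunction {F : ℝ → ℝ} (hF : IsRadialTest F) :
    IsTestFunction (fun p : Heis d => F (koranyi p)) := by
  constructor
  · rw [contDiff_iff_contDiffAt]
    intro p
    rcases eq_or_ne p 0 with rfl | hp
    · exact contDiffAt_const.congr_of_eventuallyEq hF.comp_koranyi_eventually_zero
    · have hp' := koranyi_pos.2 hp
      have h4 : koranyi4 p ≠ 0 := by rw [← koranyi_pow_four]; positivity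
      refine hF.contDiff.contDiffAt.comp p ?_
      rw [funext (koranyi_eq (d := d))]
      exact contDiff_koranyi4.contDiffAt.rpow_const_of_ne h4
  · obtain ⟨a, b, ha, hab, h0⟩ := hF.exists_Icc
    refine HasCompactSupport.intro (isCompact_koranyi_le b) fun p hp => h0 _ fun hc => hp hc.2

theorem IsRadialTest.fderiv_comp_koranyi {F : ℝ → ℝ} (hF : IsRadialTest F) (p v : Heis d) :
    fderiv ℝ (fun p : Heis d => F (koranyi p)) p v =
      _root_.deriv F (koranyi p) * (fderiv ℝ koranyi4 p v / (4 * koranyi p ^ 3)) := by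
  rcases eq_or_ne p 0 with rfl | hp
  · rw [hF.comp_koranyi_eventually_zero.fderiv_eq, koranyi_eq_zero.2 rfl,
      hF.deriv.eq_zero le_rfl]
    simp
  · have h := (hF.hasDerivAt (koranyi p)).comp_hasFDerivAt p (fderiv_koranyi hp)
    have h' : HasFDerivAt (fun p : Heis d => F (koranyi p)) _ p := h
    rw [h'.fderiv]
    simp only [smul_apply, smul_eq_mul]
    ring

theorem IsRadialTest.fderiv_frame {F : ℝ → ℝ} (hF : IsRadialTest F) (i : Fin d ⊕ Fin d)
    (p : Heis d) :
    fderiv ℝ (fun p : Heis d => F (koranyi p)) p (horizontalFrame i p) =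
      _root_.deriv F (koranyi p) * gradKoranyi i p := by
  rw [hF.fderiv_comp_koranyi, fderiv_koranyi4_frame, gradKoranyi, mul_div_mul_left _ _ four_ne_zero]

theorem IsRadialTest.fderiv_euler {F : ℝ → ℝ} (hF : IsRadialTest F) (p : Heis d) :
    fderiv ℝ (fun p : Heis d => F (koranyi p)) p (p.1, 2 * p.2) =
      _root_.deriv F (koranyi p) * koranyi p := by
  rw [hF.fderiv_comp_koranyi, fderiv_koranyi4_euler, ← koranyi_pow_four]
  rcases eq_or_ne (koranyi p) 0 with h | h
  · simp [h]
  · field_simp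

theorem IsTestFunction.mul {φ ψ : Heis d → ℝ} (hφ : ContDiff ℝ ∞ φ) (hψ : IsTestFunction ψ) :
    IsTestFunction (fun p => φ p * ψ p) :=
  ⟨hφ.mul hψ.1, hψ.2.mul_left⟩

theorem fderiv_mul_apply {φ ψ : Heis d → ℝ} (hφ : ContDiff ℝ ∞ φ) (hψ : ContDiff ℝ ∞ ψ)
    (p v : Heis d) :
    fderiv ℝ (fun p => φ p * ψ p) p v = φ p * fderiv ℝ ψ p v + fderiv ℝ φ p v * ψ p := by
  rw [fderiv_fun_mul (hφ.differentiable (by simp) p) (hψ.differentiable (by simp) p)]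
  simp; ring

theorem IsTestFunction.integrable {φ : Heis d → ℝ} (hφ : IsTestFunction φ) : Integrable φ :=
  hφ.1.continuous.integrable_of_hasCompactSupport hφ.2

theorem IsTestFunction.continuous_fderiv_apply {φ : Heis d → ℝ} (hφ : ContDiff ℝ ∞ φ)
    {Z : Heis d → Heis d} (hZ : Continuous Z) : Continuous fun p => fderiv ℝ φ p (Z p) :=
  (hφ.continuous_fderiv (by simp)).clm_apply hZ

theorem IsTestFunction.hasCompactSupport_fderiv_apply {φ : Heis d → ℝ} (hφ : IsTestFunction φ)
    (Z : Heis d → Heis d) : HasCompactSupport fun p => fderiv ℝ φ p (Z p) :=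
  HasCompactSupport.intro hφ.2 fun p hp => by
    have : fderiv ℝ φ p = 0 := image_eq_zero_of_notMem_tsupport fun h =>
      hp (tsupport_fderiv_subset ℝ h)
    rw [this]; rfl

theorem continuous_horizontalFrame (i : Fin d ⊕ Fin d) : Continuous (horizontalFrame i) := by
  rcases i with j | j
  · exact continuous_const.prodMk (by fun_prop)
  · exact continuous_const.prodMk (by fun_prop)

instance : (volume : Measure (Heis d)).IsAddHaarMeasure :=
  Measure.prod.instIsAddHaarMeasure (volume : Measure (Fin d → ℂ)) (volume : Measure ℝ)

theorem IsTestFunction.integral_mul_fderiv {φ a : Heis d → ℝ} (hφ : IsTestFunction φ)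
    (ha : ContDiff ℝ ∞ a) (v : Heis d) :
    ∫ p, a p * fderiv ℝ φ p v = - ∫ p, fderiv ℝ a p v * φ p := by
  refine integral_mul_fderiv_eq_neg_fderiv_mul_of_integrable ?_ ?_ ?_
    (fun p _ => ha.differentiable (by simp) p) (fun p _ => hφ.1.differentiable (by simp) p)
  · exact ((continuous_fderiv_apply ha continuous_const).mul
      hφ.1.continuous).integrable_of_hasCompactSupport hφ.2.mul_left
  · exact (ha.continuous.mul (continuous_fderiv_apply hφ.1
      continuous_const)).integrable_of_hasCompactSupport
      (hφ.hasCompactSupport_fderiv_apply fun _ => v).mul_left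
  · exact (ha.continuous.mul hφ.1.continuous).integrable_of_hasCompactSupport hφ.2.mul_left

theorem IsTestFunction.integral_fderiv_const {φ : Heis d → ℝ} (hφ : IsTestFunction φ)
    (v : Heis d) : ∫ p, fderiv ℝ φ p v = 0 := by
  have := hφ.integral_mul_fderiv (a := fun _ => 1) contDiff_const v
  simpa using this

/-- The horizontal fields are divergence free. -/
theorem IsTestFunction.integral_fderiv_frame {φ : Heis d → ℝ} (hφ : IsTestFunction φ)
    (i : Fin d ⊕ Fin d) : ∫ p, fderiv ℝ φ p (horizontalFrame i p) = 0 := by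
  -- Each field is a constant vector plus a multiple of `∂_t` whose coefficient does not depend on
  -- `t`, so `∂_t` moves across the coefficient.
  have key : ∀ (v : Fin d → ℂ) (a : Heis d → ℝ), ContDiff ℝ ∞ a →
      (∀ p, fderiv ℝ a p (0, 1) = 0) → ∫ p, fderiv ℝ φ p (v, a p) = 0 := by
    intro v a ha h0
    have h1 : ∀ p, fderiv ℝ φ p (v, a p) =
        fderiv ℝ φ p (v, 0) + a p * fderiv ℝ φ p ((0, 1) : Heis d) := fun p => by
      rw [← smul_eq_mul, ← map_smul, ← map_add]; simp
    simp_rw [h1]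
    rw [integral_add, hφ.integral_fderiv_const, hφ.integral_mul_fderiv ha]
    · simp [h0]
    · exact (continuous_fderiv_apply hφ.1 continuous_const).integrable_of_hasCompactSupport
        (hφ.hasCompactSupport_fderiv_apply _)
    · exact (ha.continuous.mul (continuous_fderiv_apply hφ.1
        continuous_const)).integrable_of_hasCompactSupport
        (hφ.hasCompactSupport_fderiv_apply fun _ => _).mul_left
  rcases i with j | j
  · refine key _ (fun p => 2 * (p.1 j).im)
      (contDiff_const.mul (Complex.imCLM.contDiff.comp (by fun_prop))) fun p => ?_
    have h : HasFDerivAt (fun p : Heis d => 2 * (p.1 j).im) ((2 : ℝ) • (Complex.imCLM.comp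
        ((ContinuousLinearMap.proj (R := ℝ) (φ := fun _ : Fin d => ℂ) j).comp
          (ContinuousLinearMap.fst ℝ (Fin d → ℂ) ℝ)))) p :=
      ((2 : ℝ) • (Complex.imCLM.comp
        ((ContinuousLinearMap.proj (R := ℝ) (φ := fun _ : Fin d => ℂ) j).comp
          (ContinuousLinearMap.fst ℝ (Fin d → ℂ) ℝ)))).hasFDerivAt
    rw [h.fderiv]; simp
  · refine key _ (fun p => -2 * (p.1 j).re)
      (contDiff_const.mul (Complex.reCLM.contDiff.comp (by fun_prop))) fun p => ?_
    have h : HasFDerivAt (fun p : Heis d => -2 * (p.1 j).re) ((-2 : ℝ) • (Complex.reCLM.comp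
        ((ContinuousLinearMap.proj (R := ℝ) (φ := fun _ : Fin d => ℂ) j).comp
          (ContinuousLinearMap.fst ℝ (Fin d → ℂ) ℝ)))) p :=
      ((-2 : ℝ) • (Complex.reCLM.comp
        ((ContinuousLinearMap.proj (R := ℝ) (φ := fun _ : Fin d => ℂ) j).comp
          (ContinuousLinearMap.fst ℝ (Fin d → ℂ) ℝ)))).hasFDerivAt
    rw [h.fderiv]; simp

end RadialTest

/-! ### Dilations and polar coordinates. -/

section Dilation

variable {d : ℕ}

/-- The Heisenberg dilations `(z, t) ↦ (r z, r² t)`. -/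
noncomputable def dil (r : ℝ) (p : Heis d) : Heis d := (r • p.1, r ^ 2 * p.2)

theorem continuous_dil : Continuous fun x : ℝ × Heis d => dil x.1 x.2 := by
  unfold dil; fun_prop

theorem measurable_dil : Measurable fun x : ℝ × Heis d => dil x.1 x.2 := continuous_dil.measurable

theorem measurable_comp_dil {β : Type*} [MeasurableSpace β] {F : Heis d → β} (hF : Measurable F)
    (r : ℝ) : Measurable fun q => F (dil r q) :=
  hF.comp (measurable_dil.comp (measurable_const.prodMk measurable_id))

theorem dil_dil (r s : ℝ) (p : Heis d) : dil r (dil s p) = dil (r * s) p := by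
  refine Prod.ext ?_ ?_
  · simp [dil, mul_smul]
  · simp only [dil]; ring

theorem dil_one (p : Heis d) : dil 1 p = p := by simp [dil]

theorem zSq_dil (r : ℝ) (p : Heis d) : zSq (dil r p) = r ^ 2 * zSq p := by
  simp only [zSq, dil, Finset.mul_sum, Pi.smul_apply, norm_smul, mul_pow, Real.norm_eq_abs, sq_abs]

theorem koranyi4_dil (r : ℝ) (p : Heis d) : koranyi4 (dil r p) = r ^ 4 * koranyi4 p := by
  rw [koranyi4, zSq_dil, koranyi4]; simp only [dil]; ring

theorem koranyi_dil {r : ℝ} (hr : 0 ≤ r) (p : Heis d) : koranyi (dil r p) = r * koranyi p := by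
  refine (pow_left_inj₀ (koranyi_nonneg _) (mul_nonneg hr (koranyi_nonneg p)) four_ne_zero).1 ?_
  rw [koranyi_pow_four, koranyi4_dil, mul_pow, koranyi_pow_four]

theorem lintegral_comp_smul {E : Type*} [NormedAddCommGroup E] [NormedSpace ℝ E]
    [FiniteDimensional ℝ E] [MeasurableSpace E] [BorelSpace E] (μ : Measure E) [μ.IsAddHaarMeasure]
    {s : ℝ} (hs : 0 < s) {F : E → ℝ≥0∞} (hF : Measurable F) :
    ∫⁻ x, F (s • x) ∂μ =
      ENNReal.ofReal (s ^ Module.finrank ℝ E)⁻¹ * ∫⁻ x, F x ∂μ := by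
  rw [← lintegral_map hF (measurable_const_smul s), Measure.map_addHaar_smul μ hs.ne',
    lintegral_smul_measure, abs_of_pos (by positivity), smul_eq_mul]

/-- The Jacobian is `s^(2d)` from `z` times `s²` from `t`; hence the homogeneous dimension `2d+2`.
-/
theorem lintegral_dil {s : ℝ} (hs : 0 < s) {F : Heis d → ℝ≥0∞} (hF : Measurable F) :
    ∫⁻ p, F (dil s p) = ENNReal.ofReal (s ^ (2 * d + 2))⁻¹ * ∫⁻ p, F p := by
  have hm : Measurable fun p : Heis d => F (dil s p) :=
    hF.comp (measurable_dil.comp (measurable_const.prodMk measurable_id))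
  rw [Measure.volume_eq_prod, lintegral_prod _ hm.aemeasurable, lintegral_prod _ hF.aemeasurable]
  have h1 : ∀ z : Fin d → ℂ, ∫⁻ t : ℝ, F (dil s (z, t)) =
      ENNReal.ofReal (s ^ 2)⁻¹ * ∫⁻ t : ℝ, F (s • z, t) := fun z => by
    have := lintegral_comp_smul (volume : Measure ℝ) (pow_pos hs 2)
      (F := fun t => F (s • z, t)) (by fun_prop)
    simpa [dil] using this
  simp_rw [h1]
  have hm2 : Measurable fun z : Fin d → ℂ => ∫⁻ t : ℝ, F (z, t) :=
    hF.lintegral_prod_right'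
  rw [lintegral_const_mul' _ _ ENNReal.ofReal_ne_top,
    lintegral_comp_smul (volume : Measure (Fin d → ℂ)) hs hm2, ← mul_assoc,
    ← ENNReal.ofReal_mul (by positivity)]
  have : Module.finrank ℝ (Fin d → ℂ) = 2 * d := by
    rw [Module.finrank_pi_fintype]; simp [Complex.finrank_real_complex, mul_comm]
  rw [this]
  congr 2
  rw [← mul_inv, ← pow_add, add_comm]

/-- The dilation invariant measure `ρ^{-(2d+2)} dz dt`. -/
noncomputable def dilMeasure (d : ℕ) : Measure (Heis d) :=
  volume.withDensity fun p => ENNReal.ofReal (koranyi p ^ (2 * d + 2))⁻¹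

/-- The multiplicative Haar measure `dr / r`. -/
noncomputable def mulMeasure : Measure ℝ :=
  (volume.restrict (Ioi 0)).withDensity fun r => ENNReal.ofReal r⁻¹

instance : SFinite (dilMeasure d) := by unfold dilMeasure; infer_instance

instance : SFinite mulMeasure := by unfold mulMeasure; infer_instance

theorem measurable_koranyi : Measurable (koranyi (d := d)) := continuous_koranyi.measurable

theorem lintegral_dilMeasure {F : Heis d → ℝ≥0∞} (hF : Measurable F) :
    ∫⁻ p, F p ∂(dilMeasure d) = ∫⁻ p, ENNReal.ofReal (koranyi p ^ (2 * d + 2))⁻¹ * F p :=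
  lintegral_withDensity_eq_lintegral_mul _
    ((measurable_koranyi.pow_const _).inv.ennreal_ofReal) hF

theorem lintegral_mulMeasure {F : ℝ → ℝ≥0∞} (hF : Measurable F) :
    ∫⁻ r, F r ∂mulMeasure = ∫⁻ r in Ioi 0, ENNReal.ofReal r⁻¹ * F r :=
  lintegral_withDensity_eq_lintegral_mul _ (measurable_id.inv.ennreal_ofReal) hF

theorem lintegral_dilMeasure_dil {s : ℝ} (hs : 0 < s) {F : Heis d → ℝ≥0∞} (hF : Measurable F) :
    ∫⁻ p, F (dil s p) ∂(dilMeasure d) = ∫⁻ p, F p ∂(dilMeasure d) := by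
  have hm : Measurable fun p : Heis d => F (dil s p) :=
    hF.comp (measurable_dil.comp (measurable_const.prodMk measurable_id))
  rw [lintegral_dilMeasure hF, lintegral_dilMeasure hm]
  have hG : Measurable fun p : Heis d => ENNReal.ofReal (koranyi p ^ (2 * d + 2))⁻¹ * F p :=
    ((measurable_koranyi.pow_const _).inv.ennreal_ofReal).mul hF
  have h1 := lintegral_dil hs hG
  have h2 : ∀ p : Heis d, ENNReal.ofReal (koranyi p ^ (2 * d + 2))⁻¹ * F (dil s p) =
      ENNReal.ofReal (s ^ (2 * d + 2)) *
        (ENNReal.ofReal (koranyi (dil s p) ^ (2 * d + 2))⁻¹ * F (dil s p)) := fun p => by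
    rw [← mul_assoc, ← ENNReal.ofReal_mul (by positivity), koranyi_dil hs.le, mul_pow, mul_inv,
      mul_inv_cancel_left₀ (by positivity)]
  simp_rw [h2]
  rw [lintegral_const_mul' _ _ ENNReal.ofReal_ne_top,
    h1, ← mul_assoc, ← ENNReal.ofReal_mul (by positivity), mul_inv_cancel₀ (by positivity)]
  simp

theorem lintegral_mulMeasure_mul {a : ℝ} (ha : 0 < a) {F : ℝ → ℝ≥0∞} (hF : Measurable F) :
    ∫⁻ r, F (a * r) ∂mulMeasure = ∫⁻ r, F r ∂mulMeasure := by
  have hm : Measurable fun r => F (a * r) := hF.comp (measurable_const_mul a)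
  rw [lintegral_mulMeasure hF, lintegral_mulMeasure hm,
    ← lintegral_indicator measurableSet_Ioi, ← lintegral_indicator measurableSet_Ioi]
  set G : ℝ → ℝ≥0∞ := (Ioi 0).indicator fun r => ENNReal.ofReal r⁻¹ * F r with hGdef
  have hG : Measurable G :=
    ((measurable_id.inv.ennreal_ofReal).mul hF).indicator measurableSet_Ioi
  have h1 := lintegral_comp_smul (volume : Measure ℝ) ha hG
  have h2 : ∀ r : ℝ, (Ioi 0).indicator (fun r => ENNReal.ofReal r⁻¹ * F (a * r)) r =
      ENNReal.ofReal a * G (a • r) := fun r => by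
    by_cases hr : 0 < r
    · rw [indicator_of_mem (show r ∈ Ioi 0 from hr), hGdef,
        indicator_of_mem (show a • r ∈ Ioi 0 from smul_pos ha hr), ← mul_assoc,
        ← ENNReal.ofReal_mul ha.le, smul_eq_mul, mul_inv, mul_inv_cancel_left₀ ha.ne']
    · rw [indicator_of_notMem (show r ∉ Ioi 0 from hr), hGdef, indicator_of_notMem, mul_zero]
      exact fun hc => hr ((mul_pos_iff_of_pos_left ha).1 hc)
  simp_rw [h2]
  rw [lintegral_const_mul' _ _ ENNReal.ofReal_ne_top, h1, ← mul_assoc,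
    ← ENNReal.ofReal_mul ha.le]
  simp [ha.ne']

theorem measurable_project : Measurable fun p : Heis d => dil (koranyi p)⁻¹ p :=
  measurable_dil.comp (measurable_koranyi.inv.prodMk measurable_id)

/-- The annulus `1 < ρ ≤ 2`. -/
def annulus (d : ℕ) : Set (Heis d) := {p | 1 < koranyi p ∧ koranyi p ≤ 2}

theorem measurableSet_annulus : MeasurableSet (annulus d) :=
  (measurableSet_lt measurable_const measurable_koranyi).inter
    (measurableSet_le measurable_koranyi measurable_const)

theorem volume_annulus_lt_top : volume (annulus d) < ⊤ :=
  (measure_mono fun _ hp => hp.2).trans_lt (isCompact_koranyi_le 2).measure_lt_top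

/-- The unnormalized surface measure of the Koranyi sphere, obtained by projecting an annulus. -/
noncomputable def sphereMeasure (d : ℕ) : Measure (Heis d) :=
  ((dilMeasure d).restrict (annulus d)).map fun p => dil (koranyi p)⁻¹ p

theorem lintegral_sphereMeasure {F : Heis d → ℝ≥0∞} (hF : Measurable F) :
    ∫⁻ q, F q ∂(sphereMeasure d) =
      ∫⁻ p in annulus d, F (dil (koranyi p)⁻¹ p) ∂(dilMeasure d) :=
  lintegral_map hF measurable_project

theorem sphereMeasure_koranyi : ∀ᵐ q ∂(sphereMeasure d), koranyi q = 1 := by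
  rw [sphereMeasure, ae_map_iff measurable_project.aemeasurable
    (measurableSet_eq_fun measurable_koranyi measurable_const)]
  filter_upwards [ae_restrict_mem measurableSet_annulus] with p hp
  have h : 0 < koranyi p := one_pos.trans hp.1
  rw [koranyi_dil (by positivity), inv_mul_cancel₀ h.ne']

instance : IsFiniteMeasure (sphereMeasure d) := by
  constructor
  rw [← setLIntegral_one, Measure.restrict_univ, lintegral_sphereMeasure measurable_const,
    ← lintegral_indicator measurableSet_annulus,
    lintegral_dilMeasure (measurable_const.indicator measurableSet_annulus)]
  refine lt_of_le_of_lt (lintegral_mono (g := (annulus d).indicator 1) fun p => ?_) ?_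
  · by_cases hp : p ∈ annulus d
    · rw [indicator_of_mem hp, indicator_of_mem hp, mul_one, Pi.one_apply]
      exact ENNReal.ofReal_le_one.2 (inv_le_one_of_one_le₀ (one_le_pow₀ hp.1.le))
    · simp [hp]
  · rw [lintegral_indicator_one measurableSet_annulus]
    exact volume_annulus_lt_top

/-- The logarithmic thickness of the annulus. -/
noncomputable def annulusWidth : ℝ≥0∞ := mulMeasure (Ico (1 / 2) 1)

theorem annulusWidth_ne_zero : annulusWidth ≠ 0 := by
  rw [annulusWidth, mulMeasure, withDensity_apply _ measurableSet_Ico,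
    Measure.restrict_restrict measurableSet_Ico, inter_eq_left.2
      (show Ico (1 / 2) 1 ⊆ Ioi (0 : ℝ) from fun x hx => lt_of_lt_of_le (by norm_num) hx.1)]
  refine (lt_of_lt_of_le ?_ (setLIntegral_mono' (f := fun _ => 1) measurableSet_Ico
    fun x hx => ?_)).ne'
  · rw [setLIntegral_one, Real.volume_Ico]; norm_num
  · have h0 : 0 < x := lt_of_lt_of_le (by norm_num) hx.1
    rw [← ENNReal.ofReal_one]
    exact ENNReal.ofReal_le_ofReal ((one_le_inv₀ h0).2 hx.2.le)

theorem annulusWidth_ne_top : annulusWidth ≠ ⊤ := by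
  rw [annulusWidth, mulMeasure, withDensity_apply _ measurableSet_Ico,
    Measure.restrict_restrict measurableSet_Ico, inter_eq_left.2
      (show Ico (1 / 2) 1 ⊆ Ioi (0 : ℝ) from fun x hx => lt_of_lt_of_le (by norm_num) hx.1)]
  refine (lt_of_le_of_lt (setLIntegral_mono' (g := fun _ => ENNReal.ofReal 2) measurableSet_Ico
    fun x hx => ?_) ?_).ne
  · refine ENNReal.ofReal_le_ofReal ?_
    rw [show (2 : ℝ) = (1 / 2)⁻¹ by norm_num]
    exact inv_anti₀ (by norm_num) hx.1
  · rw [setLIntegral_const, Real.volume_Ico, ← ENNReal.ofReal_mul (by norm_num)]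
    exact ENNReal.ofReal_lt_top

/-- Invariance of `dr/r` removes `ρ(p)`. What remains is the condition `1 < 1/r ≤ 2`, so every
dilation orbit meets the annulus for the same logarithmic time. -/
theorem mulMeasure_dil_inv_annulus {p : Heis d} (hp : p ≠ 0) :
    ∫⁻ r, (annulus d).indicator 1 (dil r⁻¹ p) ∂mulMeasure = annulusWidth := by
  have hp' := koranyi_pos.2 hp
  have hm : Measurable fun r : ℝ => (annulus d).indicator (1 : Heis d → ℝ≥0∞) (dil r⁻¹ p) :=
    (measurable_one.indicator measurableSet_annulus).comp
      (measurable_dil.comp (measurable_id.inv.prodMk measurable_const))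
  rw [← lintegral_mulMeasure_mul hp' hm]
  rw [annulusWidth, ← lintegral_indicator_one measurableSet_Ico]
  refine lintegral_congr_ae ?_
  have : ∀ᵐ r ∂mulMeasure, 0 < r := by
    rw [mulMeasure]
    exact (withDensity_absolutelyContinuous _ _).ae_le (ae_restrict_mem measurableSet_Ioi)
  filter_upwards [this] with r hr
  have hk : koranyi (dil (koranyi p * r)⁻¹ p) = r⁻¹ := by
    rw [koranyi_dil (by positivity)]; field_simp
  by_cases h : r ∈ Ico (1 / 2 : ℝ) 1
  · rw [indicator_of_mem h, indicator_of_mem, Pi.one_apply, Pi.one_apply]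
    change 1 < koranyi (dil (koranyi p * r)⁻¹ p) ∧ koranyi (dil (koranyi p * r)⁻¹ p) ≤ 2
    simp only [hk]
    refine ⟨(one_lt_inv₀ hr).2 h.2, ?_⟩
    rw [show (2 : ℝ) = (1 / 2)⁻¹ by norm_num]
    exact inv_anti₀ (by norm_num) h.1
  · rw [indicator_of_notMem h, indicator_of_notMem]
    intro hc
    obtain ⟨h1, h2⟩ : 1 < koranyi (dil (koranyi p * r)⁻¹ p) ∧
        koranyi (dil (koranyi p * r)⁻¹ p) ≤ 2 := hc
    simp only [hk] at h1 h2
    refine h ⟨?_, (one_lt_inv₀ hr).1 h1⟩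
    have := inv_anti₀ (by positivity) h2
    simpa using this

theorem ae_ne_zero : ∀ᵐ p : Heis d, p ≠ 0 :=
  compl_mem_ae_iff.2 (measure_singleton 0)

/-- Disintegration by averaging. Invariance of `dr/r` absorbs the projection factor `1/ρ(p)`; after
exchanging the integrals, invariance of the dilation measure moves the dilation from `F` to the
indicator of the annulus, whose `r`-integral is the constant `annulusWidth`. -/
theorem lintegral_mul_sphere {F : Heis d → ℝ≥0∞} (hF : Measurable F) :
    ∫⁻ r, ∫⁻ q, F (dil r q) ∂(sphereMeasure d) ∂mulMeasure =
      annulusWidth * ∫⁻ p, F p ∂(dilMeasure d) := by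
  have hA : Measurable ((annulus d).indicator (1 : Heis d → ℝ≥0∞)) :=
    measurable_one.indicator measurableSet_annulus
  have h1 : ∀ r, ∫⁻ q, F (dil r q) ∂(sphereMeasure d) =
      ∫⁻ p, (annulus d).indicator 1 p * F (dil (r * (koranyi p)⁻¹) p) ∂(dilMeasure d) := fun r => by
    rw [lintegral_sphereMeasure (measurable_comp_dil hF r), ← lintegral_indicator measurableSet_annulus]
    refine lintegral_congr fun p => ?_
    by_cases hp : p ∈ annulus d
    · simp [hp, dil_dil]
    · simp [hp]
  have hm1 : Measurable fun x : ℝ × Heis d =>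
      (annulus d).indicator 1 x.2 * F (dil (x.1 * (koranyi x.2)⁻¹) x.2) :=
    (hA.comp measurable_snd).mul (hF.comp (measurable_dil.comp
      ((measurable_fst.mul (measurable_koranyi.comp measurable_snd).inv).prodMk measurable_snd)))
  have hm2 : Measurable fun x : Heis d × ℝ =>
      (annulus d).indicator 1 x.1 * F (dil x.2 x.1) :=
    (hA.comp measurable_fst).mul (hF.comp (measurable_dil.comp
      (measurable_snd.prodMk measurable_fst)))
  have hm3 : Measurable fun x : ℝ × Heis d =>
      (annulus d).indicator 1 (dil x.1⁻¹ x.2) * F x.2 :=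
    (hA.comp (measurable_dil.comp (measurable_fst.inv.prodMk measurable_snd))).mul
      (hF.comp measurable_snd)
  simp_rw [h1]
  rw [lintegral_lintegral_swap hm1.aemeasurable]
  have h2 : ∀ p : Heis d,
      ∫⁻ r, (annulus d).indicator 1 p * F (dil (r * (koranyi p)⁻¹) p) ∂mulMeasure =
        ∫⁻ r, (annulus d).indicator 1 p * F (dil r p) ∂mulMeasure := fun p => by
    by_cases hp : p ∈ annulus d
    · have hm6 : Measurable fun r : ℝ => F (dil r p) :=
        hF.comp (measurable_dil.comp (measurable_id.prodMk measurable_const))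
      have := lintegral_mulMeasure_mul (inv_pos.2 (one_pos.trans hp.1)) hm6
      simp only [indicator_of_mem hp, Pi.one_apply, one_mul]
      rw [← this]
      simp only [mul_comm (koranyi p)⁻¹]
    · simp [hp]
  simp_rw [h2]
  rw [lintegral_lintegral_swap hm2.aemeasurable]
  have hpos : ∀ᵐ r ∂mulMeasure, 0 < r := by
    rw [mulMeasure]
    exact (withDensity_absolutelyContinuous _ _).ae_le (ae_restrict_mem measurableSet_Ioi)
  have h3 : ∀ᵐ r ∂mulMeasure, ∫⁻ p, (annulus d).indicator 1 p * F (dil r p) ∂(dilMeasure d) =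
      ∫⁻ p, (annulus d).indicator 1 (dil r⁻¹ p) * F p ∂(dilMeasure d) := by
    filter_upwards [hpos] with r hr
    have hm4 : Measurable fun p : Heis d =>
        (annulus d).indicator (1 : Heis d → ℝ≥0∞) (dil r⁻¹ p) * F p :=
      (measurable_comp_dil hA _).mul hF
    rw [← lintegral_dilMeasure_dil hr hm4]
    refine lintegral_congr fun p => ?_
    rw [dil_dil, inv_mul_cancel₀ hr.ne', dil_one]
  rw [lintegral_congr_ae h3, lintegral_lintegral_swap hm3.aemeasurable,
    ← lintegral_const_mul _ hF]
  refine lintegral_congr_ae ?_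
  have h0 : ∀ᵐ p ∂(dilMeasure d), p ≠ 0 :=
    (withDensity_absolutelyContinuous _ _).ae_le (ae_ne_zero)
  filter_upwards [h0] with p hp
  have hm5 : Measurable fun r : ℝ => (annulus d).indicator (1 : Heis d → ℝ≥0∞) (dil r⁻¹ p) :=
    hA.comp (measurable_dil.comp (measurable_id.inv.prodMk measurable_const))
  rw [lintegral_mul_const _ hm5, mulMeasure_dil_inv_annulus hp]

/-- Polar coordinates: `dz dt` is the image of `c r^(2d+1) dr ⊗ σ` under `(r, q) ↦ dil r q`, with a
probability measure `σ` on the Koranyi sphere. -/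
structure PolarDecomposition (c : ℝ) (σ : Measure (Heis d)) : Prop where
  c_pos : 0 < c
  prob : IsProbabilityMeasure σ
  sphere : ∀ᵐ q ∂σ, koranyi q = 1
  preserving : MeasurePreserving (fun x : ℝ × Heis d => dil x.1 x.2)
    ((radialMeasure c d).prod σ) volume

instance (c : ℝ) : SFinite (radialMeasure c d) := by unfold radialMeasure; infer_instance

/-- Apply `lintegral_mul_sphere` to `ρ^(2d+2) F`: on the sphere of radius `r` the weight is
`r^(2d+2)`, which turns `dr/r` into `r^(2d+1) dr`. The constant `c` is the mass of the surface
measure divided by the logarithmic width. -/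
theorem exists_polarDecomposition (d : ℕ) :
    ∃ (c : ℝ) (σ : Measure (Heis d)), PolarDecomposition c σ := by
  set m := (sphereMeasure d) univ with hm
  have hvol : ∀ F : Heis d → ℝ≥0∞, Measurable F →
      ∫⁻ r, ENNReal.ofReal (r ^ (2 * d + 2)) * ∫⁻ q, F (dil r q) ∂(sphereMeasure d) ∂mulMeasure =
        annulusWidth * ∫⁻ p, F p := by
    intro F hF
    have hG : Measurable fun p : Heis d => ENNReal.ofReal (koranyi p ^ (2 * d + 2)) * F p :=
      ((measurable_koranyi.pow_const _).ennreal_ofReal).mul hF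
    have h1 := lintegral_mul_sphere hG
    rw [lintegral_dilMeasure hG] at h1
    have h2 : ∫⁻ p : Heis d, ENNReal.ofReal (koranyi p ^ (2 * d + 2))⁻¹ *
        (ENNReal.ofReal (koranyi p ^ (2 * d + 2)) * F p) = ∫⁻ p, F p := by
      refine lintegral_congr_ae ?_
      filter_upwards [ae_ne_zero] with p hp
      have hp' := koranyi_pos.2 hp
      rw [← mul_assoc, ← ENNReal.ofReal_mul (by positivity), inv_mul_cancel₀ (by positivity)]
      simp
    rw [h2] at h1
    rw [← h1]
    refine lintegral_congr_ae ?_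
    have hpos : ∀ᵐ r ∂mulMeasure, 0 < r := by
      rw [mulMeasure]
      exact (withDensity_absolutelyContinuous _ _).ae_le (ae_restrict_mem measurableSet_Ioi)
    filter_upwards [hpos] with r hr
    rw [← lintegral_const_mul _ (measurable_comp_dil hF r)]
    refine lintegral_congr_ae ?_
    filter_upwards [sphereMeasure_koranyi] with q hq
    rw [koranyi_dil hr.le, hq, mul_one]
  have hm0 : m ≠ 0 := by
    intro h
    have h1 := hvol 1 measurable_one
    rw [Measure.measure_univ_eq_zero.1 h] at h1
    have h2 : annulusWidth * volume (univ : Set (Heis d)) = 0 := by simpa using h1.symm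
    rcases mul_eq_zero.1 h2 with h3 | h3
    · exact annulusWidth_ne_zero h3
    · exact (isOpen_univ.measure_pos volume univ_nonempty).ne' h3
  have hmt : m ≠ ⊤ := measure_ne_top _ _
  set c : ℝ := (m / annulusWidth).toReal with hc
  have hct : m / annulusWidth ≠ ⊤ := ENNReal.div_ne_top hmt annulusWidth_ne_zero
  have hcpos : 0 < c := ENNReal.toReal_pos (ENNReal.div_ne_zero.2 ⟨hm0, annulusWidth_ne_top⟩) hct
  refine ⟨c, m⁻¹ • sphereMeasure d, hcpos, ⟨?_⟩, ?_, measurable_dil, ?_⟩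
  · rw [Measure.smul_apply, smul_eq_mul, ENNReal.inv_mul_cancel hm0 hmt]
  · exact Measure.ae_smul_measure sphereMeasure_koranyi _
  · have : IsFiniteMeasure (m⁻¹ • sphereMeasure d) := ⟨by
      rw [Measure.smul_apply, smul_eq_mul, ENNReal.inv_mul_cancel hm0 hmt]; simp⟩
    refine Measure.ext_of_lintegral _ fun F hF => ?_
    have hm1 : Measurable fun x : ℝ × Heis d => F (dil x.1 x.2) := hF.comp measurable_dil
    rw [lintegral_map hF measurable_dil, lintegral_prod _ hm1.aemeasurable]
    simp_rw [lintegral_smul_measure]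
    have hin : Measurable fun r : ℝ => ∫⁻ q, F (dil r q) ∂(sphereMeasure d) :=
      (hF.comp measurable_dil).lintegral_prod_right'
    have h1 := hvol F hF
    have hm2 : Measurable fun r : ℝ => ENNReal.ofReal (r ^ (2 * d + 2)) *
        ∫⁻ q, F (dil r q) ∂(sphereMeasure d) :=
      ((measurable_id.pow_const _).ennreal_ofReal).mul hin
    have hm3 : Measurable fun r : ℝ => ENNReal.ofReal r⁻¹ * (ENNReal.ofReal (r ^ (2 * d + 2)) *
        ∫⁻ q, F (dil r q) ∂(sphereMeasure d)) :=
      (measurable_id.inv.ennreal_ofReal).mul hm2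
    have hm4 : Measurable fun r : ℝ => m⁻¹ • ∫⁻ q, F (dil r q) ∂(sphereMeasure d) :=
      hin.const_smul m⁻¹
    rw [lintegral_mulMeasure hm2] at h1
    rw [radialMeasure, lintegral_withDensity_eq_lintegral_mul _ (by fun_prop) hm4]
    have h2 : ∀ r ∈ Ioi (0 : ℝ), ((fun r : ℝ => ENNReal.ofReal (c * r ^ (2 * d + 1))) *
        fun r => m⁻¹ • ∫⁻ q, F (dil r q) ∂(sphereMeasure d)) r =
        annulusWidth⁻¹ * (ENNReal.ofReal r⁻¹ * (ENNReal.ofReal (r ^ (2 * d + 2)) *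
          ∫⁻ q, F (dil r q) ∂(sphereMeasure d))) := fun r hr => by
      have hr : 0 < r := hr
      simp only [Pi.mul_apply, smul_eq_mul]
      rw [ENNReal.ofReal_mul hcpos.le, hc, ENNReal.ofReal_toReal hct,
        ← mul_assoc (ENNReal.ofReal r⁻¹), ← ENNReal.ofReal_mul (by positivity),
        show r⁻¹ * r ^ (2 * d + 2) = r ^ (2 * d + 1) by field_simp; ring, div_eq_mul_inv]
      rw [show ∀ a b e g h : ℝ≥0∞, a * b * e * (g * h) = a * g * (b * (e * h)) by
        intros; ring, ENNReal.mul_inv_cancel hm0 hmt, one_mul]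
    rw [setLIntegral_congr_fun measurableSet_Ioi h2, lintegral_const_mul _ hm3, h1, ← mul_assoc, ENNReal.inv_mul_cancel annulusWidth_ne_zero annulusWidth_ne_top,
      one_mul]

end Dilation

/-! ### Local integrability away from the origin. -/

section Annuli

variable {d : ℕ} {E : Type*} [NormedAddCommGroup E]

theorem isCompact_koranyi_Icc (a b : ℝ) : IsCompact {p : Heis d | koranyi p ∈ Icc a b} :=
  (isCompact_koranyi_le b).of_isClosed_subset (isClosed_Icc.preimage continuous_koranyi)
    fun _ hp => hp.2

theorem koranyi_Icc_subset {a b : ℝ} (ha : 0 < a) :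
    {p : Heis d | koranyi p ∈ Icc a b} ⊆ {0}ᶜ := fun _ hp =>
  koranyi_pos.1 (ha.trans_le hp.1)

theorem isOpen_compl_zero : IsOpen ({0}ᶜ : Set (Heis d)) := isOpen_compl_singleton

theorem _root_.MeasureTheory.LocallyIntegrableOn.annulus {g : Heis d → E}
    (hg : LocallyIntegrableOn g {0}ᶜ) {a : ℝ} (ha : 0 < a) (b : ℝ) :
    IntegrableOn g {p | koranyi p ∈ Icc a b} :=
  hg.integrableOn_compact_subset (koranyi_Icc_subset ha) (isCompact_koranyi_Icc a b)

theorem measurableSet_koranyi_Icc (a b : ℝ) : MeasurableSet {p : Heis d | koranyi p ∈ Icc a b} :=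
  measurable_koranyi measurableSet_Icc

theorem continuousOn_comp_koranyi {E : Type*} [TopologicalSpace E] {w : ℝ → E}
    (hw : ContinuousOn w (Ioi 0)) :
    ContinuousOn (fun p : Heis d => w (koranyi p)) {0}ᶜ :=
  hw.comp continuous_koranyi.continuousOn fun _ hp => koranyi_pos.2 hp

theorem locallyIntegrableOn_compl_zero_smul {𝕜 : Type*} [NormedField 𝕜] [NormedSpace 𝕜 E]
    [SecondCountableTopologyEither (Heis d) 𝕜] {g : Heis d → E} {a : Heis d → 𝕜}
    (hg : LocallyIntegrableOn g {0}ᶜ) (ha : ContinuousOn a {0}ᶜ) :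
    LocallyIntegrableOn (fun p => a p • g p) {0}ᶜ :=
  LocallyIntegrableOn.continuousOn_smul isOpen_compl_zero.isLocallyClosed hg ha

theorem IsRadialTest.integrable_comp_koranyi_smul [NormedSpace ℝ E] {F : ℝ → ℝ}
    (hF : IsRadialTest F) {g : Heis d → E} (hg : LocallyIntegrableOn g {0}ᶜ) :
    Integrable (fun p => F (koranyi p) • g p) := by
  obtain ⟨a, b, ha, -, h0⟩ := hF.exists_Icc
  have h1 := (locallyIntegrableOn_compl_zero_smul hg
    (a := fun p : Heis d => F (koranyi p))
    (hF.contDiff.continuous.comp continuous_koranyi).continuousOn).annulus ha b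
  rw [← integrableOn_univ]
  refine h1.of_ae_sdiff_eq_zero MeasurableSet.univ.nullMeasurableSet
    (Eventually.of_forall fun p hp => ?_)
  rw [h0 _ hp.2, zero_smul]

end Annuli

/-! ### Averages over Koranyi spheres. -/

section SphereAverage

variable {d : ℕ} {E : Type*} [NormedAddCommGroup E] [NormedSpace ℝ E]

/-- The average of `g` over the Koranyi sphere of radius `r`. -/
noncomputable def sphereAvg (σ : Measure (Heis d)) (g : Heis d → E) (r : ℝ) : E :=
  ∫ q, g (dil r q) ∂σ

variable {c : ℝ} {σ : Measure (Heis d)}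

namespace PolarDecomposition

theorem ae_koranyi_dil (hP : PolarDecomposition c σ) {r : ℝ} (hr : 0 < r) :
    ∀ᵐ q ∂σ, koranyi (dil r q) = r := by
  filter_upwards [hP.sphere] with q hq
  rw [koranyi_dil hr.le, hq, mul_one]

/-- Integrals and norms of `w ∘ ρ` on the group thereby equal those of `w` on the half-line. -/
theorem koranyi_preserving (hP : PolarDecomposition c σ) :
    MeasurePreserving (koranyi (d := d)) volume (radialMeasure c d) := by
  have := hP.prob
  refine ⟨measurable_koranyi, ?_⟩
  rw [← hP.preserving.map_eq, Measure.map_map measurable_koranyi measurable_dil]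
  have h1 : (koranyi ∘ fun x : ℝ × Heis d => dil x.1 x.2) =ᵐ[(radialMeasure c d).prod σ]
      Prod.fst := by
    filter_upwards [Measure.quasiMeasurePreserving_fst.ae (ae_radialMeasure_pos hP.c_pos),
      Measure.quasiMeasurePreserving_snd.ae hP.sphere] with x h1 h2
    rw [Function.comp_apply, koranyi_dil h1.le, h2, mul_one]
  rw [Measure.map_congr h1]
  exact Measure.map_fst_prod.trans (by simp)

theorem integrable_comp (hP : PolarDecomposition c σ) {E : Type*} [NormedAddCommGroup E]
    {g : Heis d → E} (hg : Integrable g) :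
    Integrable (fun x : ℝ × Heis d => g (dil x.1 x.2)) ((radialMeasure c d).prod σ) :=
  hP.preserving.integrable_comp_of_integrable hg

theorem integrable_sphereAvg (hP : PolarDecomposition c σ) {g : Heis d → E} (hg : Integrable g) :
    Integrable (sphereAvg σ g) (radialMeasure c d) := by
  have := hP.prob
  exact (hP.integrable_comp hg).integral_prod_left

theorem integral_eq (hP : PolarDecomposition c σ) {g : Heis d → E} (hg : Integrable g) :
    ∫ p, g p = ∫ r, sphereAvg σ g r ∂(radialMeasure c d) := by
  have := hP.prob
  unfold sphereAvg
  rw [← integral_prod _ (hP.integrable_comp hg), ← hP.preserving.map_eq,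
    integral_map measurable_dil.aemeasurable]
  rw [hP.preserving.map_eq]; exact hg.1

theorem lintegral_eq (hP : PolarDecomposition c σ) {g : Heis d → ℝ≥0∞} (hg : AEMeasurable g) :
    ∫⁻ p, g p = ∫⁻ r, ∫⁻ q, g (dil r q) ∂σ ∂(radialMeasure c d) := by
  have := hP.prob
  have h1 : AEMeasurable (fun x : ℝ × Heis d => g (dil x.1 x.2)) ((radialMeasure c d).prod σ) :=
    hg.comp_quasiMeasurePreserving hP.preserving.quasiMeasurePreserving
  rw [← lintegral_prod _ h1, ← hP.preserving.map_eq, lintegral_map' _ measurable_dil.aemeasurable]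
  rw [hP.preserving.map_eq]; exact hg

theorem sphereAvg_radial_mul (hP : PolarDecomposition c σ) (w : ℝ → ℂ) (g : Heis d → ℂ) {r : ℝ}
    (hr : 0 < r) : sphereAvg σ (fun p => w (koranyi p) * g p) r = w r * sphereAvg σ g r := by
  unfold sphereAvg
  rw [← integral_const_mul]
  refine integral_congr_ae ?_
  filter_upwards [hP.ae_koranyi_dil hr] with q hq
  rw [hq]

theorem sphereAvg_radial_smul (hP : PolarDecomposition c σ) (F : ℝ → ℝ) (g : Heis d → E) {r : ℝ}
    (hr : 0 < r) : sphereAvg σ (fun p => F (koranyi p) • g p) r = F r • sphereAvg σ g r := by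
  unfold sphereAvg
  rw [← integral_smul]
  refine integral_congr_ae ?_
  filter_upwards [hP.ae_koranyi_dil hr] with q hq
  rw [hq]

theorem ae_sphere (hP : PolarDecomposition c σ) {P : Heis d → Prop} (h : ∀ᵐ p, P p) :
    ∀ᵐ r : ℝ, 0 < r → ∀ᵐ q ∂σ, P (dil r q) := by
  have := hP.prob
  rw [← ae_radialMeasure hP.c_pos]
  exact Measure.ae_ae_of_ae_prod (hP.preserving.quasiMeasurePreserving.ae h)

theorem sphereAvg_congr (hP : PolarDecomposition c σ) {g g' : Heis d → E}
    (h : ∀ᵐ p, g p = g' p) : ∀ᵐ r : ℝ, 0 < r → sphereAvg σ g r = sphereAvg σ g' r := by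
  filter_upwards [hP.ae_sphere h] with r hr h0
  exact integral_congr_ae (hr h0)

theorem ae_integrable_sphere (hP : PolarDecomposition c σ) {E : Type*} [NormedAddCommGroup E]
    {g : Heis d → E} (hg : LocallyIntegrableOn g {0}ᶜ) :
    ∀ᵐ r : ℝ, 0 < r → Integrable (fun q => g (dil r q)) σ := by
  have := hP.prob
  -- Fubini needs integrability, which holds only on annuli; countably many of them exhaust the
  -- complement of the origin.
  have h1 : ∀ n : ℕ, ∀ᵐ r : ℝ, 0 < r → Integrable (fun q =>
      ({p : Heis d | koranyi p ∈ Icc (1 / ((n : ℝ) + 1)) n}.indicator g) (dil r q)) σ := by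
    intro n
    rw [← ae_radialMeasure hP.c_pos]
    exact (hP.integrable_comp ((hg.annulus (by positivity) n).integrable_indicator
      (measurableSet_koranyi_Icc _ _))).prod_right_ae
  filter_upwards [ae_all_iff.2 h1] with r hr h0
  obtain ⟨n, hn⟩ := exists_nat_ge (max r r⁻¹)
  refine (hr n h0).congr ?_
  filter_upwards [hP.ae_koranyi_dil h0] with q hq
  refine indicator_of_mem ?_ _
  change koranyi (dil r q) ∈ Icc (1 / ((n : ℝ) + 1)) (n : ℝ)
  rw [hq]
  refine ⟨?_, (le_max_left _ _).trans hn⟩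
  rw [one_div]
  exact inv_le_of_inv_le₀ h0 (((le_max_right _ _).trans hn).trans (by simp))

theorem sphereAvg_add (hP : PolarDecomposition c σ) {g g' : Heis d → E}
    (hg : LocallyIntegrableOn g {0}ᶜ) (hg' : LocallyIntegrableOn g' {0}ᶜ) :
    ∀ᵐ r : ℝ, 0 < r → sphereAvg σ (fun p => g p + g' p) r = sphereAvg σ g r + sphereAvg σ g' r := by
  filter_upwards [hP.ae_integrable_sphere hg, hP.ae_integrable_sphere hg'] with r h1 h2 h0
  exact integral_add (h1 h0) (h2 h0)

theorem locallyIntegrableOn_sphereAvg (hP : PolarDecomposition c σ) {g : Heis d → E}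
    (hg : LocallyIntegrableOn g {0}ᶜ) :
    LocallyIntegrableOn (sphereAvg σ g) (Ioi 0) := by
  have := hP.prob
  refine locallyIntegrableOn_Ioi_of_Icc fun a b ha hab => ?_
  have h1 := hP.integrable_sphereAvg ((hg.annulus ha b).integrable_indicator
      (measurableSet_koranyi_Icc _ _))
  rw [integrable_radialMeasure hP.c_pos] at h1
  have hsub : Icc a b ⊆ Ioi 0 := fun x hx => ha.trans_le hx.1
  have h2 := (h1.mono_set hsub).continuousOn_smul (f := fun r : ℝ => (r ^ (2 * d + 1))⁻¹)
    (ContinuousOn.inv₀ (by fun_prop) fun x hx => (pow_pos (hsub hx) _).ne') isCompact_Icc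
  refine h2.congr_fun (fun r hr => ?_) measurableSet_Icc
  have h0 : 0 < r := hsub hr
  simp only
  rw [smul_smul, inv_mul_cancel₀ (by positivity), one_smul]
  refine integral_congr_ae ?_
  filter_upwards [hP.ae_koranyi_dil h0] with q hq
  refine indicator_of_mem ?_ _
  change koranyi (dil r q) ∈ Icc a b
  rwa [hq]

theorem integral_radialTest_smul (hP : PolarDecomposition c σ) {F : ℝ → ℝ} (hF : IsRadialTest F)
    {g : Heis d → E} (hg : LocallyIntegrableOn g {0}ᶜ) :
    ∫ p, F (koranyi p) • g p = c • ∫ r, F r • (r ^ (2 * d + 1) • sphereAvg σ g r) := by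
  rw [hP.integral_eq (hF.integrable_comp_koranyi_smul hg), integral_radialMeasure hP.c_pos,
    ← setIntegral_Ioi_eq_integral (fun x hx => by rw [hF.eq_zero hx, zero_smul])]
  congr 1
  refine setIntegral_congr_fun measurableSet_Ioi fun r hr => ?_
  have h0 : 0 < r := hr
  rw [hP.sphereAvg_radial_smul _ _ h0, smul_comm]

/-- Radial weak derivatives: pairing with radial test functions controls the sphere averages. -/
theorem exists_hasACDeriv (hP : PolarDecomposition c σ) {a b : Heis d → ℂ}
    (ha : LocallyIntegrableOn a {0}ᶜ) (hb : LocallyIntegrableOn b {0}ᶜ)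
    (h : ∀ F : ℝ → ℝ, IsRadialTest F →
      ∫ p, deriv F (koranyi p) • a p = - ∫ p, F (koranyi p) • b p) :
    ∃ A : ℝ → ℂ, HasACDeriv A (fun r => r ^ (2 * d + 1) • sphereAvg σ b r) ∧
      ∀ᵐ r : ℝ, 0 < r → r ^ (2 * d + 1) • sphereAvg σ a r = A r := by
  have hpow : ∀ {g : Heis d → ℂ}, LocallyIntegrableOn g {0}ᶜ →
      LocallyIntegrableOn (fun r : ℝ => r ^ (2 * d + 1) • sphereAvg σ g r) (Ioi 0) := fun hg =>
    (hP.locallyIntegrableOn_sphereAvg hg).continuousOn_smul isOpen_Ioi.isLocallyClosed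
      (by fun_prop)
  refine exists_hasACDeriv_of_weak (hpow ha) (hpow hb) fun F hF => ?_
  have h1 := h F hF
  rw [hP.integral_radialTest_smul hF.deriv ha, hP.integral_radialTest_smul hF hb, ← smul_neg] at h1
  exact smul_right_injective ℂ hP.c_pos.ne' h1

/-- The variant of `exists_hasACDeriv` for the Euler field: `a` has the weak radial derivative
`ρ^{-(k+1)} b`. -/
theorem exists_hasACDeriv_euler (hP : PolarDecomposition c σ) {a b : Heis d → ℂ} (k : ℕ)
    (ha : LocallyIntegrableOn a {0}ᶜ) (hb : LocallyIntegrableOn b {0}ᶜ)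
    (h : ∀ F : ℝ → ℝ, IsRadialTest F →
      ∫ p, (deriv F (koranyi p) * koranyi p ^ (k + 1)
        + (2 * d + 2 + k) * F (koranyi p) * koranyi p ^ k) • a p = - ∫ p, F (koranyi p) • b p) :
    ∃ A : ℝ → ℂ, HasACDeriv A (fun r => (r ^ (k + 1))⁻¹ • sphereAvg σ b r) ∧
      ∀ᵐ r : ℝ, 0 < r → sphereAvg σ a r = A r := by
  have hk : ∀ j : ℕ, LocallyIntegrableOn (fun p => koranyi p ^ j • a p) {0}ᶜ := fun j =>
    locallyIntegrableOn_compl_zero_smul ha (continuous_koranyi.pow j).continuousOn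
  have hk' : LocallyIntegrableOn (fun p => (2 * d + 2 + k : ℝ) • (koranyi p ^ k • a p)) {0}ᶜ :=
    locallyIntegrableOn_compl_zero_smul (hk k) continuousOn_const
  -- Since `ρ^(k+1) a` has weak radial density controlled by `b`, its weighted average is absolutely
  -- continuous; that average is `r^(2d+2+k)` times the average of `a`, and the product rule with
  -- the inverse power removes the weight and the term `(2d+2+k) ρ^k a`.
  obtain ⟨A, hA, hA'⟩ := hP.exists_hasACDeriv (hk (k + 1)) (hb.add hk') fun F hF => by
    have h1 := h F hF
    have i1 := hF.deriv.integrable_comp_koranyi_smul (hk (k + 1))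
    have i2 := hF.integrable_comp_koranyi_smul hk'
    have i3 := hF.integrable_comp_koranyi_smul hb
    have e1 : ∀ p : Heis d, (deriv F (koranyi p) * koranyi p ^ (k + 1)
        + (2 * d + 2 + k) * F (koranyi p) * koranyi p ^ k) • a p =
        deriv F (koranyi p) • (koranyi p ^ (k + 1) • a p) +
          F (koranyi p) • ((2 * d + 2 + k : ℝ) • (koranyi p ^ k • a p)) := fun p => by
      rw [smul_smul, smul_smul, smul_smul, ← add_smul]; ring_nf
    simp_rw [e1] at h1
    rw [integral_add i1 i2] at h1
    simp only [Pi.add_apply, smul_add]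
    rw [integral_add i3 i2, neg_add, ← h1]
    ring
  have hpw : HasACDeriv (fun r : ℝ => (((r ^ (2 * d + 2 + k))⁻¹ : ℝ) : ℂ))
      (fun r : ℝ => ((-(2 * d + 2 + k) * (r ^ (2 * d + 2 + k + 1))⁻¹ : ℝ) : ℂ)) := by
    refine HasACDeriv.ofReal (.of_hasDerivAt (fun r hr => ?_) ?_)
    · have h1 := (hasDerivAt_pow (2 * d + 2 + k) r).inv (by positivity)
      refine h1.congr_deriv ?_
      rw [show 2 * d + 2 + k - 1 = 2 * d + 1 + k by omega]
      push_cast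
      field_simp
      ring
    · refine ContinuousOn.mul continuousOn_const (ContinuousOn.inv₀ (by fun_prop) fun x hx => ?_)
      exact (pow_pos hx _).ne'
  refine ⟨_, (hpw.mul hA).congr_deriv ?_, ?_⟩
  · filter_upwards [hA', hP.sphereAvg_add hb hk'] with r h1 h2 h0
    have e3 : sphereAvg σ (fun p => koranyi p ^ (k + 1) • a p) r = r ^ (k + 1) • sphereAvg σ a r :=
      hP.sphereAvg_radial_smul (fun r => r ^ (k + 1)) a h0
    have e4 : sphereAvg σ (fun p => (2 * d + 2 + k : ℝ) • (koranyi p ^ k • a p)) r =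
        ((2 * d + 2 + k : ℝ) * r ^ k) • sphereAvg σ a r := by
      rw [← hP.sphereAvg_radial_smul (fun r => (2 * d + 2 + k : ℝ) * r ^ k) a h0]
      simp only [smul_smul]
    have h2' : sphereAvg σ (b + fun p => (2 * d + 2 + k : ℝ) • (koranyi p ^ k • a p)) r = _ :=
      h2 h0
    rw [← h1 h0, h2', e3, e4]
    simp only [Complex.real_smul]
    push_cast
    have hr0 : (r : ℂ) ≠ 0 := by exact_mod_cast h0.ne'
    field_simp
    ring
  · filter_upwards [hA'] with r h1 h0
    have e3 : sphereAvg σ (fun p => koranyi p ^ (k + 1) • a p) r = r ^ (k + 1) • sphereAvg σ a r :=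
      hP.sphereAvg_radial_smul (fun r => r ^ (k + 1)) a h0
    rw [← h1 h0, e3]
    simp only [Complex.real_smul]
    push_cast
    have hr0 : (r : ℂ) ≠ 0 := by exact_mod_cast h0.ne'
    field_simp
    ring

end PolarDecomposition

end SphereAverage

/-! ### Cutoff limits for complex integrands. -/

section CutoffLimits

variable {c : ℝ} {d : ℕ} {f : ℝ → ℂ}

theorem integrable_cutoff_smul (hf : Integrable f (radialMeasure c d)) (n : ℕ) :
    Integrable (fun r => cutoff n r • f r) (radialMeasure c d) :=
  Integrable.bdd_smul (φ := cutoff n) hf 1 (cutoff_contDiffOn n).continuousOn.aesm_radial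
    (Eventually.of_forall fun r => by
      rw [Real.norm_eq_abs, abs_of_nonneg (cutoff_nonneg n r)]; exact cutoff_le_one n r)

theorem tendsto_integral_cutoff_smul (hf : Integrable f (radialMeasure c d)) :
    Tendsto (fun n => ∫ r, cutoff n r • f r ∂(radialMeasure c d)) atTop
      (𝓝 (∫ r, f r ∂(radialMeasure c d))) := by
  refine tendsto_integral_of_dominated_convergence (fun r => ‖f r‖)
    (fun n => (integrable_cutoff_smul hf n).1) hf.norm
    (fun n => Eventually.of_forall fun r => ?_) (Eventually.of_forall fun r => ?_)
  · rw [norm_smul, Real.norm_eq_abs, abs_of_nonneg (cutoff_nonneg n r)]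
    exact mul_le_of_le_one_left (norm_nonneg _) (cutoff_le_one n r)
  · simpa using tendsto_cutoff.smul_const (f r)

theorem integrable_cutoffDeriv_smul (hf : Integrable f (radialMeasure c d)) (n : ℕ) :
    Integrable (fun r => cutoffDeriv n r • f r) (radialMeasure c d) := by
  obtain ⟨C, hC0, hC⟩ := exists_cutoffDeriv_bound
  exact Integrable.bdd_smul (φ := cutoffDeriv n) hf _ (cutoffDeriv_continuousOn n).aesm_radial
    (Eventually.of_forall (hC n))

theorem tendsto_integral_cutoffDeriv_smul (hf : Integrable f (radialMeasure c d)) :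
    Tendsto (fun n => ∫ r, cutoffDeriv n r • f r ∂(radialMeasure c d)) atTop (𝓝 0) := by
  obtain ⟨C, hC0, hC⟩ := exists_cutoffDeriv_bound
  refine squeeze_zero_norm (fun n => ?_)
    (by simpa using (tendsto_const_div_nat C).mul_const (∫ r, ‖f r‖ ∂(radialMeasure c d)))
  rw [← integral_const_mul]
  refine (norm_integral_le_integral_norm _).trans (integral_mono_of_nonneg
    (Eventually.of_forall fun r => norm_nonneg _) (hf.norm.const_mul _)
    (Eventually.of_forall fun r => ?_))
  simp only [norm_smul]
  exact mul_le_mul_of_nonneg_right (hC n r) (norm_nonneg _)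

end CutoffLimits

theorem _root_.MeasureTheory.MemLp.integrable_smul_two {α : Type*} [MeasurableSpace α]
    {ν : Measure α} {g : α → ℝ} {f : α → ℂ} (hg : MemLp g 2 ν) (hf : MemLp f 2 ν) :
    Integrable (fun x => g x • f x) ν :=
  memLp_one_iff_integrable.1 (MemLp.smul hf hg)

/-! ### From a profile to a function in `H¹`. -/

section RadialSobolev

variable {d : ℕ} {c : ℝ} {σ : Measure (Heis d)}

theorem continuousOn_gradKoranyi (i : Fin d ⊕ Fin d) : ContinuousOn (gradKoranyi i) {0}ᶜ :=
  (contDiff_gradPoly i).continuous.continuousOn.div (continuous_koranyi.pow 3).continuousOn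
    fun _ hp => (pow_pos (koranyi_pos.2 hp) 3).ne'

theorem IsTestFunction.integrable_mul_gradKoranyi {φ : Heis d → ℝ} (hφ : IsTestFunction φ)
    (i : Fin d ⊕ Fin d) : Integrable (fun p => φ p * gradKoranyi i p) :=
  hφ.integrable.mul_bdd (c := 1) (measurable_gradKoranyi i).aestronglyMeasurable
    (Eventually.of_forall (abs_gradKoranyi_le i))

theorem IsTestFunction.integrable_fderiv_frame {φ : Heis d → ℝ} (hφ : IsTestFunction φ)
    (i : Fin d ⊕ Fin d) : Integrable (fun p => fderiv ℝ φ p (horizontalFrame i p)) :=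
  (IsTestFunction.continuous_fderiv_apply hφ.1
    (continuous_horizontalFrame i)).integrable_of_hasCompactSupport
    (hφ.hasCompactSupport_fderiv_apply _)

/-- The fields are divergence free; apply this to the product of `φ` with `F ∘ ρ`. It says that
`r^(2d+1)` times the average of `φ Z_i ρ` has weak derivative `r^(2d+1)` times the average of `Z_i
φ`. -/
theorem IsTestFunction.integral_radial_mul {φ : Heis d → ℝ} (hφ : IsTestFunction φ)
    (i : Fin d ⊕ Fin d) {F : ℝ → ℝ} (hF : IsRadialTest F) :
    ∫ p, deriv F (koranyi p) * (φ p * gradKoranyi i p) =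
      - ∫ p, F (koranyi p) * fderiv ℝ φ p (horizontalFrame i p) := by
  have h1 := (IsTestFunction.mul hφ.1 (hF.isTestFunction (d := d))).integral_fderiv_frame i
  simp_rw [fderiv_mul_apply hφ.1 (hF.isTestFunction (d := d)).1, hF.fderiv_frame] at h1
  have i1 := hF.deriv.integrable_comp_koranyi_smul
    ((hφ.integrable_mul_gradKoranyi i).locallyIntegrable.locallyIntegrableOn {0}ᶜ)
  have i2 := hF.integrable_comp_koranyi_smul
    ((hφ.integrable_fderiv_frame i).locallyIntegrable.locallyIntegrableOn {0}ᶜ)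
  simp only [smul_eq_mul] at i1 i2
  rw [← add_eq_zero_iff_eq_neg, ← integral_add i1 i2, ← h1]
  refine integral_congr_ae (Eventually.of_forall fun p => ?_)
  simp only
  ring

/-- Integration by parts against a radial function. -/
theorem PolarDecomposition.integral_fderiv_frame_smul (hP : PolarDecomposition c σ)
    {φ : Heis d → ℝ} (hφ : IsTestFunction φ) (i : Fin d ⊕ Fin d) {w w₁ : ℝ → ℂ}
    (hw : HasACDeriv w w₁)
    (h1 : Integrable fun p => fderiv ℝ φ p (horizontalFrame i p) • w (koranyi p))
    (h2 : Integrable fun p => (φ p * gradKoranyi i p) • w₁ (koranyi p))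
    (h3 : Integrable fun p => (φ p * gradKoranyi i p) • (w (koranyi p) / (koranyi p : ℂ))) :
    ∫ p, fderiv ℝ φ p (horizontalFrame i p) • w (koranyi p) =
      - ∫ p, (φ p * gradKoranyi i p) • w₁ (koranyi p) := by
  set a : Heis d → ℂ := fun p => ((φ p * gradKoranyi i p : ℝ) : ℂ) with ha
  set b : Heis d → ℂ := fun p => ((fderiv ℝ φ p (horizontalFrame i p) : ℝ) : ℂ) with hb
  have hai : LocallyIntegrableOn a {0}ᶜ :=
    (hφ.integrable_mul_gradKoranyi i).ofReal.locallyIntegrable.locallyIntegrableOn _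
  have hbi : LocallyIntegrableOn b {0}ᶜ :=
    (hφ.integrable_fderiv_frame i).ofReal.locallyIntegrable.locallyIntegrableOn _
  obtain ⟨A, hA, hA'⟩ := hP.exists_hasACDeriv hai hbi fun F hF => by
    have := congrArg (fun x : ℝ => (x : ℂ)) (hφ.integral_radial_mul i hF)
    simp only [Complex.ofReal_neg, ← integral_complex_ofReal] at this
    simpa [ha, hb] using this
  set G : ℝ → ℂ := fun r => w r * sphereAvg σ b r + w₁ r * sphereAvg σ a r with hG
  set H : ℝ → ℂ := fun r => w r / (r : ℂ) * sphereAvg σ a r with hH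
  have key : ∀ (v : ℝ → ℂ) (g : Heis d → ℝ), Integrable (fun p => g p • v (koranyi p)) →
      Integrable (fun r => v r * sphereAvg σ (fun p => (g p : ℂ)) r) (radialMeasure c d) ∧
      ∫ p, g p • v (koranyi p) =
        ∫ r, v r * sphereAvg σ (fun p => (g p : ℂ)) r ∂(radialMeasure c d) := by
    intro v g hg
    have e : ∀ᵐ r ∂(radialMeasure c d), sphereAvg σ (fun p => g p • v (koranyi p)) r =
        v r * sphereAvg σ (fun p => (g p : ℂ)) r := by
      filter_upwards [ae_radialMeasure_pos hP.c_pos] with r hr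
      rw [← hP.sphereAvg_radial_mul v _ hr]
      simp [mul_comm]
    exact ⟨(hP.integrable_sphereAvg hg).congr e, (hP.integral_eq hg).trans (integral_congr_ae e)⟩
  have k1 := key w _ h1
  have k2 := key w₁ _ h2
  have k3 := key (fun r => w r / (r : ℂ)) _ h3
  have hGi : Integrable G (radialMeasure c d) := k1.1.add k2.1
  -- Total divergence of `η w A`. The hypothesis `h3` is what makes `H` integrable, so that the
  -- error with `r η'` vanishes in the limit.
  have hzero : ∀ n, ∫ r, cutoff n r • G r ∂(radialMeasure c d) +
      ∫ r, cutoffDeriv n r • H r ∂(radialMeasure c d) = 0 := by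
    intro n
    have hprod := (cutoff_hasACDeriv n).ofReal.mul (hA.mul hw)
    have := (hprod.integral_radialMeasure_complex hP.c_pos (d := d)
      (S := fun r => cutoff n r • G r + cutoffDeriv n r • H r) (Real.exp_pos _)
      (exp_cutoff_lt n) (fun x hx hx' => by simp [cutoff_eq_zero n hx hx']) ?_).2
    · rw [← this, integral_add (integrable_cutoff_smul hGi n)
        (integrable_cutoffDeriv_smul k3.1 n)]
    · filter_upwards [hA'] with r hr h0
      rw [← hr h0, hG, hH]
      simp only [Complex.real_smul]
      push_cast
      have hr0 : (r : ℂ) ≠ 0 := by exact_mod_cast h0.ne'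
      generalize sphereAvg σ a r = x
      generalize sphereAvg σ b r = y
      generalize (r : ℂ) ^ (2 * d + 1) = z
      field_simp
      ring
  have hlim := (tendsto_integral_cutoff_smul hGi).add (tendsto_integral_cutoffDeriv_smul k3.1)
  have h0 : ∫ r, G r ∂(radialMeasure c d) = 0 := by
    rw [add_zero] at hlim
    refine tendsto_nhds_unique hlim ?_
    exact tendsto_const_nhds.congr fun n => (hzero n).symm
  rw [k1.2, k2.2, ← add_eq_zero_iff_eq_neg, ← integral_add k1.1 k2.1]
  exact h0

/-- The horizontal gradient of `w ∘ ρ`, where `w' = w₁`. -/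
noncomputable def radialGrad (w₁ : ℝ → ℂ) (p : Heis d) : EuclideanSpace ℂ (Fin d ⊕ Fin d) :=
  WithLp.toLp 2 fun i => w₁ (koranyi p) * (gradKoranyi i p : ℂ)

theorem radialGrad_apply (w₁ : ℝ → ℂ) (p : Heis d) (i : Fin d ⊕ Fin d) :
    radialGrad w₁ p i = w₁ (koranyi p) * (gradKoranyi i p : ℂ) := rfl

theorem norm_radialGrad_sq (w₁ : ℝ → ℂ) (p : Heis d) :
    ‖radialGrad w₁ p‖ ^ 2 = ‖w₁ (koranyi p)‖ ^ 2 * (zSq p / koranyi p ^ 2) := by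
  rw [EuclideanSpace.norm_sq_eq, ← sum_gradKoranyi_sq, Finset.mul_sum]
  refine Finset.sum_congr rfl fun i _ => ?_
  rw [radialGrad_apply, norm_mul, mul_pow, Complex.norm_real, Real.norm_eq_abs, sq_abs]

/-- The mean of `|∇ρ|²` over the Koranyi sphere. -/
noncomputable def sphereMoment (σ : Measure (Heis d)) : ℝ := ∫ q, zSq q ∂σ

theorem PolarDecomposition.sphereAvg_density (hP : PolarDecomposition c σ) {r : ℝ} (hr : 0 < r) :
    sphereAvg σ (fun p => zSq p / koranyi p ^ 2) r = sphereMoment σ := by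
  refine integral_congr_ae ?_
  filter_upwards [hP.sphere] with q hq
  rw [zSq_dil, koranyi_dil hr.le, hq]
  field_simp

theorem measurable_zSq : Measurable (zSq (d := d)) := contDiff_zSq.continuous.measurable

theorem PolarDecomposition.integrable_zSq (hP : PolarDecomposition c σ) : Integrable zSq σ := by
  have := hP.prob
  refine Integrable.mono' (integrable_const 1) measurable_zSq.aestronglyMeasurable ?_
  filter_upwards [hP.sphere] with q hq
  rw [Real.norm_eq_abs, abs_of_nonneg (zSq_nonneg q)]
  simpa [hq] using zSq_le q

theorem ae_zSq_pos (hd : 1 ≤ d) : ∀ᵐ p : Heis d, 0 < zSq p := by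
  have h1 : ∀ᵐ z : Fin d → ℂ, z ≠ 0 := by
    have : Nonempty (Fin d) := ⟨⟨0, hd⟩⟩
    have : Nontrivial (Fin d → ℂ) := inferInstance
    exact compl_mem_ae_iff.2 (measure_singleton 0)
  have h2 : ∀ᵐ p : Heis d, p.1 ≠ 0 := Measure.quasiMeasurePreserving_fst.ae h1
  filter_upwards [h2] with p hp
  refine lt_of_le_of_ne (zSq_nonneg p) fun h => hp ?_
  funext j
  have := (Finset.sum_eq_zero_iff_of_nonneg (fun j _ => by positivity)).1 h.symm j
    (Finset.mem_univ j)
  simpa using this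

theorem PolarDecomposition.sphereMoment_pos (hP : PolarDecomposition c σ) (hd : 1 ≤ d) :
    0 < sphereMoment σ := by
  have := hP.prob
  rw [sphereMoment, integral_pos_iff_support_of_nonneg zSq_nonneg hP.integrable_zSq]
  have h1 := hP.ae_sphere (ae_zSq_pos hd)
  have h2 : ∃ r : ℝ, 0 < r ∧ ∀ᵐ q ∂σ, 0 < zSq (dil r q) := by
    have h3 : ∃ᵐ r : ℝ, 0 < r := by
      rw [frequently_ae_iff]
      change volume (Ioi (0 : ℝ)) ≠ 0
      simp
    obtain ⟨r, h0, hr⟩ := (h3.and_eventually h1).exists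
    exact ⟨r, h0, hr h0⟩
  obtain ⟨r, h0, hr⟩ := h2
  have h4 : ∀ᵐ q ∂σ, q ∈ Function.support (zSq (d := d)) := by
    filter_upwards [hr] with q hq
    rw [zSq_dil] at hq
    exact (pos_of_mul_pos_right hq (by positivity)).ne'
  rw [measure_eq_measure_of_null_sdiff (subset_univ _) (by rw [← compl_eq_univ_sdiff]; exact h4)]
  simp

/-- Integrals of `F(ρ) |∇ρ|²`. -/
theorem PolarDecomposition.lintegral_mul_density (hP : PolarDecomposition c σ) {F : ℝ → ℝ≥0∞}
    (hF : AEMeasurable F (radialMeasure c d)) :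
    ∫⁻ p : Heis d, F (koranyi p) * ENNReal.ofReal (zSq p / koranyi p ^ 2) =
      ENNReal.ofReal (sphereMoment σ) * ∫⁻ r, F r ∂(radialMeasure c d) := by
  have := hP.prob
  have hm : Measurable fun p : Heis d => ENNReal.ofReal (zSq p / koranyi p ^ 2) :=
    (measurable_zSq.div (measurable_koranyi.pow_const 2)).ennreal_ofReal
  have hF' : AEMeasurable (fun p : Heis d => F (koranyi p)) :=
    hF.comp_quasiMeasurePreserving hP.koranyi_preserving.quasiMeasurePreserving
  rw [← lintegral_const_mul'' _ hF]
  refine (hP.lintegral_eq (hF'.mul hm.aemeasurable)).trans ?_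
  refine lintegral_congr_ae ?_
  filter_upwards [ae_radialMeasure_pos hP.c_pos] with r hr
  have h1 : ∫⁻ q, F (koranyi (dil r q)) *
      ENNReal.ofReal (zSq (dil r q) / koranyi (dil r q) ^ 2) ∂σ =
      ∫⁻ q, F r * ENNReal.ofReal (zSq q) ∂σ := by
    refine lintegral_congr_ae ?_
    filter_upwards [hP.sphere] with q hq
    rw [koranyi_dil hr.le, hq, zSq_dil, mul_one]
    congr 2
    field_simp
  simp only [Pi.mul_apply]
  rw [h1, lintegral_const_mul _ measurable_zSq.ennreal_ofReal, sphereMoment,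
    ofReal_integral_eq_lintegral_ofReal hP.integrable_zSq (Eventually.of_forall zSq_nonneg),
    mul_comm]

theorem PolarDecomposition.lintegral_radialGrad (hP : PolarDecomposition c σ) {w₁ : ℝ → ℂ}
    (hw₁ : AEStronglyMeasurable w₁ (radialMeasure c d)) :
    ∫⁻ p : Heis d, ‖radialGrad w₁ p‖ₑ ^ 2 =
      ENNReal.ofReal (sphereMoment σ) * ∫⁻ r, ‖w₁ r‖ₑ ^ 2 ∂(radialMeasure c d) := by
  rw [← hP.lintegral_mul_density (hw₁.enorm.pow_const 2)]
  refine lintegral_congr fun p => ?_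
  rw [← ofReal_norm, ← ofReal_norm, ← ENNReal.ofReal_pow (norm_nonneg _),
    ← ENNReal.ofReal_pow (norm_nonneg _), norm_radialGrad_sq, ENNReal.ofReal_mul (by positivity)]

theorem PolarDecomposition.aestronglyMeasurable_comp (hP : PolarDecomposition c σ) {w : ℝ → ℂ}
    (hw : AEStronglyMeasurable w (radialMeasure c d)) :
    AEStronglyMeasurable (fun p : Heis d => w (koranyi p)) :=
  hw.comp_quasiMeasurePreserving hP.koranyi_preserving.quasiMeasurePreserving

theorem PolarDecomposition.aestronglyMeasurable_radialGrad (hP : PolarDecomposition c σ)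
    {w₁ : ℝ → ℂ} (hw₁ : AEStronglyMeasurable w₁ (radialMeasure c d)) :
    AEStronglyMeasurable (radialGrad (d := d) w₁) := by
  have h : AEStronglyMeasurable (fun p : Heis d =>
      (fun i => w₁ (koranyi p) * (gradKoranyi i p : ℂ))) := by
    refine (aemeasurable_pi_lambda _ fun i => ?_).aestronglyMeasurable
    exact (hP.aestronglyMeasurable_comp hw₁).aemeasurable.mul
      (measurable_gradKoranyi i).complex_ofReal.aemeasurable
  exact (PiLp.continuous_toLp 2 (fun _ : Fin d ⊕ Fin d => ℂ)).comp_aestronglyMeasurable h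

theorem PolarDecomposition.memLp_comp (hP : PolarDecomposition c σ) {w : ℝ → ℂ}
    (hw : MemLp w 2 (radialMeasure c d)) : MemLp (fun p : Heis d => w (koranyi p)) 2 :=
  hw.comp_measurePreserving hP.koranyi_preserving

theorem memLp_two_iff_lintegral {α E : Type*} [MeasurableSpace α] [NormedAddCommGroup E]
    {ν : Measure α} {g : α → E} (hg : AEStronglyMeasurable g ν) :
    MemLp g 2 ν ↔ ∫⁻ x, ‖g x‖ₑ ^ 2 ∂ν < ⊤ := by
  have h := eLpNorm_lt_top_iff_lintegral_rpow_enorm_lt_top (f := g) (μ := ν) (p := 2)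
    (by norm_num) (by norm_num)
  simp only [ENNReal.toReal_ofNat, ENNReal.rpow_ofNat] at h
  exact ⟨fun hm => h.1 hm.2, fun hm => ⟨hg, h.2 hm⟩⟩

theorem PolarDecomposition.memLp_radialGrad (hP : PolarDecomposition c σ) {w₁ : ℝ → ℂ}
    (hw₁ : MemLp w₁ 2 (radialMeasure c d)) : MemLp (radialGrad (d := d) w₁) 2 := by
  rw [memLp_two_iff_lintegral (hP.aestronglyMeasurable_radialGrad hw₁.1),
    hP.lintegral_radialGrad hw₁.1]
  exact ENNReal.mul_lt_top ENNReal.ofReal_lt_top ((memLp_two_iff_lintegral hw₁.1).1 hw₁)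

theorem IsTestFunction.memLp_two {φ : Heis d → ℝ} (hφ : IsTestFunction φ) : MemLp φ 2 :=
  hφ.1.continuous.memLp_of_hasCompactSupport hφ.2

/-- A radial function with square integrable profile and profile derivative belongs to `H^1`. -/
theorem PolarDecomposition.memH1 (hP : PolarDecomposition c σ) (hd : 1 ≤ d) {w w₁ : ℝ → ℂ}
    (h : HasACDeriv w w₁) (hw : MemLp w 2 (radialMeasure c d))
    (hw₁ : MemLp w₁ 2 (radialMeasure c d)) :
    MemH1 (fun p : Heis d => w (koranyi p)) (radialGrad w₁) := by
  refine ⟨hP.memLp_comp hw, hP.memLp_radialGrad hw₁, fun i φ hφ => ?_⟩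
  have hb : MemLp (fun p => φ p * gradKoranyi i p) 2 :=
    hφ.memLp_two.of_le (hφ.integrable_mul_gradKoranyi i).1 (Eventually.of_forall fun p => by
      rw [norm_mul]
      exact mul_le_of_le_one_right (norm_nonneg _) (abs_gradKoranyi_le i p))
  have hz : MemLp (fun p => fderiv ℝ φ p (horizontalFrame i p)) 2 :=
    (IsTestFunction.continuous_fderiv_apply hφ.1
      (continuous_horizontalFrame i)).memLp_of_hasCompactSupport
      (hφ.hasCompactSupport_fderiv_apply _)
  -- Hardy's inequality makes `w/ρ` square integrable, so `φ` need not vanish near the origin.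
  rw [hP.integral_fderiv_frame_smul hφ i h (hz.integrable_smul_two (hP.memLp_comp hw))
    (hb.integrable_smul_two (hP.memLp_comp hw₁))
    (hb.integrable_smul_two (hP.memLp_comp (memLp_div_id hP.c_pos hd h hw hw₁)))]
  congr 1
  refine integral_congr_ae (Eventually.of_forall fun p => ?_)
  simp only [radialGrad_apply, Complex.real_smul]
  push_cast
  ring

end RadialSobolev

/-! ### From a radial function in `H¹` to its profile. -/

section Profile

variable {d : ℕ} {c : ℝ} {σ : Measure (Heis d)}

theorem locallyIntegrableOn_sum {ι E : Type*} [NormedAddCommGroup E] {s : Set (Heis d)}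
    (I : Finset ι) {f : ι → Heis d → E} (hf : ∀ i, LocallyIntegrableOn (f i) s) :
    LocallyIntegrableOn (fun p => ∑ i ∈ I, f i p) s := by
  classical
  induction I using Finset.induction_on with
  | empty => simpa using locallyIntegrableOn_zero
  | insert i I hi ih =>
    simp only [Finset.sum_insert hi]
    exact (hf i).add ih

theorem integrable_smul_of_tsupport {E : Type*} [NormedAddCommGroup E] [NormedSpace ℝ E]
    {φ : Heis d → ℝ} (hφ : Continuous φ) (hc : HasCompactSupport φ) (hs : tsupport φ ⊆ {0}ᶜ)
    {g : Heis d → E} (hg : LocallyIntegrableOn g {0}ᶜ) : Integrable fun p => φ p • g p := by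
  have h1 := (hg.integrableOn_compact_subset hs hc.isCompact).continuousOn_smul
    hφ.continuousOn hc.isCompact
  rw [← integrableOn_univ]
  refine h1.of_ae_sdiff_eq_zero MeasurableSet.univ.nullMeasurableSet
    (Eventually.of_forall fun p hp => ?_)
  rw [image_eq_zero_of_notMem_tsupport hp.2, zero_smul]

theorem PolarDecomposition.locallyIntegrableOn_comp (hP : PolarDecomposition c σ) {w : ℝ → ℂ}
    (hw : LocallyIntegrableOn w (Ioi 0)) :
    LocallyIntegrableOn (fun p : Heis d => w (koranyi p)) {0}ᶜ := by
  rw [locallyIntegrableOn_iff isOpen_compl_zero.isLocallyClosed]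
  intro K hK hKc
  rcases K.eq_empty_or_nonempty with rfl | hne
  · simp
  obtain ⟨p, hpK, hp⟩ := hKc.exists_isMinOn hne continuous_koranyi.continuousOn
  obtain ⟨q, hqK, hq⟩ := hKc.exists_isMaxOn hne continuous_koranyi.continuousOn
  have hp0 : 0 < koranyi p := koranyi_pos.2 (hK hpK)
  have h1 : Integrable ((Icc (koranyi p) (koranyi q)).indicator w) (radialMeasure c d) := by
    refine integrable_radialMeasure_of_Icc (a := koranyi p) (b := koranyi q) hP.c_pos hp0 ?_
      fun x _ hx => indicator_of_notMem hx _
    refine locallyIntegrableOn_Ioi_of_Icc fun a b ha _ => ?_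
    exact (hw.Icc ha).indicator measurableSet_Icc
  have h2 := hP.koranyi_preserving.integrable_comp_of_integrable h1
  have h3 : IntegrableOn (fun p : Heis d => w (koranyi p))
      {x | koranyi x ∈ Icc (koranyi p) (koranyi q)} := by
    rw [← integrable_indicator_iff (measurableSet_koranyi_Icc _ _)]
    exact h2
  exact h3.mono_set fun x hx => ⟨hp hx, hq hx⟩

theorem continuousOn_density : ContinuousOn (fun p : Heis d => zSq p / koranyi p ^ 2) {0}ᶜ :=
  contDiff_zSq.continuous.continuousOn.div (continuous_koranyi.pow 2).continuousOn
    fun _ hp => (pow_pos (koranyi_pos.2 hp) 2).ne'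

theorem sum_gradPoly_mul_gradKoranyi (p : Heis d) :
    ∑ i, gradPoly i p * gradKoranyi i p = zSq p * koranyi p := by
  have : ∀ i, gradPoly i p * gradKoranyi i p = gradPoly i p ^ 2 / koranyi p ^ 3 := fun i => by
    rw [gradKoranyi]; ring
  simp_rw [this]
  rw [← Finset.sum_div, sum_gradPoly_sq, ← koranyi_pow_four]
  rcases eq_or_ne (koranyi p) 0 with h | h
  · simp [h]
  · field_simp

theorem MemH1.apply_memLp {u : Heis d → ℂ}
    {g : Heis d → EuclideanSpace ℂ (Fin d ⊕ Fin d)} (hu : MemH1 u g) (i : Fin d ⊕ Fin d) :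
    MemLp (fun p => g p i) 2 :=
  hu.memLp_grad.of_le
    ((EuclideanSpace.proj (𝕜 := ℂ) i).continuous.comp_aestronglyMeasurable hu.memLp_grad.1)
    (Eventually.of_forall fun p => PiLp.norm_apply_le (g p) i)

/-- Test the derivative along each `Z_i` with `ρ³ Z_i ρ · F(ρ)` and sum: only the radial derivative
of `u` survives, and `2d+4` comes from the divergence of `ρ³ ∇_ℍ ρ`. -/
theorem MemH1.integral_radial {u : Heis d → ℂ}
    {g : Heis d → EuclideanSpace ℂ (Fin d ⊕ Fin d)} (hu : MemH1 u g) {F : ℝ → ℝ}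
    (hF : IsRadialTest F) :
    ∫ p, (deriv F (koranyi p) * koranyi p ^ 3 + (2 * d + 4) * F (koranyi p) * koranyi p ^ 2) •
        ((zSq p / koranyi p ^ 2) • u p) =
      - ∫ p, F (koranyi p) • ∑ i, gradPoly i p • g p i := by
  have ht := hF.isTestFunction (d := d)
  have htest : ∀ i : Fin d ⊕ Fin d, IsTestFunction fun p => gradPoly i p * F (koranyi p) := fun i =>
    IsTestFunction.mul (contDiff_gradPoly i) ht
  have h1 : ∀ i, _ := fun i => hu.weakDeriv i _ (htest i)
  have hg := hu.apply_memLp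
  have h2 := Finset.sum_congr (s₁ := Finset.univ) rfl fun i _ => h1 i
  rw [Finset.sum_neg_distrib, ← integral_finsetSum, ← integral_finsetSum] at h2
  · convert h2 using 1
    · refine integral_congr_ae ?_
      filter_upwards [ae_ne_zero] with p hp
      have hp' := koranyi_pos.2 hp
      rw [← Finset.sum_smul, smul_smul]
      congr 1
      simp_rw [fderiv_mul_apply (contDiff_gradPoly _) ht.1, hF.fderiv_frame]
      rw [Finset.sum_add_distrib, ← Finset.sum_mul, sum_fderiv_gradPoly_frame]
      have : ∑ i, gradPoly i p * (deriv F (koranyi p) * gradKoranyi i p) =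
          deriv F (koranyi p) * (zSq p * koranyi p) := by
        rw [← sum_gradPoly_mul_gradKoranyi, Finset.mul_sum]
        exact Finset.sum_congr rfl fun i _ => by ring
      rw [this]
      field_simp
    · congr 1
      refine integral_congr_ae (Eventually.of_forall fun p => ?_)
      simp only [Finset.smul_sum, smul_smul, mul_comm]
  · intro i _
    exact (htest i).memLp_two.integrable_smul_two (hg i)
  · intro i _
    refine MemLp.integrable_smul_two ?_ hu.memLp
    exact (IsTestFunction.continuous_fderiv_apply (htest i).1
      (continuous_horizontalFrame i)).memLp_of_hasCompactSupport
      ((htest i).hasCompactSupport_fderiv_apply _)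

theorem PolarDecomposition.sphereAvg_density_mul (hP : PolarDecomposition c σ) (w : ℝ → ℂ) {r : ℝ}
    (hr : 0 < r) :
    sphereAvg σ (fun p => (zSq p / koranyi p ^ 2) • w (koranyi p)) r = sphereMoment σ * w r := by
  have : (fun p : Heis d => (zSq p / koranyi p ^ 2) • w (koranyi p)) =
      fun p => w (koranyi p) * ((zSq p / koranyi p ^ 2 : ℝ) : ℂ) := by
    funext p; rw [Complex.real_smul, mul_comm]
  rw [this, hP.sphereAvg_radial_mul w _ hr, ← hP.sphereAvg_density hr, sphereAvg, sphereAvg,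
    integral_complex_ofReal, mul_comm]

theorem PolarDecomposition.ae_comp (hP : PolarDecomposition c σ) {P : ℝ → Prop}
    (h : ∀ᵐ r : ℝ, 0 < r → P r) : ∀ᵐ p : Heis d, P (koranyi p) :=
  hP.koranyi_preserving.quasiMeasurePreserving.ae ((ae_radialMeasure hP.c_pos).2 h)

/-- Square integrability of `w₁` is not yet available, and `integral_fderiv_frame_smul` needs
integrable products. Test functions supported off the origin require only local integrability there,
and they determine `g` almost everywhere. -/
theorem PolarDecomposition.eq_radialGrad (hP : PolarDecomposition c σ)
    {u : Heis d → ℂ} {g : Heis d → EuclideanSpace ℂ (Fin d ⊕ Fin d)} (hu : MemH1 u g)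
    {w w₁ : ℝ → ℂ} (hw : HasACDeriv w w₁) (hwL : MemLp w 2 (radialMeasure c d))
    (huw : ∀ᵐ p, u p = w (koranyi p)) : ∀ᵐ p, g p = radialGrad w₁ p := by
  have hgi : ∀ i, LocallyIntegrableOn (fun p => g p i) {0}ᶜ := fun i =>
    ((hu.apply_memLp i).locallyIntegrable (by norm_num)).locallyIntegrableOn _
  have hi : ∀ i, ∀ᵐ p, g p i = w₁ (koranyi p) * (gradKoranyi i p : ℂ) := by
    intro i
    have hli : LocallyIntegrableOn
        (fun p : Heis d => gradKoranyi i p • w₁ (koranyi p)) {0}ᶜ :=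
      locallyIntegrableOn_compl_zero_smul (hP.locallyIntegrableOn_comp hw.locallyIntegrableOn)
        (continuousOn_gradKoranyi i)
    have hli3 : LocallyIntegrableOn
        (fun p : Heis d => gradKoranyi i p • (w (koranyi p) / (koranyi p : ℂ))) {0}ᶜ := by
      refine locallyIntegrableOn_compl_zero_smul ?_ (continuousOn_gradKoranyi i)
      refine hP.locallyIntegrableOn_comp (w := fun r => w r / (r : ℂ)) ?_
      exact (hw.continuousOn.div Complex.continuous_ofReal.continuousOn
        fun x hx => by exact_mod_cast (ne_of_gt hx)).locallyIntegrableOn_Ioi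
    have h0 := isOpen_compl_zero.ae_eq_zero_of_integral_contDiff_smul_eq_zero
      ((hgi i).sub hli) fun φ hφ hφc hφs => by
        have ht : IsTestFunction φ := ⟨hφ, hφc⟩
        have i2 := integrable_smul_of_tsupport hφ.continuous hφc hφs hli
        have i3 := integrable_smul_of_tsupport hφ.continuous hφc hφs hli3
        have i1 := integrable_smul_of_tsupport hφ.continuous hφc hφs (hgi i)
        have hz : MemLp (fun p => fderiv ℝ φ p (horizontalFrame i p)) 2 :=
          (IsTestFunction.continuous_fderiv_apply hφ
            (continuous_horizontalFrame i)).memLp_of_hasCompactSupport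
            (ht.hasCompactSupport_fderiv_apply _)
        have e1 := hP.integral_fderiv_frame_smul ht i hw
          (hz.integrable_smul_two (hP.memLp_comp hwL))
          (by simpa only [smul_smul] using i2) (by simpa only [smul_smul] using i3)
        have e2 := hu.weakDeriv i φ ht
        have e3 : ∫ p, fderiv ℝ φ p (horizontalFrame i p) • u p =
            ∫ p, fderiv ℝ φ p (horizontalFrame i p) • w (koranyi p) := by
          refine integral_congr_ae ?_
          filter_upwards [huw] with p hp
          rw [hp]
        rw [e3, e1, neg_inj] at e2
        simp only [Pi.sub_apply, smul_sub]
        rw [integral_sub i1 i2, ← e2, sub_eq_zero]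
        simp only [smul_smul]
    filter_upwards [h0, ae_ne_zero] with p h1 h2
    have := sub_eq_zero.1 (h1 h2)
    exact this.trans (by simp only [Complex.real_smul, mul_comm])
  filter_upwards [ae_all_iff.2 hi] with p hp
  ext i
  exact hp i

/-- A radial function in `H^1` has an absolutely continuous profile, and its gradient is given by
the derivative of the profile. -/
theorem PolarDecomposition.exists_profile (hP : PolarDecomposition c σ) (hd : 1 ≤ d)
    {u : Heis d → ℂ} {g : Heis d → EuclideanSpace ℂ (Fin d ⊕ Fin d)} (hu : MemH1 u g)
    (hrad : IsRadial u) :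
    ∃ w w₁ : ℝ → ℂ, HasACDeriv w w₁ ∧ MemLp w 2 (radialMeasure c d) ∧
      MemLp w₁ 2 (radialMeasure c d) ∧ (∀ᵐ p, u p = w (koranyi p)) ∧
      ∀ᵐ p, g p = radialGrad w₁ p := by
  obtain ⟨u₀, hu₀⟩ := hrad
  have hκ := hP.sphereMoment_pos hd
  have hui : LocallyIntegrableOn u {0}ᶜ :=
    (hu.memLp.locallyIntegrable (by norm_num)).locallyIntegrableOn _
  have hgi : ∀ i, LocallyIntegrableOn (fun p => g p i) {0}ᶜ := fun i =>
    ((hu.apply_memLp i).locallyIntegrable (by norm_num)).locallyIntegrableOn _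
  have hbi : LocallyIntegrableOn (fun p => ∑ i, gradPoly i p • g p i) {0}ᶜ := by
    refine locallyIntegrableOn_sum Finset.univ fun i => ?_
    exact locallyIntegrableOn_compl_zero_smul (hgi i) (contDiff_gradPoly i).continuous.continuousOn
  -- The exponent `k = 2` matches `2d+2+k = 2d+4`. The averaged function is `|z|²/ρ² · u`, whose
  -- average is `κ w`; hence the factor `κ⁻¹` in `w`.
  obtain ⟨A, hA, hA'⟩ := hP.exists_hasACDeriv_euler 2
    (locallyIntegrableOn_compl_zero_smul hui continuousOn_density) hbi fun F hF => by
      rw [← hu.integral_radial hF]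
      refine integral_congr_ae (Eventually.of_forall fun p => ?_)
      simp only
      congr 1
      push_cast
      ring
  have hw := hA.const_mul ((sphereMoment σ : ℂ)⁻¹)
  set w : ℝ → ℂ := fun r => (sphereMoment σ : ℂ)⁻¹ * A r with hwdef
  set w₁ : ℝ → ℂ := fun r => (sphereMoment σ : ℂ)⁻¹ *
    ((r ^ (2 + 1))⁻¹ • sphereAvg σ (fun p => ∑ i, gradPoly i p • g p i) r)
  have hκ' : (sphereMoment σ : ℂ) ≠ 0 := by exact_mod_cast hκ.ne'
  have hu0w : ∀ᵐ r : ℝ, 0 < r → u₀ r = w r := by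
    have h1 : ∀ᵐ r : ℝ, 0 < r → sphereAvg σ (fun p => (zSq p / koranyi p ^ 2) • u p) r =
        sphereAvg σ (fun p => (zSq p / koranyi p ^ 2) • u₀ (koranyi p)) r := by
      refine hP.sphereAvg_congr ?_
      filter_upwards [hu₀] with p hp
      rw [hp]
    filter_upwards [h1, hA'] with r h1 h2 h0
    rw [hwdef]
    simp only
    rw [← h2 h0, h1 h0, hP.sphereAvg_density_mul u₀ h0, inv_mul_cancel_left₀ hκ']
  have huw : ∀ᵐ p, u p = w (koranyi p) := by
    filter_upwards [hu₀, hP.ae_comp hu0w] with p h1 h2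
    rw [h1, h2]
  have hwm : AEStronglyMeasurable w (radialMeasure c d) := hw.continuousOn.aesm_radial
  have hwL : MemLp w 2 (radialMeasure c d) := by
    refine ⟨hwm, ?_⟩
    rw [← eLpNorm_comp_measurePreserving hwm hP.koranyi_preserving]
    exact (hu.memLp.ae_eq huw).2
  have hgw := hP.eq_radialGrad hu hw hwL huw
  have hw₁m : AEStronglyMeasurable w₁ (radialMeasure c d) :=
    aestronglyMeasurable_radialMeasure hw.locallyIntegrableOn
  refine ⟨w, w₁, hw, hwL, ?_, huw, hgw⟩
  -- Finiteness of `‖g‖²`, which is `κ` times the radial norm of `w₁` squared, is read backwards;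
  -- this uses `κ > 0`.
  have h1 := (memLp_two_iff_lintegral (hP.aestronglyMeasurable_radialGrad hw₁m)).1
    (hu.memLp_grad.ae_eq hgw)
  rw [hP.lintegral_radialGrad hw₁m] at h1
  rw [memLp_two_iff_lintegral hw₁m]
  refine lt_top_iff_ne_top.2 fun h => ?_
  rw [h, ENNReal.mul_top (by simpa using hκ)] at h1
  exact lt_irrefl _ h1

end Profile

/-! ### The equation satisfied by the profile. -/

section RadialEquation

variable {d : ℕ} {c : ℝ} {σ : Measure (Heis d)}

theorem IsRadialTest.memH1 (hP : PolarDecomposition c σ) (hd : 1 ≤ d) {F : ℝ → ℝ}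
    (hF : IsRadialTest F) :
    MemH1 (fun p : Heis d => (F (koranyi p) : ℂ))
      (radialGrad fun r => ((_root_.deriv F r : ℝ) : ℂ)) := by
  have hL : ∀ {G : ℝ → ℝ}, IsRadialTest G →
      MemLp (fun r => (G r : ℂ)) 2 (radialMeasure c d) := fun hG => by
    obtain ⟨a, b, ha, -, h0⟩ := hG.exists_Icc
    refine memLp_two_of_Icc (b := b) hP.c_pos ha
      (Complex.continuous_ofReal.comp hG.contDiff.continuous).continuousOn fun x _ hx => ?_
    rw [h0 x hx, Complex.ofReal_zero]
  exact hP.memH1 hd hF.hasACDeriv.ofReal (hL hF) (hL hF.deriv)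

theorem inner_radialGrad (v w : ℝ → ℂ) (p : Heis d) :
    inner ℂ (radialGrad v p) (radialGrad w p) =
      star (v (koranyi p)) * ((zSq p / koranyi p ^ 2) • w (koranyi p)) := by
  rw [PiLp.inner_apply]
  simp only [radialGrad_apply, RCLike.inner_apply, map_mul, Complex.conj_ofReal]
  rw [← sum_gradKoranyi_sq, Complex.real_smul, Complex.ofReal_sum, Finset.sum_mul, Finset.mul_sum]
  refine Finset.sum_congr rfl fun i _ => ?_
  simp only [Complex.star_def]
  push_cast
  ring

theorem ae_zNorm_pos (hd : 1 ≤ d) : ∀ᵐ p : Heis d, 0 < zNorm p := by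
  filter_upwards [ae_zSq_pos hd] with p hp
  exact Real.sqrt_pos.2 hp

theorem memLp_source {f : Heis d → ℂ} (hf : AEStronglyMeasurable f) (hN : sourceNorm f ≠ ⊤) :
    MemLp (fun p : Heis d => ((koranyi p ^ 2 / zNorm p : ℝ) : ℂ) * f p) 2 := by
  refine ⟨AEStronglyMeasurable.mul ?_ hf, lt_top_iff_ne_top.2 hN⟩
  exact (((measurable_koranyi.pow_const 2).div
    continuous_zNorm.measurable).complex_ofReal).aestronglyMeasurable

/-- Here `f` is `|z|/ρ²`, continuous off the origin, times a square integrable function. This makes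
radial test functions admissible in the weak formulation. -/
theorem locallyIntegrableOn_source (hd : 1 ≤ d) {f : Heis d → ℂ} (hf : AEStronglyMeasurable f)
    (hN : sourceNorm f ≠ ⊤) : LocallyIntegrableOn f {0}ᶜ := by
  have h1 : LocallyIntegrableOn (fun p => (zNorm p / koranyi p ^ 2) •
      (((koranyi p ^ 2 / zNorm p : ℝ) : ℂ) * f p)) {0}ᶜ :=
    locallyIntegrableOn_compl_zero_smul
      (((memLp_source hf hN).locallyIntegrable (by norm_num)).locallyIntegrableOn _)
      (continuous_zNorm.continuousOn.div (continuous_koranyi.pow 2).continuousOn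
        fun p hp => (pow_pos (koranyi_pos.2 hp) 2).ne')
  refine h1.congr (ae_restrict_of_ae ?_)
  filter_upwards [ae_zNorm_pos hd] with p hp
  have h2 : 0 < koranyi p := hp.trans_le (zNorm_le p)
  rw [Complex.real_smul, ← mul_assoc, ← Complex.ofReal_mul]
  rw [show zNorm p / koranyi p ^ 2 * (koranyi p ^ 2 / zNorm p) = 1 by field_simp]
  simp

/-- The radial part of the resolvent equation. -/
theorem PolarDecomposition.exists_radial_equation (hP : PolarDecomposition c σ) (hd : 1 ≤ d)
    {V : Heis d → ℝ} (hV : LocallyIntegrable V) {l : ℂ} {f u : Heis d → ℂ}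
    {gu : Heis d → EuclideanSpace ℂ (Fin d ⊕ Fin d)} (hf : LocallyIntegrableOn f {0}ᶜ)
    (hsol : IsWeakSolution V l f u gu) {w w₁ : ℝ → ℂ} (hw : HasACDeriv w w₁)
    (hu : ∀ᵐ p, u p = w (koranyi p)) (hgu : ∀ᵐ p, gu p = radialGrad w₁ p) :
    ∃ w₁' w₂ : ℝ → ℂ, HasACDeriv w₁' w₂ ∧ (∀ᵐ r : ℝ, 0 < r → w₁ r = w₁' r) ∧
      ∀ᵐ r : ℝ, 0 < r →
        (sphereMoment σ : ℂ) * (w₂ r + ((2 * d + 1 : ℝ) : ℂ) / (r : ℂ) * w₁' r)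
          - ((sphereAvg σ V r : ℝ) : ℂ) * w r + l * w r = sphereAvg σ f r := by
  have hκ := hP.sphereMoment_pos hd
  have hκ' : (sphereMoment σ : ℂ) ≠ 0 := by exact_mod_cast hκ.ne'
  have hai : LocallyIntegrableOn
      (fun p : Heis d => (zSq p / koranyi p ^ 2) • w₁ (koranyi p)) {0}ᶜ :=
    locallyIntegrableOn_compl_zero_smul (hP.locallyIntegrableOn_comp hw.locallyIntegrableOn)
      continuousOn_density
  have hVc : LocallyIntegrableOn (fun p => ((V p : ℝ) : ℂ)) {0}ᶜ := by
    refine LocallyIntegrable.locallyIntegrableOn (fun x => ?_) _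
    obtain ⟨s, hs, h⟩ := hV x
    exact ⟨s, hs, h.ofReal⟩
  have hcw := continuousOn_comp_koranyi (d := d) hw.continuousOn
  have hVw : LocallyIntegrableOn (fun p => w (koranyi p) * (V p : ℂ)) {0}ᶜ :=
    locallyIntegrableOn_compl_zero_smul hVc hcw
  have hlw : LocallyIntegrableOn (fun p : Heis d => w (koranyi p) * (-l)) {0}ᶜ :=
    locallyIntegrableOn_compl_zero_smul (locallyIntegrableOn_const (-l)) hcw
  have hVl : LocallyIntegrableOn (fun p => w (koranyi p) * (V p : ℂ) + w (koranyi p) * (-l)) {0}ᶜ :=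
    hVw.add hlw
  have hbi : LocallyIntegrableOn
      (fun p => (w (koranyi p) * (V p : ℂ) + w (koranyi p) * (-l)) + f p) {0}ᶜ := hVl.add hf
  -- Testing with `F ∘ ρ` is allowed: on its support `u` agrees almost everywhere with a continuous
  -- function, so `V u` is integrable there. The outcome is the divergence form of the equation,
  -- `(r^(2d+1) κ w')' = r^(2d+1) (U w - λ w + F)`.
  obtain ⟨A, hA, hA'⟩ := hP.exists_hasACDeriv hai hbi fun F hF => by
    have i1 := hF.integrable_comp_koranyi_smul hVw
    have i2 := hF.integrable_comp_koranyi_smul hlw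
    have i3 := hF.integrable_comp_koranyi_smul hf
    have j1 : Integrable (fun p => star ((F (koranyi p) : ℝ) : ℂ) * ((V p : ℂ) * u p)) := by
      refine i1.congr ?_
      filter_upwards [hu] with p hp
      rw [hp, Complex.star_def, Complex.conj_ofReal, Complex.real_smul]; ring
    have j3 : Integrable (fun p => star ((F (koranyi p) : ℝ) : ℂ) * f p) := by
      refine i3.congr (Eventually.of_forall fun p => ?_)
      simp only
      rw [Complex.star_def, Complex.conj_ofReal, Complex.real_smul]
    have h1 := hsol.equation _ _ (hF.memH1 hP hd) j1 j3
    have e0 : ∫ p, inner ℂ (radialGrad (fun r => ((deriv F r : ℝ) : ℂ)) p) (gu p) =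
        ∫ p : Heis d, deriv F (koranyi p) • ((zSq p / koranyi p ^ 2) • w₁ (koranyi p)) := by
      refine integral_congr_ae ?_
      filter_upwards [hgu] with p hp
      rw [hp, inner_radialGrad, Complex.star_def, Complex.conj_ofReal, ← Complex.real_smul]
    have e1 : ∫ p, star ((F (koranyi p) : ℝ) : ℂ) * ((V p : ℂ) * u p) =
        ∫ p, F (koranyi p) • (w (koranyi p) * (V p : ℂ)) := by
      refine integral_congr_ae ?_
      filter_upwards [hu] with p hp
      rw [hp, Complex.star_def, Complex.conj_ofReal, Complex.real_smul]; ring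
    have e2 : l * (∫ p, star ((F (koranyi p) : ℝ) : ℂ) * u p) =
        - ∫ p : Heis d, F (koranyi p) • (w (koranyi p) * (-l)) := by
      rw [← integral_const_mul, ← integral_neg]
      refine integral_congr_ae ?_
      filter_upwards [hu] with p hp
      rw [hp, Complex.star_def, Complex.conj_ofReal, Complex.real_smul]; ring
    have e3 : ∫ p, star ((F (koranyi p) : ℝ) : ℂ) * f p = ∫ p, F (koranyi p) • f p := by
      refine integral_congr_ae (Eventually.of_forall fun p => ?_)
      simp only
      rw [Complex.star_def, Complex.conj_ofReal, Complex.real_smul]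
    rw [e0, e1, e2, e3] at h1
    simp only [smul_add]
    rw [integral_add (i1.fun_add i2) i3, integral_add i1 i2, ← h1]
    ring
  have hpw : HasACDeriv (fun r : ℝ => (((r ^ (2 * d + 1))⁻¹ : ℝ) : ℂ))
      (fun r : ℝ => ((-(2 * d + 1) * (r ^ (2 * d + 2))⁻¹ : ℝ) : ℂ)) := by
    refine HasACDeriv.ofReal (.of_hasDerivAt (fun r hr => ?_) ?_)
    · have h1 := (hasDerivAt_pow (2 * d + 1) r).inv (by positivity)
      refine h1.congr_deriv ?_
      rw [show 2 * d + 1 - 1 = 2 * d by omega]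
      push_cast
      field_simp
      ring
    · refine ContinuousOn.mul continuousOn_const (ContinuousOn.inv₀ (by fun_prop) fun x hx => ?_)
      exact (pow_pos hx _).ne'
  refine ⟨_, _, (hpw.mul hA).const_mul (sphereMoment σ : ℂ)⁻¹, ?_, ?_⟩
  · filter_upwards [hA'] with r h1 h0
    rw [hP.sphereAvg_density_mul w₁ h0] at h1
    rw [← h1 h0]
    simp only [Complex.real_smul]
    push_cast
    have hr0 : (r : ℂ) ≠ 0 := by exact_mod_cast h0.ne'
    field_simp
  · filter_upwards [hP.sphereAvg_add hVl hf, hP.sphereAvg_add hVw hlw] with r h1 h2 h0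
    have e1 : sphereAvg σ (fun p => w (koranyi p) * (V p : ℂ)) r =
        w r * ((sphereAvg σ V r : ℝ) : ℂ) := by
      rw [hP.sphereAvg_radial_mul w _ h0, sphereAvg, sphereAvg, integral_complex_ofReal]
    have e2 : sphereAvg σ (fun p : Heis d => w (koranyi p) * (-l)) r = w r * (-l) := by
      have := hP.prob
      rw [hP.sphereAvg_radial_mul w (fun _ => -l) h0]
      simp [sphereAvg]
    rw [h1 h0, h2 h0, e1, e2]
    simp only [Complex.real_smul]
    push_cast
    have hr0 : (r : ℂ) ≠ 0 := by exact_mod_cast h0.ne'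
    field_simp
    ring

end RadialEquation

/-! ### Sphere averages of the potential. -/

section Potential

variable {d : ℕ} {c : ℝ} {σ : Measure (Heis d)}

/-- The real coordinate directions of `ℂ^d × ℝ`, indexed by real parts, imaginary parts, `t`. -/
noncomputable def coordVector : (Fin d ⊕ Fin d) ⊕ Unit → Heis d
  | Sum.inl (Sum.inl j) => (Pi.single j 1, 0)
  | Sum.inl (Sum.inr j) => (Pi.single j Complex.I, 0)
  | Sum.inr _ => (0, 1)

/-- The coefficients of the Euler field along `coordVector`. -/
noncomputable def eulerCoeff : (Fin d ⊕ Fin d) ⊕ Unit → (Heis d →L[ℝ] ℝ)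
  | Sum.inl (Sum.inl j) => Complex.reCLM.comp
      ((ContinuousLinearMap.proj (R := ℝ) (φ := fun _ : Fin d => ℂ) j).comp
          (ContinuousLinearMap.fst ℝ (Fin d → ℂ) ℝ))
  | Sum.inl (Sum.inr j) => Complex.imCLM.comp
      ((ContinuousLinearMap.proj (R := ℝ) (φ := fun _ : Fin d => ℂ) j).comp
          (ContinuousLinearMap.fst ℝ (Fin d → ℂ) ℝ))
  | Sum.inr _ => (2 : ℝ) • ContinuousLinearMap.snd ℝ (Fin d → ℂ) ℝ

theorem sum_eulerCoeff_smul (p : Heis d) :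
    ∑ m, eulerCoeff m p • coordVector m = (p.1, 2 * p.2) := by
  rw [Fintype.sum_sum_type, Fintype.sum_sum_type]
  refine Prod.ext ?_ ?_
  · funext j
    simp [eulerCoeff, coordVector, Prod.fst_sum, Finset.sum_apply, Pi.single_apply]
  · simp [eulerCoeff, coordVector, Prod.snd_sum]

theorem sum_eulerCoeff_coordVector :
    ∑ m, eulerCoeff m (coordVector (d := d) m) = 2 * d + 2 := by
  rw [Fintype.sum_sum_type, Fintype.sum_sum_type]
  simp [eulerCoeff, coordVector]
  ring

theorem MemW1Loc.locallyIntegrable_deriv {q : ℝ≥0∞} (hq : 1 ≤ q) {V : Heis d → ℝ}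
    {DV : Heis d → (Heis d →L[ℝ] ℝ)} (h : MemW1Loc q V DV) : LocallyIntegrable DV := by
  rw [locallyIntegrable_iff]
  intro K hK
  have : IsFiniteMeasure (volume.restrict K) := ⟨by simpa using hK.measure_lt_top⟩
  exact (h.memLpLoc_deriv K hK).integrable hq

theorem locallyIntegrable_clm_apply {DV : Heis d → (Heis d →L[ℝ] ℝ)} (h : LocallyIntegrable DV)
    (e : Heis d) : LocallyIntegrable fun p => DV p e := fun x => by
  obtain ⟨s, hs, hi⟩ := h x
  exact ⟨s, hs, (ContinuousLinearMap.apply ℝ ℝ e).integrable_comp hi⟩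

theorem euler_eq_sum (DV : Heis d → (Heis d →L[ℝ] ℝ)) (p : Heis d) :
    DV p (p.1, 2 * p.2) = ∑ m, eulerCoeff m p • DV p (coordVector m) := by
  rw [← sum_eulerCoeff_smul, map_sum]
  simp

theorem locallyIntegrableOn_euler {DV : Heis d → (Heis d →L[ℝ] ℝ)} (h : LocallyIntegrable DV) :
    LocallyIntegrableOn (fun p => DV p (p.1, 2 * p.2)) {0}ᶜ := by
  simp_rw [euler_eq_sum DV]
  refine locallyIntegrableOn_sum Finset.univ fun m => ?_
  exact locallyIntegrableOn_compl_zero_smul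
    ((locallyIntegrable_clm_apply h _).locallyIntegrableOn _) (eulerCoeff m).continuous.continuousOn

/-- The weak differential is given along constant vectors, so the Euler field is expanded in
coordinates, with its linear coefficients moved into the test functions. Its divergence is `2d+2`.
-/
theorem MemW1Loc.integral_radial {q : ℝ≥0∞} (hq : 1 ≤ q) {V : Heis d → ℝ}
    {DV : Heis d → (Heis d →L[ℝ] ℝ)} (h : MemW1Loc q V DV) (hV : LocallyIntegrable V) {F : ℝ → ℝ}
    (hF : IsRadialTest F) :
    ∫ p, (deriv F (koranyi p) * koranyi p + (2 * d + 2) * F (koranyi p)) • V p =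
      - ∫ p, F (koranyi p) • DV p (p.1, 2 * p.2) := by
  have ht := hF.isTestFunction (d := d)
  have hsm : ∀ m : (Fin d ⊕ Fin d) ⊕ Unit, ContDiff ℝ ∞ (eulerCoeff (d := d) m) := fun m =>
    (eulerCoeff m).contDiff
  have htest : ∀ m : (Fin d ⊕ Fin d) ⊕ Unit,
      IsTestFunction fun p : Heis d => eulerCoeff m p * F (koranyi p) := fun m =>
    IsTestFunction.mul (hsm m) ht
  have h1 : ∀ m, _ := fun m => h.weakDeriv (coordVector m) _ (htest m)
  have h2 := Finset.sum_congr (s₁ := Finset.univ) rfl fun m _ => h1 m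
  rw [Finset.sum_neg_distrib, ← integral_finsetSum, ← integral_finsetSum] at h2
  · convert h2 using 1
    · refine integral_congr_ae (Eventually.of_forall fun p => ?_)
      simp only
      rw [← Finset.sum_smul]
      congr 1
      simp_rw [fderiv_mul_apply (hsm _) ht.1, ContinuousLinearMap.fderiv]
      rw [Finset.sum_add_distrib, ← Finset.sum_mul, sum_eulerCoeff_coordVector,
        ← hF.fderiv_euler, ← sum_eulerCoeff_smul, map_sum]
      simp
    · congr 1
      refine integral_congr_ae (Eventually.of_forall fun p => ?_)
      simp only
      rw [euler_eq_sum, Finset.smul_sum]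
      simp only [smul_smul, mul_comm]
  · intro m _
    exact (locallyIntegrable_clm_apply (h.locallyIntegrable_deriv hq)
      _).integrable_smul_left_of_hasCompactSupport (htest m).1.continuous (htest m).2
  · intro m _
    exact hV.integrable_smul_left_of_hasCompactSupport
      (IsTestFunction.continuous_fderiv_apply (htest m).1 continuous_const)
      ((htest m).hasCompactSupport_fderiv_apply _)

/-- The sphere averages of the potential form an absolutely continuous function. -/
theorem PolarDecomposition.exists_potential_profile (hP : PolarDecomposition c σ) {q : ℝ≥0∞}
    (hq : 1 ≤ q) {V : Heis d → ℝ} {DV : Heis d → (Heis d →L[ℝ] ℝ)} (h : MemW1Loc q V DV)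
    (hV : LocallyIntegrable V) :
    ∃ U U₁ : ℝ → ℝ, HasACDeriv U U₁ ∧ (∀ᵐ r : ℝ, 0 < r → sphereAvg σ V r = U r) ∧
      ∀ᵐ r : ℝ, 0 < r → sphereAvg σ (radialDerivMul V DV) r = U r + r * U₁ r := by
  have hVi : LocallyIntegrableOn V {0}ᶜ := hV.locallyIntegrableOn _
  have hEi := locallyIntegrableOn_euler (h.locallyIntegrable_deriv hq)
  have hVc : LocallyIntegrableOn (fun p => ((V p : ℝ) : ℂ)) {0}ᶜ := fun x hx => by
    obtain ⟨s, hs, hi⟩ := hVi x hx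
    exact ⟨s, hs, hi.ofReal⟩
  have hEc : LocallyIntegrableOn (fun p : Heis d => ((DV p (p.1, 2 * p.2) : ℝ) : ℂ)) {0}ᶜ :=
    fun x hx => by
    obtain ⟨s, hs, hi⟩ := hEi x hx
    exact ⟨s, hs, hi.ofReal⟩
  obtain ⟨A, hA, hA'⟩ := hP.exists_hasACDeriv_euler 0 hVc hEc fun F hF => by
    have h1 := congrArg (fun x : ℝ => (x : ℂ)) (h.integral_radial hq hV hF)
    simp only [Complex.ofReal_neg, ← integral_complex_ofReal] at h1
    simpa using h1
  have hav : ∀ (g : Heis d → ℝ) (r : ℝ),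
      sphereAvg σ (fun p => (g p : ℂ)) r = ((sphereAvg σ g r : ℝ) : ℂ) := fun g r => by
    rw [sphereAvg, sphereAvg, integral_complex_ofReal]
  refine ⟨_, _, hA.re, ?_, ?_⟩
  · filter_upwards [hA'] with r h1 h0
    rw [← h1 h0, hav, Complex.ofReal_re]
  · have e : ∀ᵐ p : Heis d, radialDerivMul V DV p = V p + DV p (p.1, 2 * p.2) := by
      filter_upwards [ae_ne_zero] with p hp
      rw [radialDerivMul, radialDeriv, mul_inv_cancel_left₀ (koranyi_pos.2 hp).ne']
    filter_upwards [hA', hP.sphereAvg_congr e, hP.sphereAvg_add hVi hEi] with r h1 h2 h3 h0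
    rw [h2 h0, h3 h0, ← h1 h0, hav, hav, Complex.ofReal_re]
    simp only [Complex.real_smul, ← Complex.ofReal_mul, Complex.ofReal_re]
    have : r ≠ 0 := h0.ne'
    rw [zero_add, pow_one]
    field_simp

end Potential

/-! ### Norm identities and elementary integral inequalities. -/

section Norms

variable {α E : Type*} [MeasurableSpace α] [NormedAddCommGroup E] {ν : Measure α} {g : α → E}

theorem eLpNorm_two_sq (g : α → E) : eLpNorm g 2 ν ^ 2 = ∫⁻ x, ‖g x‖ₑ ^ 2 ∂ν := by
  rw [eLpNorm_eq_lintegral_rpow_enorm_toReal (by norm_num) (by norm_num), ← ENNReal.rpow_natCast,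
    ← ENNReal.rpow_mul]
  simp

theorem lintegral_enorm_sq (hg : MemLp g 2 ν) :
    ∫⁻ x, ‖g x‖ₑ ^ 2 ∂ν = ENNReal.ofReal (∫ x, ‖g x‖ ^ 2 ∂ν) := by
  rw [ofReal_integral_eq_lintegral_ofReal (integrable_norm_sq hg)
    (Eventually.of_forall fun x => by positivity)]
  refine lintegral_congr fun x => ?_
  rw [ENNReal.ofReal_pow (norm_nonneg _), ofReal_norm]

theorem eLpNorm_le_of_sq_le {C : ℝ≥0∞} (h : ∫⁻ x, ‖g x‖ₑ ^ 2 ∂ν ≤ C ^ 2) :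
    eLpNorm g 2 ν ≤ C := by
  rw [← eLpNorm_two_sq] at h
  exact (ENNReal.pow_le_pow_left_iff (by norm_num)).1 h

theorem eLpNorm_two_eq {A : ℝ} (hA : 0 ≤ A)
    (h : ∫⁻ x, ‖g x‖ₑ ^ 2 ∂ν = ENNReal.ofReal A) :
    eLpNorm g 2 ν = ENNReal.ofReal (√A) := by
  have : eLpNorm g 2 ν ^ 2 = ENNReal.ofReal (√A) ^ 2 := by
    rw [eLpNorm_two_sq, h, ← ENNReal.ofReal_pow (Real.sqrt_nonneg _), Real.sq_sqrt hA]
  exact (ENNReal.pow_right_strictMono (n := 2) (by norm_num)).injective this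

/-- Jensen's inequality for the positive part. -/
theorem ofReal_max_integral_le {h : α → ℝ} (hh : Integrable h ν) :
    ENNReal.ofReal (max 0 (∫ x, h x ∂ν)) ≤ ∫⁻ x, ENNReal.ofReal (max 0 (h x)) ∂ν := by
  have hi : Integrable (fun x => max 0 (h x)) ν := (integrable_zero _ _ _).sup hh
  rw [← ofReal_integral_eq_lintegral_ofReal hi (Eventually.of_forall fun x => le_max_left _ _)]
  refine ENNReal.ofReal_le_ofReal (max_le (integral_nonneg fun x => le_max_left _ _) ?_)
  exact integral_mono hh hi fun x => le_max_right _ _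

theorem sq_lintegral_mul_le {f g : α → ℝ≥0∞} (hf : AEMeasurable f ν) (hg : AEMeasurable g ν) :
    (∫⁻ x, f x * g x ∂ν) ^ 2 ≤ (∫⁻ x, f x ^ 2 ∂ν) * ∫⁻ x, g x ^ 2 ∂ν := by
  have h := ENNReal.lintegral_mul_le_Lp_mul_Lq ν Real.HolderConjugate.two_two hf hg
  refine (pow_le_pow_left₀ zero_le h 2).trans_eq ?_
  rw [mul_pow, ← ENNReal.rpow_natCast, ← ENNReal.rpow_natCast, ← ENNReal.rpow_mul,
    ← ENNReal.rpow_mul]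
  simp

end Norms

/-! ### Passing form bounds and the source norm to the half-line. -/

section RadialData

variable {d : ℕ} {c : ℝ} {σ : Measure (Heis d)}

/-- Restricted to `φ ∘ ρ`, the form bound contains only the sphere averages of `W` and of `|∇_ℍ
ρ|²`. Allowing any `U` below the average of `W` leaves room for Jensen's inequality. -/
theorem PolarDecomposition.radialFormBounded (hP : PolarDecomposition c σ) (hd : 1 ≤ d)
    {W : Heis d → ℝ} {U : ℝ → ℝ} {b : ℝ} (hW : FormBounded W b) (hWm : AEMeasurable W)
    (hU : AEStronglyMeasurable U (radialMeasure c d)) (hU0 : ∀ r, 0 ≤ U r)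
    (h : ∀ᵐ r : ℝ, 0 < r → ENNReal.ofReal (U r) ≤ ∫⁻ q, ENNReal.ofReal (W (dil r q)) ∂σ) :
    RadialFormBounded c d (sphereMoment σ) U b := by
  intro φ φ₁ hφ hφm hφ₁
  have hκ := (hP.sphereMoment_pos hd).le
  have hmeas : AEMeasurable (fun p : Heis d => ‖φ (koranyi p)‖ₑ ^ 2) :=
    (hP.aestronglyMeasurable_comp hφm.1).enorm.pow_const 2
  have key : ∫⁻ r, ENNReal.ofReal (U r * ‖φ r‖ ^ 2) ∂(radialMeasure c d) ≤
      ENNReal.ofReal (b ^ 2 * (sphereMoment σ * ∫ r, ‖φ₁ r‖ ^ 2 ∂(radialMeasure c d))) := by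
    have h1 := hW _ _ (hP.memH1 hd hφ hφm hφ₁)
    have hl := hP.lintegral_eq (g := fun p => ENNReal.ofReal (W p) * ‖φ (koranyi p)‖ₑ ^ 2)
      (hWm.ennreal_ofReal.mul hmeas)
    rw [hP.lintegral_radialGrad hφ₁.1, lintegral_enorm_sq hφ₁, ← ENNReal.ofReal_mul hκ,
      ← ENNReal.ofReal_mul (sq_nonneg b), hl] at h1
    refine le_trans (lintegral_mono_ae ?_) h1
    filter_upwards [ae_radialMeasure_pos hP.c_pos, (ae_radialMeasure hP.c_pos).2 h] with r hr h2
    have h3 : ∫⁻ q, ENNReal.ofReal (W (dil r q)) * ‖φ (koranyi (dil r q))‖ₑ ^ 2 ∂σ =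
        (∫⁻ q, ENNReal.ofReal (W (dil r q)) ∂σ) * ‖φ r‖ₑ ^ 2 := by
      rw [← lintegral_mul_const' _ _ (by simp)]
      refine lintegral_congr_ae ?_
      filter_upwards [hP.ae_koranyi_dil hr] with q hq
      rw [hq]
    rw [h3, ENNReal.ofReal_mul (hU0 r), ENNReal.ofReal_pow (norm_nonneg _), ofReal_norm]
    gcongr
  have hm : AEStronglyMeasurable (fun r => U r * ‖φ r‖ ^ 2) (radialMeasure c d) :=
    hU.mul (hφm.1.norm.pow 2)
  have h0 : 0 ≤ᵐ[radialMeasure c d] fun r => U r * ‖φ r‖ ^ 2 :=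
    Eventually.of_forall fun r => mul_nonneg (hU0 r) (by positivity)
  refine ⟨(lintegral_ofReal_ne_top_iff_integrable hm h0).1
    (key.trans_lt ENNReal.ofReal_lt_top).ne, ?_⟩
  rw [integral_eq_lintegral_of_nonneg_ae h0 hm]
  refine ENNReal.toReal_le_of_le_ofReal ?_ key
  have : 0 ≤ ∫ r, ‖φ₁ r‖ ^ 2 ∂(radialMeasure c d) := integral_nonneg fun r => by positivity
  positivity

/-- The sphere averages of the source. -/
theorem PolarDecomposition.lintegral_source_le (hP : PolarDecomposition c σ) (hd : 1 ≤ d)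
    {f : Heis d → ℂ} (hf : AEStronglyMeasurable f) :
    ∫⁻ r, ‖(r : ℂ) * sphereAvg σ f r‖ₑ ^ 2 ∂(radialMeasure c d) ≤
      ENNReal.ofReal (sphereMoment σ) * sourceNorm f ^ 2 := by
  have := hP.prob
  have hSm : AEMeasurable
      (fun p : Heis d => ‖((koranyi p ^ 2 / zNorm p : ℝ) : ℂ) * f p‖ₑ) := by
    have h1 : Measurable fun p : Heis d => ((koranyi p ^ 2 / zNorm p : ℝ) : ℂ) :=
      ((measurable_koranyi.pow_const 2).div continuous_zNorm.measurable).complex_ofReal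
    exact (h1.aestronglyMeasurable.mul hf).enorm
  have hz : ∫⁻ q, ENNReal.ofReal (zNorm q) ^ 2 ∂σ = ENNReal.ofReal (sphereMoment σ) := by
    rw [sphereMoment, ofReal_integral_eq_lintegral_ofReal hP.integrable_zSq
      (Eventually.of_forall zSq_nonneg)]
    refine lintegral_congr fun q => ?_
    rw [← ENNReal.ofReal_pow (zNorm_nonneg q), zNorm_sq]
  rw [sourceNorm, eLpNorm_two_sq, hP.lintegral_eq (hSm.pow_const 2),
    ← lintegral_const_mul' _ _ ENNReal.ofReal_ne_top]
  refine lintegral_mono_ae ((ae_radialMeasure hP.c_pos).2 ?_)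
  have hmr : ∀ᵐ r ∂(radialMeasure c d), AEMeasurable (fun q =>
      ‖((koranyi (dil r q) ^ 2 / zNorm (dil r q) : ℝ) : ℂ) * f (dil r q)‖ₑ) σ := by
    have h1 : AEMeasurable (fun x : ℝ × Heis d =>
        ‖((koranyi (dil x.1 x.2) ^ 2 / zNorm (dil x.1 x.2) : ℝ) : ℂ) * f (dil x.1 x.2)‖ₑ)
        ((radialMeasure c d).prod σ) :=
      hSm.comp_quasiMeasurePreserving hP.preserving.quasiMeasurePreserving
    have h2 := Measure.ae_ae_of_ae_prod h1.ae_eq_mk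
    filter_upwards [h2] with r hr
    exact ⟨_, h1.measurable_mk.comp measurable_prodMk_left, hr⟩
  filter_upwards [hP.ae_sphere (ae_zNorm_pos hd), (ae_radialMeasure hP.c_pos).1 hmr]
    with r h1 h2 h0
  rw [← hz]
  -- At `dil r q` the weight `ρ²/|z|` equals `r/|z_q|`, so `r|f|` factors as `|z_q|` times the
  -- weighted source. Cauchy-Schwarz in `q` then yields the factor `κ = ∫ |z_q|² dσ`.
  refine le_trans ?_ (sq_lintegral_mul_le
    continuous_zNorm.measurable.ennreal_ofReal.aemeasurable (h2 h0))
  gcongr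
  rw [sphereAvg, ← integral_const_mul]
  refine (enorm_integral_le_lintegral_enorm _).trans (lintegral_mono_ae ?_)
  filter_upwards [hP.sphere, hP.ae_koranyi_dil h0, h1 h0] with q hq hq' hz'
  have hzd : zNorm (dil r q) = r * zNorm q := by
    rw [← abs_of_nonneg (zNorm_nonneg (dil r q)), ← abs_of_nonneg (mul_nonneg h0.le
      (zNorm_nonneg q)), ← sq_eq_sq_iff_abs_eq_abs, mul_pow, zNorm_sq, zNorm_sq, zSq_dil]
  have hz0 : 0 < zNorm q := by
    rw [hzd] at hz'
    exact pos_of_mul_pos_right hz' h0.le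
  rw [← ofReal_norm, ← ofReal_norm, ← ENNReal.ofReal_mul hz0.le, hzd, hq']
  refine ENNReal.ofReal_le_ofReal (le_of_eq ?_)
  rw [norm_mul, norm_mul, Complex.norm_real, Complex.norm_real, Real.norm_eq_abs,
    Real.norm_eq_abs, abs_of_pos h0, abs_of_pos (by positivity)]
  field_simp

end RadialData

/-! ### The value of `κ` and the slope of the phase. -/

section Moment

variable {d : ℕ} {c : ℝ} {σ : Measure (Heis d)}

theorem integrableOn_pow_mul_exp_neg_pow_four (n : ℕ) :
    IntegrableOn (fun y : ℝ => y ^ n * Real.exp (-y ^ 4)) (Ioi 0) := by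
  have h := integrableOn_rpow_mul_exp_neg_rpow (s := n) (p := 4)
    (by linarith [n.cast_nonneg (α := ℝ)]) (by norm_num)
  exact h.congr_fun (fun x hx => by simp only [Real.rpow_natCast, Real.rpow_ofNat])
    measurableSet_Ioi

theorem integral_pow_mul_exp_neg_pow_four (n : ℕ) :
    ∫ y in Ioi (0 : ℝ), y ^ n * Real.exp (-y ^ 4) = 1 / 4 * Real.Gamma (((n : ℝ) + 1) / 4) := by
  have h := integral_rpow_mul_exp_neg_rpow (p := 4) (q := n) (by norm_num)
    (by linarith [n.cast_nonneg (α := ℝ)])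
  rw [← h]
  exact setIntegral_congr_fun measurableSet_Ioi
    fun x hx => by simp only [Real.rpow_natCast, Real.rpow_ofNat]

/-- Polar coordinates in `ℂ^d`, transported to the Euclidean norm. The constant can stay implicit
because it cancels in `sphereMoment_mul`. -/
theorem exists_integral_euclidean (hd : 1 ≤ d) : ∃ C : ℝ, ∀ f : ℝ → ℝ,
    ∫ z : Fin d → ℂ, f (√(∑ j, ‖z j‖ ^ 2)) = C * ∫ y in Ioi 0, y ^ (2 * d - 1) * f y := by
  have : Nonempty (Fin d) := ⟨⟨0, hd⟩⟩
  let e : (Fin d → ℂ) ≃L[ℝ] EuclideanSpace ℂ (Fin d) :=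
    (PiLp.continuousLinearEquiv 2 ℝ (fun _ : Fin d => ℂ)).symm
  have hfin : Module.finrank ℝ (EuclideanSpace ℂ (Fin d)) = 2 * d := by
    rw [finrank_real_of_complex, finrank_euclideanSpace_fin]
  have : (Measure.map e volume).IsAddHaarMeasure := inferInstance
  refine ⟨(2 * d : ℕ) * (Measure.map e volume).real (Metric.ball 0 1), fun f => ?_⟩
  have h := integral_fun_norm_addHaar (Measure.map e volume) f
  have he : MeasurableEmbedding e := e.toHomeomorph.measurableEmbedding
  rw [hfin, he.integral_map] at h
  simp only [smul_eq_mul, nsmul_eq_mul] at h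
  rw [← mul_assoc] at h
  rw [← h]
  refine integral_congr_ae (Eventually.of_forall fun z => ?_)
  simp only
  congr 1
  exact (EuclideanSpace.norm_eq _).symm

theorem koranyi_pow_four_eq (p : Heis d) : koranyi p ^ 4 = √(∑ j, ‖p.1 j‖ ^ 2) ^ 4 + p.2 ^ 2 := by
  rw [koranyi_pow_four, koranyi4, ← zNorm_sq, zNorm]; ring

theorem PolarDecomposition.integrable_pow_koranyi_mul_exp (hP : PolarDecomposition c σ) (n : ℕ) :
    Integrable fun p : Heis d => koranyi p ^ n * Real.exp (-koranyi p ^ 4) := by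
  refine hP.koranyi_preserving.integrable_comp_of_integrable
    (g := fun r => r ^ n * Real.exp (-r ^ 4)) ?_
  rw [integrable_radialMeasure hP.c_pos]
  refine (integrableOn_pow_mul_exp_neg_pow_four (2 * d + 1 + n)).congr_fun (fun r _ => ?_)
    measurableSet_Ioi
  simp only [smul_eq_mul]
  ring

theorem PolarDecomposition.integral_exp_neg_koranyi (hP : PolarDecomposition c σ) :
    ∫ p : Heis d, Real.exp (-koranyi p ^ 4) = c / 4 * Real.Gamma (((d : ℝ) + 1) / 2) := by
  have h1 : Integrable fun p : Heis d => Real.exp (-koranyi p ^ 4) := by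
    simpa using hP.integrable_pow_koranyi_mul_exp 0
  have h2 := integral_pow_mul_exp_neg_pow_four (2 * d + 1)
  have := hP.prob
  have h3 : ∫ r, sphereAvg σ (fun p => Real.exp (-koranyi p ^ 4)) r ∂(radialMeasure c d) =
      ∫ r, Real.exp (-r ^ 4) ∂(radialMeasure c d) := by
    refine integral_congr_ae ?_
    filter_upwards [ae_radialMeasure_pos hP.c_pos] with r hr
    have := hP.sphereAvg_radial_smul (fun r => Real.exp (-r ^ 4)) (fun _ => (1 : ℝ)) hr
    simp only [smul_eq_mul, mul_one] at this
    rw [this, sphereAvg]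
    simp
  rw [hP.integral_eq h1, h3, integral_radialMeasure hP.c_pos]
  simp only [smul_eq_mul]
  rw [h2]
  push_cast
  rw [show (2 * (d : ℝ) + 1 + 1) / 4 = (d + 1) / 2 by ring]
  ring

theorem PolarDecomposition.integral_zSq_mul_exp_neg_koranyi (hP : PolarDecomposition c σ)
    (hd : 1 ≤ d) : ∫ p : Heis d, zSq p * Real.exp (-koranyi p ^ 4) =
      sphereMoment σ * (c / 4 * (d / 2 * Real.Gamma ((d : ℝ) / 2))) := by
  have h1 : Integrable fun p : Heis d => zSq p * Real.exp (-koranyi p ^ 4) := by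
    refine (hP.integrable_pow_koranyi_mul_exp 2).mono' (measurable_zSq.mul
      (Real.measurable_exp.comp (measurable_koranyi.pow_const 4).neg)).aestronglyMeasurable
      (Eventually.of_forall fun p => ?_)
    rw [Real.norm_eq_abs, abs_of_nonneg (mul_nonneg (zSq_nonneg p) (Real.exp_pos _).le)]
    gcongr
    exact zSq_le p
  have h2 := integral_pow_mul_exp_neg_pow_four (2 * d + 3)
  have h3 : ∫ r, sphereAvg σ (fun p => zSq p * Real.exp (-koranyi p ^ 4)) r ∂(radialMeasure c d) =
      ∫ r, sphereMoment σ * (r ^ 2 * Real.exp (-r ^ 4)) ∂(radialMeasure c d) := by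
    refine integral_congr_ae ?_
    filter_upwards [ae_radialMeasure_pos hP.c_pos] with r hr
    have := hP.sphereAvg_radial_smul (fun r => Real.exp (-r ^ 4)) zSq hr
    simp only [smul_eq_mul] at this
    simp_rw [mul_comm (zSq _)]
    rw [this, sphereAvg, sphereMoment]
    simp_rw [zSq_dil]
    rw [integral_const_mul]
    ring
  rw [hP.integral_eq h1, h3, integral_radialMeasure hP.c_pos]
  simp only [smul_eq_mul]
  have h4 : ∫ r in Ioi (0 : ℝ), r ^ (2 * d + 1) * (sphereMoment σ * (r ^ 2 * Real.exp (-r ^ 4))) =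
      sphereMoment σ * ∫ r in Ioi (0 : ℝ), r ^ (2 * d + 3) * Real.exp (-r ^ 4) := by
    rw [← integral_const_mul]
    refine setIntegral_congr_fun measurableSet_Ioi fun r _ => ?_
    ring
  have hd0 : (0 : ℝ) < d := by exact_mod_cast hd
  rw [h4, h2]
  push_cast
  rw [show (2 * (d : ℝ) + 3 + 1) / 4 = d / 2 + 1 by ring, Real.Gamma_add_one (by positivity)]
  ring

/-- The mean of `|∇ρ|²` over the Koranyi sphere in terms of Gamma functions. -/
theorem PolarDecomposition.sphereMoment_mul (hP : PolarDecomposition c σ) (hd : 1 ≤ d) :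
    sphereMoment σ * ((d : ℝ) / 2 * Real.Gamma ((d : ℝ) / 2) ^ 2) =
      Real.Gamma (((d : ℝ) + 1) / 2) ^ 2 := by
  obtain ⟨C, hC⟩ := exists_integral_euclidean hd
  set n : (Fin d → ℂ) → ℝ := fun z => √(∑ j, ‖z j‖ ^ 2) with hn
  set T : ℝ := ∫ t : ℝ, Real.exp (-t ^ 2)
  have hX : ∫ z : Fin d → ℂ, Real.exp (-n z ^ 4) = C * (1 / 4 * Real.Gamma ((d : ℝ) / 2)) := by
    have h := integral_pow_mul_exp_neg_pow_four (2 * d - 1)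
    rw [Nat.cast_sub (by omega)] at h
    push_cast at h
    rw [show (2 * (d : ℝ) - 1 + 1) / 4 = d / 2 by ring] at h
    rw [← h, hC fun y => Real.exp (-y ^ 4)]
  have hY : ∫ z : Fin d → ℂ, n z ^ 2 * Real.exp (-n z ^ 4) =
      C * (1 / 4 * Real.Gamma (((d : ℝ) + 1) / 2)) := by
    have h := integral_pow_mul_exp_neg_pow_four (2 * d + 1)
    push_cast at h
    rw [show (2 * (d : ℝ) + 1 + 1) / 4 = (d + 1) / 2 by ring] at h
    rw [← h, hC fun y => y ^ 2 * Real.exp (-y ^ 4)]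
    congr 1
    refine setIntegral_congr_fun measurableSet_Ioi fun y _ => ?_
    rw [← mul_assoc, ← pow_add]
    congr 2
    omega
  -- The integrals of `exp(-ρ⁴)` and `|z|² exp(-ρ⁴)` each factor over `z` and `t`, and each is also
  -- known in Koranyi polar coordinates. Comparing the two pairs eliminates `C`, `T` and `c`.
  have hXT : (∫ z : Fin d → ℂ, Real.exp (-n z ^ 4)) * T =
      c / 4 * Real.Gamma (((d : ℝ) + 1) / 2) := by
    rw [← hP.integral_exp_neg_koranyi, ← integral_prod_mul]
    refine integral_congr_ae (Eventually.of_forall fun p => ?_)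
    simp only [koranyi_pow_four_eq, neg_add, Real.exp_add, hn]
  have hYT : (∫ z : Fin d → ℂ, n z ^ 2 * Real.exp (-n z ^ 4)) * T =
      sphereMoment σ * (c / 4 * (d / 2 * Real.Gamma ((d : ℝ) / 2))) := by
    rw [← hP.integral_zSq_mul_exp_neg_koranyi hd, ← integral_prod_mul]
    refine integral_congr_ae (Eventually.of_forall fun p => ?_)
    simp only [koranyi_pow_four_eq, neg_add, Real.exp_add, hn]
    rw [Real.sq_sqrt (by positivity), zSq, mul_assoc]
  rw [hX] at hXT
  rw [hY] at hYT
  have hc := hP.c_pos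
  have : c / 4 * Real.Gamma (((d : ℝ) + 1) / 2) ^ 2 =
      c / 4 * (sphereMoment σ * ((d : ℝ) / 2 * Real.Gamma ((d : ℝ) / 2) ^ 2)) := by
    calc _ = (c / 4 * Real.Gamma (((d : ℝ) + 1) / 2)) * Real.Gamma (((d : ℝ) + 1) / 2) := by ring
      _ = (C * (1 / 4 * Real.Gamma (((d : ℝ) + 1) / 2)) * T) * Real.Gamma ((d : ℝ) / 2) := by
        rw [← hXT]; ring
      _ = _ := by rw [hYT]; ring
  exact (mul_left_cancel₀ (by positivity) this).symm

/-- The slope of the phase as a function of the Koranyi norm. -/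
noncomputable def phaseSlope (d : ℕ) (l : ℂ) : ℝ :=
  √((d : ℝ) / 2) * (Real.Gamma ((d : ℝ) / 2) / Real.Gamma (((d : ℝ) + 1) / 2)) * sgn l.im *
    √|l.re|

theorem sgn_sq (x : ℝ) : sgn x ^ 2 = 1 := by
  unfold sgn
  split_ifs with h
  · simp
  · rw [div_pow, sq_abs, div_self (pow_ne_zero 2 h)]

theorem mul_sgn (x : ℝ) : x * sgn x = |x| := by
  unfold sgn
  split_ifs with h
  · simp [h]
  · rw [← mul_div_assoc, ← abs_mul_abs_self, mul_div_assoc, div_self (abs_pos.2 h).ne', mul_one]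

/-- The square root and the Gamma quotient in the phase are together exactly `κ^(-1/2)`. -/
theorem PolarDecomposition.sphereMoment_mul_phaseSlope_sq (hP : PolarDecomposition c σ)
    (hd : 1 ≤ d) (l : ℂ) : sphereMoment σ * phaseSlope d l ^ 2 = |l.re| := by
  have hA : 0 < Real.Gamma (((d : ℝ) + 1) / 2) := Real.Gamma_pos_of_pos (by positivity)
  have h := hP.sphereMoment_mul hd
  rw [phaseSlope, mul_pow, mul_pow, mul_pow, sgn_sq, Real.sq_sqrt (by positivity),
    Real.sq_sqrt (abs_nonneg _), div_pow, ← h]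
  have hd0 : (0 : ℝ) < d := by exact_mod_cast hd
  have := hP.sphereMoment_pos hd
  have hB : 0 < Real.Gamma ((d : ℝ) / 2) := Real.Gamma_pos_of_pos (by positivity)
  field_simp

/-- The purpose of the sign in the phase: it makes the multiplier parameter `τ` nonnegative. -/
theorem im_mul_phaseSlope_nonneg (d : ℕ) (l : ℂ) : 0 ≤ l.im * phaseSlope d l := by
  have hA : 0 < Real.Gamma (((d : ℝ) + 1) / 2) := Real.Gamma_pos_of_pos (by positivity)
  have hB : 0 ≤ Real.Gamma ((d : ℝ) / 2) := Real.Gamma_nonneg_of_nonneg (by positivity)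
  have : l.im * phaseSlope d l = |l.im| * (√((d : ℝ) / 2) *
      (Real.Gamma ((d : ℝ) / 2) / Real.Gamma (((d : ℝ) + 1) / 2)) * √|l.re|) := by
    rw [← mul_sgn, phaseSlope]; ring
  rw [this]
  positivity

theorem uMinus_eq (l : ℂ) (u : Heis d → ℂ) (p : Heis d) :
    uMinus l u p = phaseFactor (phaseSlope d l) (koranyi p) * u p := by
  rw [uMinus, phaseFactor, phase, phaseSlope]

end Moment

/-! ### Reduction of the group problem to the radial equation. -/

section Reduction

variable {d : ℕ} {c : ℝ} {σ : Measure (Heis d)}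

theorem MemH1.congr {u u' : Heis d → ℂ} {g g' : Heis d → EuclideanSpace ℂ (Fin d ⊕ Fin d)}
    (h : MemH1 u g) (hu : ∀ᵐ p, u p = u' p) (hg : ∀ᵐ p, g p = g' p) : MemH1 u' g' := by
  refine ⟨h.memLp.ae_eq hu, h.memLp_grad.ae_eq hg, fun i φ hφ => ?_⟩
  have h1 := h.weakDeriv i φ hφ
  have e1 : ∫ p, fderiv ℝ φ p (horizontalFrame i p) • u p =
      ∫ p, fderiv ℝ φ p (horizontalFrame i p) • u' p :=
    integral_congr_ae (by filter_upwards [hu] with p hp; rw [hp])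
  have e2 : ∫ p, φ p • g p i = ∫ p, φ p • g' p i :=
    integral_congr_ae (by filter_upwards [hg] with p hp; rw [hp])
  rw [← e1, ← e2, h1]

theorem PolarDecomposition.eLpNorm_radialGrad (hP : PolarDecomposition c σ) (hd : 1 ≤ d)
    {w₁ : ℝ → ℂ} (hw₁ : MemLp w₁ 2 (radialMeasure c d)) :
    eLpNorm (radialGrad (d := d) w₁) 2 volume =
      ENNReal.ofReal √(sphereMoment σ * ∫ r, ‖w₁ r‖ ^ 2 ∂(radialMeasure c d)) := by
  have hκ := (hP.sphereMoment_pos hd).le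
  have h0 : 0 ≤ ∫ r, ‖w₁ r‖ ^ 2 ∂(radialMeasure c d) := integral_nonneg fun r => by positivity
  refine eLpNorm_two_eq (by positivity) ?_
  rw [hP.lintegral_radialGrad hw₁.1, lintegral_enorm_sq hw₁, ENNReal.ofReal_mul hκ]

/-- The Hardy inequality for radial functions. -/
theorem PolarDecomposition.hardyNorm_le (hP : PolarDecomposition c σ) (hd : 1 ≤ d)
    {w w₁ : ℝ → ℂ} (h : HasACDeriv w w₁) (hw : MemLp w 2 (radialMeasure c d))
    (hw₁ : MemLp w₁ 2 (radialMeasure c d)) :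
    hardyNorm (fun p : Heis d => w (koranyi p)) ≤
      ENNReal.ofReal (1 / d) * eLpNorm (radialGrad (d := d) w₁) 2 volume := by
  have hκ := (hP.sphereMoment_pos hd).le
  obtain ⟨hi, hle⟩ := radial_hardy hP.c_pos hd h hw hw₁
  refine eLpNorm_le_of_sq_le ?_
  have h1 : ∫⁻ p : Heis d, ‖((zNorm p / koranyi p ^ 2 : ℝ) : ℂ) * w (koranyi p)‖ₑ ^ 2 =
      ∫⁻ p : Heis d, ENNReal.ofReal (‖w (koranyi p)‖ ^ 2 / koranyi p ^ 2) *
        ENNReal.ofReal (zSq p / koranyi p ^ 2) := by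
    refine lintegral_congr fun p => ?_
    rw [← ofReal_norm, ← ENNReal.ofReal_pow (norm_nonneg _), ← ENNReal.ofReal_mul (by positivity),
      norm_mul, Complex.norm_real, mul_pow, Real.norm_eq_abs, sq_abs, div_pow, zNorm_sq]
    congr 1
    rw [div_mul_div_comm, div_mul_eq_mul_div]
    ring
  rw [h1, hP.lintegral_mul_density (F := fun r => ENNReal.ofReal (‖w r‖ ^ 2 / r ^ 2))
    hi.1.aemeasurable.ennreal_ofReal, ← ofReal_integral_eq_lintegral_ofReal hi
    (Eventually.of_forall fun r => by positivity), mul_pow, eLpNorm_two_sq,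
    hP.lintegral_radialGrad hw₁.1, lintegral_enorm_sq hw₁, ← ENNReal.ofReal_mul hκ,
    ← ENNReal.ofReal_mul hκ, ← ENNReal.ofReal_pow (by positivity),
    ← ENNReal.ofReal_mul (by positivity)]
  refine ENNReal.ofReal_le_ofReal ((mul_le_mul_of_nonneg_left hle hκ).trans_eq ?_)
  ring

theorem MemW1Loc.locallyIntegrableOn_radialDerivMul {q : ℝ≥0∞} (hq : 1 ≤ q) {V : Heis d → ℝ}
    {DV : Heis d → (Heis d →L[ℝ] ℝ)} (h : MemW1Loc q V DV) (hV : LocallyIntegrable V) :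
    LocallyIntegrableOn (radialDerivMul V DV) {0}ᶜ := by
  have e : ∀ᵐ p : Heis d, V p + DV p (p.1, 2 * p.2) = radialDerivMul V DV p := by
    filter_upwards [ae_ne_zero] with p hp
    rw [radialDerivMul, radialDeriv, mul_inv_cancel_left₀ (koranyi_pos.2 hp).ne']
  intro x hx
  obtain ⟨s, hs, hi⟩ := (hV.locallyIntegrableOn {0}ᶜ).add
    (locallyIntegrableOn_euler (h.locallyIntegrable_deriv hq)) x hx
  exact ⟨s, hs, hi.congr (ae_restrict_of_ae e)⟩

theorem _root_.MeasureTheory.LocallyIntegrableOn.aestronglyMeasurable_compl_zero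
    {g : Heis d → ℝ} (hg : LocallyIntegrableOn g {0}ᶜ) : AEStronglyMeasurable g := by
  have := hg.aestronglyMeasurable
  rwa [restrict_compl_singleton] at this

/-- The positive part of an average is at most the average of the positive part, so a form bound for
a nonradial potential passes to its sphere average. -/
theorem PolarDecomposition.radialFormBounded_max (hP : PolarDecomposition c σ) (hd : 1 ≤ d)
    {g : Heis d → ℝ} {U : ℝ → ℝ} {b : ℝ} (hW : FormBounded (fun p => max 0 (g p)) b)
    (hg : LocallyIntegrableOn g {0}ᶜ)
    (hU : AEStronglyMeasurable U (radialMeasure c d))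
    (h : ∀ᵐ r : ℝ, 0 < r → sphereAvg σ g r = U r) :
    RadialFormBounded c d (sphereMoment σ) (fun r => max 0 (U r)) b := by
  refine hP.radialFormBounded hd hW
    (aemeasurable_const.max hg.aestronglyMeasurable_compl_zero.aemeasurable)
    (aemeasurable_const.max hU.aemeasurable).aestronglyMeasurable (fun r => le_max_left _ _) ?_
  filter_upwards [h, hP.ae_integrable_sphere hg] with r h1 h2 h0
  rw [← h1 h0]
  exact ofReal_max_integral_le (h2 h0)

theorem PolarDecomposition.memLp_sphereAvg_source (hP : PolarDecomposition c σ) (hd : 1 ≤ d)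
    {f : Heis d → ℂ} (hf : AEStronglyMeasurable f) (hN : sourceNorm f ≠ ⊤) :
    MemLp (fun r : ℝ => (r : ℂ) * sphereAvg σ f r) 2 (radialMeasure c d) ∧
      ENNReal.ofReal √((∫ r, ‖(r : ℂ) * sphereAvg σ f r‖ ^ 2 ∂(radialMeasure c d)) /
        sphereMoment σ) ≤ sourceNorm f := by
  have hκ := hP.sphereMoment_pos hd
  have hm : AEStronglyMeasurable (fun r : ℝ => (r : ℂ) * sphereAvg σ f r) (radialMeasure c d) :=
    (Complex.continuous_ofReal.aestronglyMeasurable).mul (aestronglyMeasurable_radialMeasure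
      (hP.locallyIntegrableOn_sphereAvg (locallyIntegrableOn_source hd hf hN)))
  have h := hP.lintegral_source_le hd hf
  have hM := (memLp_two_iff_lintegral hm).2 (h.trans_lt
    (ENNReal.mul_lt_top ENNReal.ofReal_lt_top (ENNReal.pow_lt_top (lt_top_iff_ne_top.2 hN))))
  refine ⟨hM, ?_⟩
  have h0 : 0 ≤ ∫ r, ‖(r : ℂ) * sphereAvg σ f r‖ ^ 2 ∂(radialMeasure c d) :=
    integral_nonneg fun r => by positivity
  rw [← ENNReal.pow_le_pow_left_iff two_ne_zero, ← ENNReal.ofReal_pow (Real.sqrt_nonneg _),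
    Real.sq_sqrt (by positivity), ENNReal.ofReal_div_of_pos hκ]
  rw [lintegral_enorm_sq hM] at h
  exact ENNReal.div_le_of_le_mul' h

/-- Reduction to the radial ordinary differential equation. -/
theorem PolarDecomposition.exists_radialSolution (hP : PolarDecomposition c σ) (hd : 1 ≤ d)
    {q : ℝ≥0∞} (hq : 1 ≤ q) {V : Heis d → ℝ} {DV : Heis d → (Heis d →L[ℝ] ℝ)}
    (hV : LocallyIntegrable V) (hDV : MemW1Loc q V DV) {b₁ b₂ : ℝ}
    (hVneg : FormBounded (fun p => max 0 (-V p)) b₁)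
    (hVrad : FormBounded (fun p => max 0 (radialDerivMul V DV p)) b₂)
    {l : ℂ} {f u : Heis d → ℂ} {gu : Heis d → EuclideanSpace ℂ (Fin d ⊕ Fin d)}
    (hf : AEStronglyMeasurable f) (hN : sourceNorm f ≠ ⊤) (hsol : IsWeakSolution V l f u gu)
    {w w₁ : ℝ → ℂ} (hw : HasACDeriv w w₁) (hwm : MemLp w 2 (radialMeasure c d))
    (hw₁ : MemLp w₁ 2 (radialMeasure c d)) (hu : ∀ᵐ p, u p = w (koranyi p))
    (hgu : ∀ᵐ p, gu p = radialGrad w₁ p) :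
    ∃ (U U₁ : ℝ → ℝ) (w₁' w₂ : ℝ → ℂ),
      RadialSolution c d (sphereMoment σ) U l (sphereAvg σ f) w w₁' w₂ ∧ HasACDeriv U U₁ ∧
      RadialFormBounded c d (sphereMoment σ) (fun r => max 0 (-U r)) b₁ ∧
      RadialFormBounded c d (sphereMoment σ) (fun r => max 0 (U r + r * U₁ r)) b₂ ∧
      w₁ =ᵐ[radialMeasure c d] w₁' := by
  obtain ⟨w₁', w₂, h1, h2, h3⟩ := hP.exists_radial_equation hd hV
    (locallyIntegrableOn_source hd hf hN) hsol hw hu hgu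
  obtain ⟨U, U₁, hU, hUV, hUr⟩ := hP.exists_potential_profile hq hDV hV
  have e : w₁ =ᵐ[radialMeasure c d] w₁' := (ae_radialMeasure hP.c_pos).2 h2
  refine ⟨U, U₁, w₁', w₂, ⟨hP.c_pos, hd, hP.sphereMoment_pos hd, hU.continuousOn,
    hw.congr_deriv h2, h1, hwm, hw₁.ae_eq e, (hP.memLp_sphereAvg_source hd hf hN).1, ?_⟩, hU,
    ?_, ?_, e⟩
  · filter_upwards [h3, hUV] with r h4 h5 h0
    rw [← h4 h0, h5 h0]
  · refine hP.radialFormBounded_max hd hVneg (hV.neg.locallyIntegrableOn _)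
      (U := fun r => -U r) hU.continuousOn.neg.aesm_radial ?_
    filter_upwards [hUV] with r h4 h0
    rw [← h4 h0, sphereAvg, sphereAvg, ← integral_neg]
  · refine hP.radialFormBounded_max hd hVrad (hDV.locallyIntegrableOn_radialDerivMul hq hV)
      (U := fun r => U r + r * U₁ r) (hU.continuousOn.aesm_radial.add
        (continuous_id.aestronglyMeasurable.mul
          (aestronglyMeasurable_radialMeasure hU.locallyIntegrableOn_real))) hUr

theorem ofReal_mul_eq_top {C : ℝ} {N : ℝ≥0∞} (hC : 0 < C) (hN : N = ⊤) :
    ENNReal.ofReal C * N = ⊤ := by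
  rw [hN, ENNReal.mul_top (by simpa using hC)]

end Reduction

/-! ### The two gradient estimates on the group. -/

section Cones

variable {d : ℕ} {c : ℝ} {σ : Measure (Heis d)} {q : ℝ≥0∞} {V : Heis d → ℝ}
  {DV : Heis d → (Heis d →L[ℝ] ℝ)} {b₁ b₂ δ : ℝ} {l : ℂ} {f u : Heis d → ℂ}
  {gu : Heis d → EuclideanSpace ℂ (Fin d ⊕ Fin d)} {w w₁ : ℝ → ℂ}

theorem PolarDecomposition.eLpNorm_le_outside_cone (hP : PolarDecomposition c σ) (hd : 1 ≤ d)
    (hq : 1 ≤ q) (hV : LocallyIntegrable V) (hDV : MemW1Loc q V DV)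
    (hb₁ : 0 ≤ b₁) (hb₁' : b₁ < 1)
    (hVneg : FormBounded (fun p => max 0 (-V p)) b₁)
    (hVrad : FormBounded (fun p => max 0 (radialDerivMul V DV p)) b₂)
    (hf : AEStronglyMeasurable f) (hsol : IsWeakSolution V l f u gu)
    (hw : HasACDeriv w w₁) (hwm : MemLp w 2 (radialMeasure c d))
    (hw₁ : MemLp w₁ 2 (radialMeasure c d)) (hu : ∀ᵐ p, u p = w (koranyi p))
    (hgu : ∀ᵐ p, gu p = radialGrad w₁ p) (hδ : 0 < δ) (hl : δ * l.re < |l.im|) :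
    eLpNorm gu 2 volume ≤
      ENNReal.ofReal ((1 + 1 / δ) / (d * (1 - b₁ ^ 2))) * sourceNorm f := by
  have hβ := one_sub_sq_pos hb₁ hb₁'
  have hdp : (0 : ℝ) < d := by exact_mod_cast hd
  have hC : 0 < (1 + 1 / δ) / (d * (1 - b₁ ^ 2)) := by positivity
  -- An infinite source norm makes the bound trivial because the constant is positive; otherwise `f`
  -- is locally integrable off the origin.
  by_cases hN : sourceNorm f = ⊤
  · rw [ofReal_mul_eq_top hC hN]; exact le_top
  obtain ⟨U, U₁, w₁', w₂, hR, -, hneg, -, e⟩ := hP.exists_radialSolution hd hq hV hDV hVneg hVrad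
    hf hN hsol hw hwm hw₁ hu hgu
  have h := hR.estimate_outside_cone hb₁ hb₁' hneg hδ hl
  have hi : ∫ r, ‖w₁ r‖ ^ 2 ∂(radialMeasure c d) = ∫ r, ‖w₁' r‖ ^ 2 ∂(radialMeasure c d) :=
    integral_congr_ae (e.mono fun r hr => by simp only [hr])
  rw [eLpNorm_congr_ae hgu, hP.eLpNorm_radialGrad hd hw₁, hi]
  refine (ENNReal.ofReal_le_ofReal h).trans ?_
  rw [ENNReal.ofReal_mul hC.le]
  gcongr
  exact (hP.memLp_sphereAvg_source hd hf hN).2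

theorem memLp_phase_deriv {ν : Measure ℝ} (k : ℝ) (hw : MemLp w 2 ν) (hw₁ : MemLp w₁ 2 ν) :
    MemLp (fun r => phaseFactor k r * (w₁ r - Complex.I * k * w r)) 2 ν :=
  memLp_phase k (hw₁.sub (hw.const_mul _))

theorem PolarDecomposition.memH1_uMinus (hP : PolarDecomposition c σ) (hd : 1 ≤ d)
    (hw : HasACDeriv w w₁) (hwm : MemLp w 2 (radialMeasure c d))
    (hw₁ : MemLp w₁ 2 (radialMeasure c d)) (hu : ∀ᵐ p, u p = w (koranyi p)) (l : ℂ) :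
    MemH1 (uMinus l u) (radialGrad fun r => phaseFactor (phaseSlope d l) r *
      (w₁ r - Complex.I * phaseSlope d l * w r)) := by
  refine (hP.memH1 hd (hw.phase (phaseSlope d l)) (memLp_phase _ hwm)
    (memLp_phase_deriv _ hwm hw₁)).congr ?_ (Eventually.of_forall fun _ => rfl)
  filter_upwards [hu] with p hp
  rw [uMinus_eq, hp]

/-- The phase factor has modulus one, so Hardy's inequality for `u^-` bounds the weighted norm of
`u`. -/
theorem PolarDecomposition.hardyNorm_le_uMinus (hP : PolarDecomposition c σ) (hd : 1 ≤ d)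
    (hw : HasACDeriv w w₁) (hwm : MemLp w 2 (radialMeasure c d))
    (hw₁ : MemLp w₁ 2 (radialMeasure c d)) (hu : ∀ᵐ p, u p = w (koranyi p)) (l : ℂ) :
    hardyNorm u ≤ ENNReal.ofReal (1 / d) *
      eLpNorm (radialGrad (d := d) fun r => phaseFactor (phaseSlope d l) r *
        (w₁ r - Complex.I * phaseSlope d l * w r)) 2 volume := by
  refine le_trans (le_of_eq ?_) (hP.hardyNorm_le hd (hw.phase (phaseSlope d l))
    (memLp_phase _ hwm) (memLp_phase_deriv _ hwm hw₁))
  refine eLpNorm_congr_norm_ae ?_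
  filter_upwards [hu] with p hp
  rw [hp, norm_mul, norm_mul, norm_mul, norm_phaseFactor, one_mul]

theorem PolarDecomposition.eLpNorm_le_inside_cone (hP : PolarDecomposition c σ) (hd : 1 ≤ d)
    (hq : 1 ≤ q) (hV : LocallyIntegrable V) (hDV : MemW1Loc q V DV)
    (hb₁ : 0 ≤ b₁) (hb₁' : b₁ < 1) (hb₂ : 0 ≤ b₂) (hb₂' : b₂ < 1)
    (hVneg : FormBounded (fun p => max 0 (-V p)) b₁)
    (hVrad : FormBounded (fun p => max 0 (radialDerivMul V DV p)) b₂)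
    (hf : AEStronglyMeasurable f) (hsol : IsWeakSolution V l f u gu)
    (hw : HasACDeriv w w₁) (hwm : MemLp w 2 (radialMeasure c d))
    (hw₁ : MemLp w₁ 2 (radialMeasure c d)) (hu : ∀ᵐ p, u p = w (koranyi p))
    (hgu : ∀ᵐ p, gu p = radialGrad w₁ p) (hδ : 0 < δ) (hl : |l.im| ≤ δ * l.re) :
    eLpNorm (radialGrad (d := d) fun r => phaseFactor (phaseSlope d l) r *
        (w₁ r - Complex.I * phaseSlope d l * w r)) 2 volume ≤
      ENNReal.ofReal (MConst d b₂ δ) * sourceNorm f := by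
  have hC := MConst_pos hd hb₂ hb₂' hδ
  by_cases hN : sourceNorm f = ⊤
  · rw [ofReal_mul_eq_top hC hN]; exact le_top
  obtain ⟨U, U₁, w₁', w₂, hR, hU, hneg, hrad, e⟩ := hP.exists_radialSolution hd hq hV hDV hVneg
    hVrad hf hN hsol hw hwm hw₁ hu hgu
  have hre : 0 ≤ l.re := nonneg_of_mul_nonneg_right ((abs_nonneg _).trans hl) hδ
  have hk : sphereMoment σ * phaseSlope d l ^ 2 = l.re := by
    rw [hP.sphereMoment_mul_phaseSlope_sq hd, abs_of_nonneg hre]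
  obtain ⟨T, -, hT, h⟩ := hR.estimate_inside_cone hU hb₁ hb₁' hneg hrad hδ hl hk
    (im_mul_phaseSlope_nonneg d l) rfl rfl
  -- The estimate holds for every admissible pair of parameters and is used at the minimizing one.
  obtain ⟨γ₁, γ₂, h₁, h₂, h₂', hM⟩ := (isLeast_MConst hd hb₂ hb₂' hδ).1
  have hX := le_gConst_mul hd hδ hb₂ hb₂' h₁ h₂ h₂' (Real.sqrt_nonneg _) (Real.sqrt_nonneg _) hT h
  rw [← hM] at hX
  have hi : ∫ r, ‖phaseFactor (phaseSlope d l) r *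
        (w₁ r - Complex.I * phaseSlope d l * w r)‖ ^ 2 ∂(radialMeasure c d) =
      ∫ r, ‖phaseFactor (phaseSlope d l) r *
        (w₁' r - Complex.I * phaseSlope d l * w r)‖ ^ 2 ∂(radialMeasure c d) :=
    integral_congr_ae (e.mono fun r hr => by simp only [hr])
  rw [hP.eLpNorm_radialGrad hd (memLp_phase_deriv _ hwm hw₁), hi]
  refine (ENNReal.ofReal_le_ofReal hX).trans ?_
  rw [ENNReal.ofReal_mul hC.le]
  gcongr
  exact (hP.memLp_sphereAvg_source hd hf hN).2

end Cones

end HeisenbergResolvent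


/-! ### The resolvent estimate. -/

theorem theorem2p4 (d : ℕ) (hd : 1 ≤ d)
    (V : HeisenbergResolvent.Heis d → ℝ)
    (DV : HeisenbergResolvent.Heis d → (HeisenbergResolvent.Heis d →L[ℝ] ℝ))
    (hV : LocallyIntegrable V) (hDV : HeisenbergResolvent.MemW1Loc (d : ℝ≥0∞) V DV)
    (b₁ b₂ : ℝ) (hb₁ : 0 ≤ b₁) (hb₁' : b₁ < 1) (hb₂ : 0 ≤ b₂) (hb₂' : b₂ < 1)
    (hVneg : HeisenbergResolvent.FormBounded (fun p => max 0 (-V p)) b₁)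
    (hVrad : HeisenbergResolvent.FormBounded
      (fun p => max 0 (HeisenbergResolvent.radialDerivMul V DV p)) b₂)
    (l : ℂ) (f : HeisenbergResolvent.Heis d → ℂ) (hf : AEStronglyMeasurable f)
    (u : HeisenbergResolvent.Heis d → ℂ)
    (gu : HeisenbergResolvent.Heis d → EuclideanSpace ℂ (Fin d ⊕ Fin d))
    (hsol : HeisenbergResolvent.IsWeakSolution V l f u gu)
    (hrad : HeisenbergResolvent.IsRadial u) :
    -- for each opening `δ`: the bound outside the cone, the bound inside it, and the fact that
    -- the minimum defining `M_{d,b₂}(δ)` is attained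
    (∀ δ : ℝ, 0 < δ →
      (δ * l.re < |l.im| →
        eLpNorm gu 2 volume ≤
          ENNReal.ofReal ((1 + 1 / δ) / (d * (1 - b₁ ^ 2))) *
            HeisenbergResolvent.sourceNorm f) ∧
      (|l.im| ≤ δ * l.re →
        ∃ gm : HeisenbergResolvent.Heis d → EuclideanSpace ℂ (Fin d ⊕ Fin d),
          HeisenbergResolvent.MemH1 (HeisenbergResolvent.uMinus l u) gm ∧
          eLpNorm gm 2 volume ≤
            ENNReal.ofReal (HeisenbergResolvent.MConst d b₂ δ) *
              HeisenbergResolvent.sourceNorm f) ∧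
      IsLeast (HeisenbergResolvent.MValues d b₂ δ) (HeisenbergResolvent.MConst d b₂ δ)) ∧
    -- the uniform bound, and the fact that the minimum defining `μ_{d,b₁,b₂}` is attained
    HeisenbergResolvent.hardyNorm u ≤
      ENNReal.ofReal (HeisenbergResolvent.μConst d b₁ b₂) *
        HeisenbergResolvent.sourceNorm f ∧
    IsLeast (HeisenbergResolvent.μValues d b₁ b₂) (HeisenbergResolvent.μConst d b₁ b₂) := by
  obtain ⟨c, σ, hP⟩ := HeisenbergResolvent.exists_polarDecomposition d
  have hq : (1 : ℝ≥0∞) ≤ d := by exact_mod_cast hd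
  have hdp : (0 : ℝ) < d := by exact_mod_cast hd
  obtain ⟨w, w₁, hw, hwm, hw₁, hu, hgu⟩ := hP.exists_profile hd hsol.memH1 hrad
  have hout := fun (δ : ℝ) (hδ : 0 < δ) (hl : δ * l.re < |l.im|) =>
    hP.eLpNorm_le_outside_cone hd hq hV hDV hb₁ hb₁' hVneg hVrad hf hsol hw hwm hw₁ hu hgu hδ hl
  have hin := fun (δ : ℝ) (hδ : 0 < δ) (hl : |l.im| ≤ δ * l.re) =>
    hP.eLpNorm_le_inside_cone hd hq hV hDV hb₁ hb₁' hb₂ hb₂' hVneg hVrad hf hsol hw hwm hw₁ hu hgu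
      hδ hl
  have hμ := HeisenbergResolvent.isLeast_μConst hd hb₁ hb₁' hb₂ hb₂'
  refine ⟨fun δ hδ => ⟨hout δ hδ, fun hl => ⟨_, hP.memH1_uMinus hd hw hwm hw₁ hu l, hin δ hδ hl⟩,
    HeisenbergResolvent.isLeast_MConst hd hb₂ hb₂' hδ⟩, ?_, hμ⟩
  -- Take the opening `δ` at which the minimum is attained. Either side of this cone yields one
  -- entry of the maximum, with the extra `1/d` coming from Hardy's inequality.
  obtain ⟨δ, hδ, hμδ⟩ := hμ.1
  rw [hμδ]
  rcases lt_or_ge (δ * l.re) |l.im| with hl | hl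
  · have h1 : HeisenbergResolvent.hardyNorm u ≤ ENNReal.ofReal (1 / d) * eLpNorm gu 2 volume := by
      rw [eLpNorm_congr_ae hgu]
      refine le_trans (le_of_eq (eLpNorm_congr_ae ?_)) (hP.hardyNorm_le hd hw hwm hw₁)
      filter_upwards [hu] with p hp
      rw [hp]
    refine (h1.trans (mul_le_mul_right (hout δ hδ hl) _)).trans ?_
    rw [← mul_assoc, ← ENNReal.ofReal_mul (by positivity)]
    gcongr
    refine le_trans (le_of_eq ?_) (le_max_left _ _)
    rw [div_mul_div_comm, one_mul, sq (d : ℝ), mul_assoc]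
  · refine ((hP.hardyNorm_le_uMinus hd hw hwm hw₁ hu l).trans
      (mul_le_mul_right (hin δ hδ hl) _)).trans ?_
    rw [← mul_assoc, ← ENNReal.ofReal_mul (by positivity)]
    gcongr
    refine le_trans (le_of_eq ?_) (le_max_right _ _)
    ring
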